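/- **Setting.** Let $M>0$ and let $m:[0,M]\to[0,\infty)$ be continuous and concave with $m(0)=0$, such that $\theta(\rho)=m(\rho)/\rho$ is bounded on $(0,M]$. For $p>1$ put $\phi_{p,m}(\rho,j)=|j|^p/m(\rho)^{p-1}$ if $\rho\in[0,M]$ and $m(\rho)>0$, $\phi_{p,m}(\rho,0)=0$ if $\rho\in[0,M]$ and $m(\rho)=0$, and $\phi_{p,m}(\rho,j)=+\infty$ otherwise. For a probability measure $\mu$ and a finite signed measure $\nu$ on $\mathbb R$ let $\Phi_{p,m}(\mu,\nu)=\int_{\mathbb R}\phi_{p,m}(\rho,j)\,dx$ if $\mu=\rho\,dx$ and $\nu=j\,dx$, and $\Phi_{p,m}(\mu,\nu)=+\infty$ otherwise. Let $\mathsf{CE}$ be the set of families $(\mu_t,\nu_t)_{t\in[0,1]}$ such that $t\mapsto\mu_t$ is a vaguely continuous curve of probability measures on $\mathbb R$, $(\nu_t)_t$ is a Borel family of finite signed measures on $\mathbb R$, $\int_0^1\nu_t\,dt$ is a locally finite measure on $(0,1)\times\mathbb R$, and $\partial_t\mu_t+\partial_x\nu_t=0$ in the sense of distributions on $(0,1)\times\mathbb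 R$, i.e. tested against all $\xi\in C^1_c((0,1)\times\mathbb R)$. For a compact set $K\subset\mathbb R$ and constants $0<l\le\tilde M<M$, a family $(\tilde\mu_t,\tilde\nu_t)\in\mathsf{CE}$ is called a *regular curve* (with $K,l,\tilde M$) if for every $t\in[0,1]$ the measures $\tilde\mu_t$ and $\tilde\nu_t$ have compact connected supports contained in $K$ (the empty set counts as connected, for $\tilde\nu_t=0$), are absolutely continuous with respect to Lebesgue measure with densities $\tilde\rho_t$, $\tilde j_t$ that are $C^\infty$ on the respective supports, and $l<\tilde\rho_t(x)<\tilde M$ for all $x\in\operatorname{supp}\tilde\mu_t$. For $q\ge1$ let $\mathbb W_q$ denote the $q$-Wasserstein distance on $\mathbb R$. **Proposition 4.7 (approximation with regular curves).** Let $p\in(1,\infty)$ and let $M$, $m$, $\phi_{p,m}$ be as above. Let $(\mu_t,\nu_t)\in\mathsf{CE}$ be such that $\mu_0$ has finite $p$-th moment, every $\mu_t$ $(t\in[0,1])$ has a density $\rho_t$ with respect to Lebesgue measure, and $$\int_0^1\Phi_{p,m}(\mu_t,\nu_t)\,dt<\infty,\qquad \sup_{t\in[0,1]}\|\rho_t\|_{L^\infty(\mathbb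 R)}\le\bar M<M .$$ Then for every $\eta>0$ there exists $(\tilde\mu_t,\tilde\nu_t)\in\mathsf{CE}$ such that: 1. $\displaystyle\int_0^1\Phi_{p,m}(\tilde\mu_t,\tilde\nu_t)\,dt\le\int_0^1\Phi_{p,m}(\mu_t,\nu_t)\,dt+\eta$; 2. $(\tilde\mu_t,\tilde\nu_t)$ is a regular curve with some compact set $K$ and constants $0<l\le\tilde M<M$, where $\tilde M$ depends only on $M$ and $\bar M$, while $K$ and $l$ depend only on $p,M,\bar M,m$, on $\eta$ and on $(\mu_t)_{t\in[0,1]}$ (not on $(\nu_t)$); 3. for every $q\in[1,p]$ and every $t\in[0,1]$, $$\max\Big\{\big(\operatorname{diam}(\operatorname{supp}\tilde\mu_t)^{p-q}\vee1\big)\,\mathbb W_q(\mu_t,\tilde\mu_t)^q,\ \int_{\mathbb R\setminus\operatorname{supp}\tilde\mu_t}(|x|^p+1)\,d\mu_t(x)\Big\}\le\eta .$$ -/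

import Mathlib

open MeasureTheory Set Filter
open scoped ENNReal ContDiff

noncomputable section

namespace NonlinearTransport

/-- `m` is a nonlinear mobility with maximal density `M`: a continuous concave function
`[0, M] → [0, ∞)` with `m 0 = 0`. Values of `m` outside `[0, M]` are never used. -/
structure IsMobility (M : ℝ) (m : ℝ → ℝ) : Prop where
  continuousOn : ContinuousOn m (Icc 0 M)
  concaveOn : ConcaveOn ℝ (Icc 0 M) m
  nonneg : ∀ ρ ∈ Icc 0 M, 0 ≤ m ρ
  map_zero : m 0 = 0

/-- The function `θ(ρ) = m(ρ) / ρ` is bounded on `(0, M]`. -/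
def BoundedTheta (M : ℝ) (m : ℝ → ℝ) : Prop :=
  BddAbove ((fun ρ : ℝ => m ρ / ρ) '' Ioc 0 M)

/-- The action density `φ_{p,m}(ρ, j)`: it is `|j|^p / m(ρ)^(p-1)` if `m(ρ) > 0`, it is `0` if
`m(ρ) = 0 = j`, and it is `+∞` if `m(ρ) = 0 ≠ j` or if `ρ ∉ [0, M]`. -/
def actionDensity (p M : ℝ) (m : ℝ → ℝ) (ρ j : ℝ) : ℝ≥0∞ :=
  if ρ < 0 ∨ M < ρ then ⊤
  else if 0 < m ρ then ENNReal.ofReal (|j| ^ p / m ρ ^ (p - 1))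
  else if j = 0 then 0
  else ⊤

open Classical in
/-- The action functional `Φ_{p,m}(μ, ν) = ∫ φ_{p,m}(ρ, j) dx` if `μ = ρ dx` and `ν = j dx`,
and `+∞` if one of the two measures is not absolutely continuous. -/
def action (p M : ℝ) (m : ℝ → ℝ) (μ : Measure ℝ) (ν : SignedMeasure ℝ) : ℝ≥0∞ :=
  if μ ≪ volume ∧ ν.totalVariation ≪ volume then
    ∫⁻ x, actionDensity p M m (μ.rnDeriv volume x).toReal (ν.rnDeriv volume x)
  else ⊤

/-- The total action `∫₀¹ Φ_{p,m}(μ_t, ν_t) dt` of a curve. -/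
def totalAction (p M : ℝ) (m : ℝ → ℝ) (μ : ℝ → ProbabilityMeasure ℝ)
    (ν : ℝ → SignedMeasure ℝ) : ℝ≥0∞ :=
  ∫⁻ t in Ioo (0 : ℝ) 1, action p M m (μ t : Measure ℝ) (ν t)

/-- The set of solutions `(μ_t, ν_t)`, `t ∈ [0, 1]`, of the continuity equation
`∂_t μ_t + ∂_x ν_t = 0`. Only the values at times `t ∈ [0, 1]` matter. -/
structure IsCE (μ : ℝ → ProbabilityMeasure ℝ) (ν : ℝ → SignedMeasure ℝ) : Prop where
  /-- `t ↦ μ_t` is vaguely continuous on `[0, 1]`. -/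
  vaguely_continuous : ∀ φ : ℝ → ℝ, Continuous φ → HasCompactSupport φ →
    ContinuousOn (fun t : ℝ => ∫ x, φ x ∂(μ t : Measure ℝ)) (Icc 0 1)
  /-- `(ν_t)` is a Borel family of finite signed measures. -/
  borel : ∀ A : Set ℝ, MeasurableSet A → Measurable (fun t : Icc (0 : ℝ) 1 => ν t A)
  /-- `∫₀¹ ν_t dt` is a locally finite measure on `(0, 1) × ℝ`. -/
  locally_finite : ∀ a b R : ℝ, 0 < a → b < 1 →
    ∫⁻ t in Icc a b, (ν t).totalVariation (Icc (-R) R) < ⊤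
  /-- The equation holds in the sense of distributions on `(0, 1) × ℝ`. -/
  weak_eq : ∀ ξ : ℝ × ℝ → ℝ, ContDiff ℝ 1 ξ → HasCompactSupport ξ →
    tsupport ξ ⊆ Ioo (0 : ℝ) 1 ×ˢ (univ : Set ℝ) →
    (∫ t in Ioo (0 : ℝ) 1, ∫ x, fderiv ℝ ξ (t, x) (1, 0) ∂(μ t : Measure ℝ))
      + (∫ t in Ioo (0 : ℝ) 1, ∫ᵛ x, fderiv ℝ ξ (t, x) (0, 1) ∂•(ν t)) = 0

/-- The `q`-Wasserstein distance on `ℝ`, as an infimum over all couplings. -/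
def wasserstein (q : ℝ) (μ ν : Measure ℝ) : ℝ≥0∞ :=
  (⨅ (π : Measure (ℝ × ℝ)) (_ : π.map Prod.fst = μ ∧ π.map Prod.snd = ν),
    ∫⁻ z, ENNReal.ofReal (|z.1 - z.2| ^ q) ∂π) ^ (1 / q)

/-- `(μ_t, ν_t)` is a regular curve with compact set `K` and constants `0 < l ≤ M' < M`: it solves
the continuity equation, and for all `t ∈ [0, 1]` the measures `μ_t`, `ν_t` have compact and
connected supports contained in `K` and have densities `ρ`, `j` that are smooth on
the respective supports, with `l < ρ < M'` on the support of `μ_t`. As `ν_t = 0` is possible,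
the empty set counts as connected here. -/
structure IsRegularCurve (M : ℝ) (K : Set ℝ) (l M' : ℝ) (μ : ℝ → ProbabilityMeasure ℝ)
    (ν : ℝ → SignedMeasure ℝ) : Prop where
  isCE : IsCE μ ν
  isCompact : IsCompact K
  l_pos : 0 < l
  l_le : l ≤ M'
  lt_max : M' < M
  isCompact_support_fst : ∀ t ∈ Icc (0 : ℝ) 1, IsCompact (μ t : Measure ℝ).support
  isPreconnected_support_fst : ∀ t ∈ Icc (0 : ℝ) 1, IsPreconnected (μ t : Measure ℝ).support
  support_fst_subset : ∀ t ∈ Icc (0 : ℝ) 1, (μ t : Measure ℝ).support ⊆ K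
  isCompact_support_snd : ∀ t ∈ Icc (0 : ℝ) 1, IsCompact (ν t).totalVariation.support
  isPreconnected_support_snd : ∀ t ∈ Icc (0 : ℝ) 1, IsPreconnected (ν t).totalVariation.support
  support_snd_subset : ∀ t ∈ Icc (0 : ℝ) 1, (ν t).totalVariation.support ⊆ K
  density_fst : ∀ t ∈ Icc (0 : ℝ) 1, ∃ ρ : ℝ → ℝ,
    ContDiffOn ℝ ∞ ρ (μ t : Measure ℝ).support ∧
    (μ t : Measure ℝ) =
      (volume.restrict (μ t : Measure ℝ).support).withDensity (fun x => ENNReal.ofReal (ρ x)) ∧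
    ∀ x ∈ (μ t : Measure ℝ).support, l < ρ x ∧ ρ x < M'
  density_snd : ∀ t ∈ Icc (0 : ℝ) 1, ∃ j : ℝ → ℝ,
    ContDiffOn ℝ ∞ j (ν t).totalVariation.support ∧
    ν t = (volume.restrict (ν t).totalVariation.support).withDensityᵥ j

end NonlinearTransport

end

/-! Mollify in space, truncate, and repair the truncation so that the continuity equation and the
unit mass survive exactly. Let ρ_ε, j_ε be the mollified density and flux, F_ε the mollified
distribution function (F_ε' = ρ_ε, ∂_t F_ε = -j_ε), χ a cutoff equal to 1 on [-R, R] and vanishing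
outside (-2R, 2R), and H a fixed smooth step with H' supported where χ = 1. The spatial derivative
of χ F_ε + (1 - χ) H is χ ρ_ε + χ' (F_ε - H). It integrates to 1 over [-2R, 2R] and is transported
by the flux χ j_ε: the mass lost by truncation reappears in the transition zone. The regularized
density is (1 - δ) times this, plus δ/(4R) + α t χ', with flux χ ((1 - δ) j_ε - α).

Action. In the form |j| ≤ φ^(1/p) m^(1-1/p), Hölder's inequality and concavity of m give Jensen's
inequality for φ (`actionDensity_integral_le`), so mollification does not increase the action. At
each point the regularized pair is a convex combination of (ρ_ε, j_ε) and a pair (s, τ) with δ/(8R)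
≤ s ≤ 3/(8R) and |τ| ≤ |α|/δ (`exists_regDensity_eq`, `actionDensity_reg_le`). The second pair costs
little when α is small, and the same decomposition bounds the density from both sides.

Drift. A mollified flux may vanish on intervals, which disconnects its support. For all but
countably many α, at almost every time (1 - δ) j_ε equals α at no rational point, so the flux has
full support [-2R, 2R]. On the remaining null set of times the flux is replaced by 0. If m vanishes
identically, finite action forces j_ε = 0 for almost every t, and α = 0 works.

Transport. Testing the equation with the p-th power of a truncated weight of linear growth, and
absorbing by Young's inequality, shows that the p-th moments have uniformly small tails
(`IsIntegratedCE.exists_tail_bound`); boundedness of θ enters through m(ρ) ≤ Θ ρ. Hence the tail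
mass beyond R - 1 is small compared with δ = κ (4R)^(-p), which makes χ' (F_ε - H) negligible
against δ/(4R), while δ (4R)^p = κ still pays for the diameter weight in the Wasserstein estimate.

Independence of the flux. K and l must not depend on ν. For given μ, the regular curve is built
once, from a flux whose action is within η/2 of the infimum, and serves every admissible ν. -/

noncomputable section

namespace NonlinearTransport

open Topology

section

/-! ### Mollifiers and cutoffs -/

/-- A smooth monotone step from `0` (left of `-ε`) to `1` (right of `ε`). -/
def smoothStep (ε u : ℝ) : ℝ := Real.smoothTransition ((u / ε + 1) / 2)

/-- The mollification kernel at scale `ε`, the derivative of `smoothStep ε`. -/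
def mollifier (ε u : ℝ) : ℝ := deriv (smoothStep ε) u

lemma contDiff_smoothStep (ε : ℝ) {n : ℕ∞} : ContDiff ℝ n (smoothStep ε) := by
  unfold smoothStep
  exact Real.smoothTransition.contDiff.comp (by fun_prop)

lemma contDiff_mollifier (ε : ℝ) {n : ℕ∞} : ContDiff ℝ n (mollifier ε) := by
  have h : ContDiff ℝ ∞ (smoothStep ε) := contDiff_smoothStep ε
  have h2 : ContDiff ℝ ∞ (mollifier ε) := (contDiff_infty_iff_deriv.1 h).2
  exact h2.of_le (by exact_mod_cast le_top)

lemma continuous_mollifier (ε : ℝ) : Continuous (mollifier ε) :=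
  (contDiff_mollifier ε (n := 0)).continuous

lemma continuous_smoothStep (ε : ℝ) : Continuous (smoothStep ε) :=
  (contDiff_smoothStep ε (n := 0)).continuous

lemma hasDerivAt_smoothStep (ε u : ℝ) : HasDerivAt (smoothStep ε) (mollifier ε u) u :=
  (((contDiff_smoothStep ε (n := 1)).differentiable (by simp)) u).hasDerivAt

lemma smoothStep_nonneg (ε u : ℝ) : 0 ≤ smoothStep ε u := Real.smoothTransition.nonneg _

lemma smoothStep_le_one (ε u : ℝ) : smoothStep ε u ≤ 1 := Real.smoothTransition.le_one _

lemma smoothStep_of_le {ε u : ℝ} (hε : 0 < ε) (h : u ≤ -ε) : smoothStep ε u = 0 := by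
  apply Real.smoothTransition.zero_of_nonpos
  have : u / ε ≤ -1 := by rw [div_le_iff₀ hε]; linarith
  linarith

lemma smoothStep_of_ge {ε u : ℝ} (hε : 0 < ε) (h : ε ≤ u) : smoothStep ε u = 1 := by
  apply Real.smoothTransition.one_of_one_le
  have : 1 ≤ u / ε := by rw [le_div_iff₀ hε]; linarith
  linarith

lemma monotone_smoothStep {ε : ℝ} (hε : 0 < ε) : Monotone (smoothStep ε) := by
  intro a b hab
  apply Real.smoothTransition.monotone
  have : a / ε ≤ b / ε := by gcongr
  linarith

lemma mollifier_nonneg {ε : ℝ} (hε : 0 < ε) (u : ℝ) : 0 ≤ mollifier ε u :=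
  (monotone_smoothStep hε).deriv_nonneg

/-- For |u| ≥ ε the step attains its extreme value 0 or 1, so u is a local extremum; this covers the
endpoints too. -/
lemma mollifier_eq_zero {ε u : ℝ} (hε : 0 < ε) (h : ε ≤ |u|) : mollifier ε u = 0 := by
  rcases le_abs.1 h with h | h
  · have hmax : IsLocalMax (smoothStep ε) u := by
      filter_upwards with y
      rw [smoothStep_of_ge hε h]; exact smoothStep_le_one _ _
    exact hmax.deriv_eq_zero
  · have hmin : IsLocalMin (smoothStep ε) u := by
      filter_upwards with y
      rw [smoothStep_of_le hε (by linarith)]; exact smoothStep_nonneg _ _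
    exact hmin.deriv_eq_zero

lemma hasCompactSupport_mollifier {ε : ℝ} (hε : 0 < ε) : HasCompactSupport (mollifier ε) := by
  apply HasCompactSupport.intro (isCompact_Icc (a := -ε) (b := ε))
  intro x hx
  apply mollifier_eq_zero hε
  by_contra! h
  exact hx ⟨(abs_lt.1 h).1.le, (abs_lt.1 h).2.le⟩

lemma integrable_mollifier {ε : ℝ} (hε : 0 < ε) : Integrable (mollifier ε) :=
  (continuous_mollifier ε).integrable_of_hasCompactSupport (hasCompactSupport_mollifier hε)

lemma integral_mollifier {ε : ℝ} (hε : 0 < ε) : ∫ u, mollifier ε u = 1 := by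
  have h1 : Tendsto (smoothStep ε) atBot (𝓝 0) :=
    tendsto_const_nhds.congr' (by
      filter_upwards [eventually_le_atBot (-ε)] with x hx using (smoothStep_of_le hε hx).symm)
  have h2 : Tendsto (smoothStep ε) atTop (𝓝 1) :=
    tendsto_const_nhds.congr' (by
      filter_upwards [eventually_ge_atTop ε] with x hx using (smoothStep_of_ge hε hx).symm)
  rw [integral_of_hasDerivAt_of_tendsto (fun x => hasDerivAt_smoothStep ε x)
    (integrable_mollifier hε) h1 h2]
  simp

/-- A smooth even cutoff: `1` on `[-R, R]`, positive exactly on `(-2R, 2R)`. -/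
def cutoff (R x : ℝ) : ℝ := Real.smoothTransition ((4 - (x / R) ^ 2) / 3)

lemma contDiff_cutoff (R : ℝ) {n : ℕ∞} : ContDiff ℝ n (cutoff R) := by
  unfold cutoff
  exact Real.smoothTransition.contDiff.comp (by fun_prop)

lemma cutoff_nonneg (R x : ℝ) : 0 ≤ cutoff R x := Real.smoothTransition.nonneg _

lemma cutoff_le_one (R x : ℝ) : cutoff R x ≤ 1 := Real.smoothTransition.le_one _

lemma cutoff_eq_one {R x : ℝ} (hR : 0 < R) (h : |x| ≤ R) : cutoff R x = 1 := by
  apply Real.smoothTransition.one_of_one_le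
  have : (x / R) ^ 2 ≤ 1 := by
    rw [sq_le_one_iff_abs_le_one, abs_div, abs_of_pos hR]
    exact (div_le_one hR).2 h
  linarith

lemma cutoff_eq_zero {R x : ℝ} (hR : 0 < R) (h : 2 * R ≤ |x|) : cutoff R x = 0 := by
  apply Real.smoothTransition.zero_of_nonpos
  have : 2 ≤ |x / R| := by
    rw [abs_div, abs_of_pos hR]
    exact (le_div_iff₀ hR).2 h
  have : 2 ^ 2 ≤ (x / R) ^ 2 := by rw [← sq_abs (x / R)]; gcongr
  linarith

lemma cutoff_pos {R x : ℝ} (hR : 0 < R) (h : |x| < 2 * R) : 0 < cutoff R x := by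
  apply Real.smoothTransition.pos_of_pos
  have : |x / R| < 2 := by
    rw [abs_div, abs_of_pos hR]
    exact (div_lt_iff₀ hR).2 h
  have : (x / R) ^ 2 < 2 ^ 2 := by rw [← sq_abs (x / R)]; gcongr
  linarith

lemma continuous_cutoff (R : ℝ) : Continuous (cutoff R) := (contDiff_cutoff R (n := 0)).continuous

lemma hasDerivAt_cutoff (R x : ℝ) : HasDerivAt (cutoff R) (deriv (cutoff R) x) x :=
  (((contDiff_cutoff R (n := 1)).differentiable (by simp)) x).hasDerivAt

lemma contDiff_deriv_cutoff (R : ℝ) : ContDiff ℝ ∞ (deriv (cutoff R)) :=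
  (contDiff_infty_iff_deriv.1 (contDiff_cutoff R (n := ⊤))).2

lemma hasCompactSupport_cutoff {R : ℝ} (hR : 0 < R) : HasCompactSupport (cutoff R) := by
  apply HasCompactSupport.intro (isCompact_Icc (a := -(2 * R)) (b := 2 * R))
  intro x hx
  apply cutoff_eq_zero hR
  by_contra! h
  exact hx ⟨(abs_lt.1 h).1.le, (abs_lt.1 h).2.le⟩

/-- All cutoffs are rescalings of a single profile, so one constant serves every R, with the decay
1/R used throughout. -/
lemma exists_deriv_cutoff_bound : ∃ D : ℝ, 0 < D ∧ ∀ R x : ℝ, 0 < R →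
    |deriv (cutoff R) x| ≤ D / R := by
  have hc : HasCompactSupport (deriv (cutoff 1)) := (hasCompactSupport_cutoff one_pos).deriv
  obtain ⟨C, hC⟩ := (contDiff_deriv_cutoff 1).continuous.bounded_above_of_compact_support hc
  refine ⟨max C 1, by positivity, fun R x hR => ?_⟩
  have h1 : cutoff R = cutoff 1 ∘ fun x => x / R := by
    funext x; simp [cutoff]
  have h3 : HasDerivAt (fun x : ℝ => x / R) (1 / R) x := (hasDerivAt_id x).div_const R
  have h2 : HasDerivAt (cutoff R) (deriv (cutoff 1) (x / R) * (1 / R)) x :=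
    h1 ▸ (hasDerivAt_cutoff 1 (x / R)).comp x h3
  rw [h2.deriv, abs_mul, abs_of_pos (show 0 < 1 / R by positivity), ← div_eq_mul_one_div]
  gcongr
  exact (hC _).trans (le_max_left _ _)

lemma deriv_cutoff_eq_zero_of_lt {R x : ℝ} (hR : 0 < R) (h : |x| < R) :
    deriv (cutoff R) x = 0 := by
  have : cutoff R =ᶠ[𝓝 x] fun _ => 1 := by
    filter_upwards [(isOpen_lt continuous_abs continuous_const).mem_nhds h] with y hy
      using cutoff_eq_one hR (le_of_lt hy)
  rw [this.deriv_eq]; simp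

lemma deriv_cutoff_eq_zero_of_ge {R x : ℝ} (hR : 0 < R) (h : 2 * R ≤ |x|) :
    deriv (cutoff R) x = 0 := by
  have hmin : IsLocalMin (cutoff R) x := by
    filter_upwards with y
    rw [cutoff_eq_zero hR h]; exact cutoff_nonneg _ _
  exact hmin.deriv_eq_zero

end

section

/-! ### Integrals against signed measures -/

lemma lsmul_flip_real :
    (ContinuousLinearMap.lsmul ℝ ℝ : ℝ →L[ℝ] ℝ →L[ℝ] ℝ).flip = ContinuousLinearMap.lsmul ℝ ℝ := by
  ext; simp

lemma isFiniteMeasure_variation (ν : SignedMeasure ℝ) : IsFiniteMeasure ν.variation := by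
  rw [← SignedMeasure.totalVariation_eq_variation]; infer_instance

lemma integral_toSignedMeasure_real (μ : Measure ℝ) [IsFiniteMeasure μ] (f : ℝ → ℝ) :
    ∫ᵛ x, f x ∂•μ.toSignedMeasure = ∫ x, f x ∂μ := by
  have := VectorMeasure.integral_toSignedMeasure (μ := μ) (f := f)
  rwa [lsmul_flip_real] at this

lemma vint_sub_eq (μ₁ μ₂ : Measure ℝ) [IsFiniteMeasure μ₁] [IsFiniteMeasure μ₂] {f : ℝ → ℝ}
    (h₁ : Integrable f μ₁) (h₂ : Integrable f μ₂) :
    ∫ᵛ x, f x ∂•(μ₁.toSignedMeasure - μ₂.toSignedMeasure) = ∫ x, f x ∂μ₁ - ∫ x, f x ∂μ₂ := by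
  rw [VectorMeasure.integral_sub_vectorMeasure, integral_toSignedMeasure_real,
    integral_toSignedMeasure_real]
  · rw [VectorMeasure.Integrable, Measure.variation_toSignedMeasure]; exact h₁
  · rw [VectorMeasure.Integrable, Measure.variation_toSignedMeasure]; exact h₂

lemma integrable_of_bound {μ : Measure ℝ} [IsFiniteMeasure μ] {f : ℝ → ℝ} (hf : Measurable f)
    {C : ℝ} (hC : ∀ x, |f x| ≤ C) : Integrable f μ :=
  Integrable.of_bound hf.aestronglyMeasurable C (ae_of_all _ fun x => by
    simpa [Real.norm_eq_abs] using hC x)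

lemma vint_eq_sub (ν : SignedMeasure ℝ) {f : ℝ → ℝ} (hf : Measurable f) {C : ℝ}
    (hC : ∀ x, |f x| ≤ C) :
    ∫ᵛ x, f x ∂•ν = ∫ x, f x ∂ν.toJordanDecomposition.posPart
      - ∫ x, f x ∂ν.toJordanDecomposition.negPart := by
  conv_lhs => rw [← ν.toSignedMeasure_toJordanDecomposition]
  exact vint_sub_eq _ _ (integrable_of_bound hf hC) (integrable_of_bound hf hC)

lemma vint_withDensity {j f : ℝ → ℝ} (hj : Integrable j) (hf : Measurable f) {C : ℝ}
    (hC : ∀ x, |f x| ≤ C) :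
    ∫ᵛ x, f x ∂•(volume.withDensityᵥ j : SignedMeasure ℝ) = ∫ x, f x * j x := by
  have h1 := isFiniteMeasure_withDensity_ofReal hj.2
  have h2 := isFiniteMeasure_withDensity_ofReal hj.neg.2
  rw [withDensityᵥ_eq_withDensity_pos_part_sub_withDensity_neg_part hj]
  have e1 : ∀ g : ℝ → ℝ, AEMeasurable g → ∫ x, f x ∂(volume.withDensity fun x => ENNReal.ofReal (g x))
      = ∫ x, max (g x) 0 * f x := by
    intro g hg
    rw [integral_withDensity_eq_integral_toReal_smul₀ hg.ennreal_ofReal (by simp)]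
    simp [ENNReal.toReal_ofReal']
  refine (vint_sub_eq _ _ (integrable_of_bound hf hC)
    (@integrable_of_bound _ h2 _ hf _ hC)).trans ?_
  have hb : ∀ g : ℝ → ℝ, Integrable g → Integrable (fun x => max (g x) 0 * f x) := by
    intro g hg
    exact hg.pos_part.mul_bdd (c := C) hf.aestronglyMeasurable
      (ae_of_all _ fun x => by simpa [Real.norm_eq_abs] using hC x)
  rw [e1 _ hj.1.aemeasurable, e1 _ hj.neg.1.aemeasurable, ← integral_sub (hb _ hj) (hb _ hj.neg)]
  congr 1
  funext x
  rcases le_total 0 (j x) with h | h <;> simp [h, mul_comm]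

lemma enorm_vint_le (ν : SignedMeasure ℝ) {f : ℝ → ℝ} {C : ℝ} (hC : ∀ x, |f x| ≤ C) :
    ‖∫ᵛ x, f x ∂•ν‖ₑ ≤ ENNReal.ofReal C * ν.totalVariation univ := by
  have h := VectorMeasure.enorm_integral_le_of_enorm_le_const (μ := ν) (f := f)
    (B := ContinuousLinearMap.lsmul ℝ ℝ) (C := ENNReal.ofReal C) (ae_of_all _ fun x => by
      rw [← ofReal_norm, Real.norm_eq_abs]; exact ENNReal.ofReal_le_ofReal (hC x))
  rw [SignedMeasure.totalVariation_eq_variation]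
  refine h.trans ?_
  have h1 : ‖(ContinuousLinearMap.lsmul ℝ ℝ : ℝ →L[ℝ] ℝ →L[ℝ] ℝ)‖ₑ ≤ 1 := by
    rw [← ofReal_norm]
    exact ENNReal.ofReal_le_one.2 ContinuousLinearMap.opNorm_lsmul_le
  calc _ ≤ ENNReal.ofReal C * 1 * ν.variation univ := by gcongr
    _ = _ := by rw [mul_one]

lemma simpleFunc_vint (ν : SignedMeasure ℝ) (g : SimpleFunc ℝ ℝ) :
    ∫ x, g x ∂ν.toJordanDecomposition.posPart - ∫ x, g x ∂ν.toJordanDecomposition.negPart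
      = ∑ c ∈ g.range, ν (g ⁻¹' {c}) * c := by
  have hi : ∀ μ : Measure ℝ, IsFiniteMeasure μ → ∫ x, g x ∂μ = ∑ c ∈ g.range, μ.real (g ⁻¹' {c}) • c :=
    fun μ _ => by
      rw [← SimpleFunc.integral_eq_integral _ (SimpleFunc.integrable_of_isFiniteMeasure g)]
      exact SimpleFunc.integral_eq _ _
  rw [hi _ inferInstance, hi _ inferInstance, ← Finset.sum_sub_distrib]
  refine Finset.sum_congr rfl fun c _ => ?_
  rw [ν.apply_eq_posPart_real_sub_negPart_real (g.measurableSet_preimage {c})]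
  simp [sub_mul]

/-- Only t ↦ ν t A is assumed measurable. The integral of a simple function is a finite sum of such
terms, written with ν itself rather than with its Jordan parts, whose measurability in t is not at
hand; bounded f follows by pointwise limits. -/
lemma measurable_vint {T : Type*} [MeasurableSpace T] {ν : T → SignedMeasure ℝ}
    (hν : ∀ A, MeasurableSet A → Measurable fun t => ν t A) {f : ℝ → ℝ} (hf : Measurable f) {C : ℝ}
    (hC : ∀ x, |f x| ≤ C) : Measurable fun t => ∫ᵛ x, f x ∂•(ν t) := by
  let g : ℕ → SimpleFunc ℝ ℝ := fun n => SimpleFunc.approxOn f hf univ 0 (mem_univ _) n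
  have hlim : ∀ t, Tendsto (fun n => ∑ c ∈ (g n).range, ν t ((g n) ⁻¹' {c}) * c) atTop
      (𝓝 (∫ᵛ x, f x ∂•(ν t))) := by
    intro t
    rw [vint_eq_sub _ hf hC]
    simp_rw [← simpleFunc_vint]
    have key : ∀ μ : Measure ℝ, IsFiniteMeasure μ →
        Tendsto (fun n => ∫ x, g n x ∂μ) atTop (𝓝 (∫ x, f x ∂μ)) := fun μ _ => by
      simp_rw [← SimpleFunc.integral_eq_integral _ (SimpleFunc.integrable_of_isFiniteMeasure (g _))]
      exact tendsto_integral_approxOn_of_measurable (integrable_of_bound hf hC) hf (by simp)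
        (mem_univ _) (integrable_const _)
    exact (key _ inferInstance).sub (key _ inferInstance)
  refine measurable_of_tendsto_metrizable (f := fun n t => ∑ c ∈ (g n).range, ν t ((g n) ⁻¹' {c}) * c)
    (fun n => ?_) (tendsto_pi_nhds.2 hlim)
  refine Finset.measurable_fun_sum _ fun c _ => ?_
  exact (hν _ ((g n).measurableSet_preimage {c})).mul_const c

/-! ### Mollification of measures -/

/-- The convolution `y ↦ ∫ φ(y - x) dμ(x)`. -/
def convMeasure (φ : ℝ → ℝ) (μ : Measure ℝ) (y : ℝ) : ℝ := ∫ x, φ (y - x) ∂μ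

/-- The convolution `y ↦ ∫ φ(y - x) dν(x)` with a signed measure. -/
def convSigned (φ : ℝ → ℝ) (ν : SignedMeasure ℝ) (y : ℝ) : ℝ := ∫ᵛ x, φ (y - x) ∂•ν

lemma convSigned_eq (ν : SignedMeasure ℝ) {φ : ℝ → ℝ} (hf : Measurable φ) {C : ℝ}
    (hC : ∀ x, |φ x| ≤ C) : convSigned φ ν = fun y =>
      convMeasure φ ν.toJordanDecomposition.posPart y
        - convMeasure φ ν.toJordanDecomposition.negPart y := by
  funext y
  exact vint_eq_sub ν (hf.comp (measurable_const.sub measurable_id)) fun x => hC _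

lemma contDiff_convMeasure (μ : Measure ℝ) [IsFiniteMeasure μ] {φ : ℝ → ℝ} {n : ℕ∞}
    (hφ : ContDiff ℝ n φ) (hc : HasCompactSupport φ) : ContDiff ℝ n (convMeasure φ μ) := by
  -- With respect to μ, the convolution of the constant 1 with φ is y ↦ ∫ φ(y - x) dμ(x).
  have h := hc.contDiff_convolution_right (μ := μ) (f := fun _ : ℝ => (1 : ℝ))
    (ContinuousLinearMap.mul ℝ ℝ) (integrable_const _).locallyIntegrable hφ
  convert h using 1
  funext y
  simp [convMeasure, convolution]

lemma hasDerivAt_convMeasure (μ : Measure ℝ) [IsFiniteMeasure μ] {φ φ' : ℝ → ℝ}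
    (hφ : ∀ x, HasDerivAt φ (φ' x) x) (hφ' : Measurable φ') {C C' : ℝ} (hC : ∀ x, |φ x| ≤ C)
    (hC' : ∀ x, |φ' x| ≤ C') (y : ℝ) : HasDerivAt (convMeasure φ μ) (convMeasure φ' μ y) y := by
  have hcont : Continuous φ := continuous_iff_continuousAt.2 fun x => (hφ x).continuousAt
  refine (hasDerivAt_integral_of_dominated_loc_of_deriv_le (F := fun y x => φ (y - x))
    (F' := fun y x => φ' (y - x)) (bound := fun _ => C') (s := univ) Filter.univ_mem ?_ ?_ ?_ ?_ ?_ ?_).2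
  · exact Eventually.of_forall fun y => (hcont.comp (by fun_prop)).aestronglyMeasurable
  · exact integrable_of_bound (hcont.measurable.comp (by fun_prop)) fun x => hC _
  · exact (hφ'.comp (by fun_prop)).aestronglyMeasurable
  · exact ae_of_all _ fun x y _ => hC' _
  · exact integrable_const _
  · refine ae_of_all _ fun x y _ => ?_
    exact (hφ (y - x)).comp_sub_const y x

lemma contDiff_convSigned (ν : SignedMeasure ℝ) {φ : ℝ → ℝ} {n : ℕ∞}
    (hφ : ContDiff ℝ n φ) (hc : HasCompactSupport φ) : ContDiff ℝ n (convSigned φ ν) := by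
  obtain ⟨C, hC⟩ := hφ.continuous.bounded_above_of_compact_support hc
  rw [convSigned_eq ν hφ.continuous.measurable hC]
  exact (contDiff_convMeasure _ hφ hc).sub (contDiff_convMeasure _ hφ hc)

lemma hasDerivAt_convSigned (ν : SignedMeasure ℝ) {φ φ' : ℝ → ℝ}
    (hφ : ∀ x, HasDerivAt φ (φ' x) x) (hφ' : Measurable φ') {C C' : ℝ} (hC : ∀ x, |φ x| ≤ C)
    (hC' : ∀ x, |φ' x| ≤ C') (y : ℝ) : HasDerivAt (convSigned φ ν) (convSigned φ' ν y) y := by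
  have hcont : Continuous φ := continuous_iff_continuousAt.2 fun x => (hφ x).continuousAt
  rw [convSigned_eq ν hcont.measurable hC, convSigned_eq ν hφ' hC']
  exact (hasDerivAt_convMeasure _ hφ hφ' hC hC' y).sub (hasDerivAt_convMeasure _ hφ hφ' hC hC' y)

lemma enorm_convSigned_le (ν : SignedMeasure ℝ) {φ : ℝ → ℝ} {C : ℝ} (hC : ∀ x, |φ x| ≤ C) (y : ℝ) :
    ‖convSigned φ ν y‖ₑ ≤ ENNReal.ofReal C * ν.totalVariation univ :=
  enorm_vint_le ν fun _ => hC _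

/-- Carathéodory functions: measurable in t and continuous in y, hence jointly measurable. -/
lemma measurable_convSigned_uncurry {T : Type*} [MeasurableSpace T] {ν : T → SignedMeasure ℝ}
    (hν : ∀ A, MeasurableSet A → Measurable fun t => ν t A) {φ : ℝ → ℝ} (hφ : Continuous φ)
    (hc : HasCompactSupport φ) : Measurable fun z : T × ℝ => convSigned φ (ν z.1) z.2 := by
  obtain ⟨C, hC⟩ := hφ.bounded_above_of_compact_support hc
  have h1 : ∀ y, Measurable fun t => convSigned φ (ν t) y := fun y => by
    have hm : Measurable fun x => φ (y - x) := hφ.measurable.comp (by fun_prop)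
    have hb : ∀ x, |φ (y - x)| ≤ C := fun x => hC (y - x)
    exact measurable_vint hν hm hb
  have h2 : ∀ t, Continuous fun y => convSigned φ (ν t) y := fun t =>
    (contDiff_convSigned (ν t) (n := 0) (contDiff_zero.2 hφ) hc).continuous
  have h3 : Measurable (Function.uncurry fun (y : ℝ) (t : T) => convSigned φ (ν t) y) :=
    measurable_uncurry_of_continuous_of_measurable h2 h1
  have h4 : (fun z : T × ℝ => convSigned φ (ν z.1) z.2)
      = (Function.uncurry fun (y : ℝ) (t : T) => convSigned φ (ν t) y) ∘ Prod.swap := by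
    funext z; simp only [Function.comp_apply, Function.uncurry, Prod.swap]
  rw [h4]
  exact h3.comp measurable_swap

end

section

/-! ### The continuity equation, integrated in time -/

/-- Integration by parts for absolutely continuous functions. The primitive vanishes at 0, so only
the boundary term at 1 remains; χ need not vanish there. -/
lemma integral_deriv_mul_primitive {χ g : ℝ → ℝ} (hχ : ContDiff ℝ 1 χ)
    (hg : IntegrableOn g (Ioo 0 1)) :
    ∫ t in (0 : ℝ)..1, deriv χ t * (∫ r in (0 : ℝ)..t, g r)
      = χ 1 * (∫ r in (0 : ℝ)..1, g r) - ∫ t in (0 : ℝ)..1, χ t * g t := by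
  have hgi : IntervalIntegrable g volume 0 1 := by
    rw [intervalIntegrable_iff_integrableOn_Ioo_of_le zero_le_one]; exact hg
  have hac := hgi.absolutelyContinuousOnInterval_intervalIntegral (c := 0) (by simp)
  have hχc : AbsolutelyContinuousOnInterval χ 0 1 := hχ.contDiffOn.absolutelyContinuousOnInterval
  have h := hχc.integral_mul_deriv_eq_deriv_mul hac
  have hae : ∀ᵐ t, t ∈ uIoc (0 : ℝ) 1 →
      χ t * deriv (fun x => ∫ r in (0 : ℝ)..x, g r) t = χ t * g t := by
    filter_upwards [hgi.ae_hasDerivAt_integral] with t ht hmem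
    rw [(ht (uIoc_subset_uIcc hmem) 0 (by simp)).deriv]
  rw [intervalIntegral.integral_congr_ae hae] at h
  simp only [intervalIntegral.integral_same, mul_zero, sub_zero] at h
  linarith

lemma tendsto_integral_mollifier_mul {h : ℝ → ℝ} (hh : Continuous h) (t : ℝ) :
    Tendsto (fun ε => ∫ u, mollifier ε (u - t) * h u) (𝓝[>] 0) (𝓝 (h t)) := by
  rw [Metric.tendsto_nhds]
  intro η hη
  obtain ⟨r, hr, hrη⟩ := Metric.continuousAt_iff.1 hh.continuousAt (η / 2) (by positivity)
  filter_upwards [Ioo_mem_nhdsGT hr] with ε hε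
  have hε0 : 0 < ε := hε.1
  have hk : Integrable fun u => mollifier ε (u - t) := (integrable_mollifier hε0).comp_sub_right t
  have hk1 : ∫ u, mollifier ε (u - t) = 1 := by
    rw [integral_sub_right_eq_self (mollifier ε) t, integral_mollifier hε0]
  have hkh : Integrable fun u => mollifier ε (u - t) * h u := by
    refine Continuous.integrable_of_hasCompactSupport
      (((continuous_mollifier ε).comp (by fun_prop)).mul hh) ?_
    exact HasCompactSupport.mul_right ((hasCompactSupport_mollifier hε0).comp_homeomorph
      (Homeomorph.subRight t))
  have hd : (∫ u, mollifier ε (u - t) * h u) - h t = ∫ u, mollifier ε (u - t) * (h u - h t) := by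
    simp_rw [mul_sub]
    rw [integral_sub hkh (hk.mul_const _), integral_mul_const, hk1, one_mul]
  rw [Real.dist_eq, hd]
  calc |∫ u, mollifier ε (u - t) * (h u - h t)| ≤ ∫ u, mollifier ε (u - t) * (η / 2) := by
        rw [← Real.norm_eq_abs]
        refine norm_integral_le_of_norm_le (hk.mul_const _) (ae_of_all _ fun u => ?_)
        rw [norm_mul, Real.norm_of_nonneg (mollifier_nonneg hε0 _)]
        rcases lt_or_ge |u - t| ε with hu | hu
        · gcongr
          · exact mollifier_nonneg hε0 _
          · exact (hrη (by rw [Real.dist_eq]; exact hu.trans hε.2)).le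
        · simp [mollifier_eq_zero hε0 hu]
    _ = η / 2 := by rw [integral_mul_const, hk1, one_mul]
    _ < η := by linarith

/-- Du Bois-Reymond: f minus the primitive of g has zero distributional derivative. The test
function is a difference of smooth steps centred at t and s; its derivative is a difference of
mollifiers, so the averages near s and t agree, and ε → 0 gives equality of the values. -/
lemma eq_primitive_of_forall_test {f g : ℝ → ℝ} (hf : ContinuousOn f (Icc 0 1))
    (hg : IntegrableOn g (Ioo 0 1))
    (h : ∀ χ : ℝ → ℝ, ContDiff ℝ 1 χ → HasCompactSupport χ → tsupport χ ⊆ Ioo 0 1 →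
      (∫ t in Ioo (0 : ℝ) 1, deriv χ t * f t) + ∫ t in Ioo (0 : ℝ) 1, χ t * g t = 0)
    {t : ℝ} (ht : t ∈ Icc (0 : ℝ) 1) : f t - f 0 = ∫ r in (0 : ℝ)..t, g r := by
  set G : ℝ → ℝ := fun t => ∫ r in (0 : ℝ)..t, g r with hG
  have hgi : IntegrableOn g (Icc 0 1) := by rwa [integrableOn_Icc_iff_integrableOn_Ioo]
  have hGc : ContinuousOn G (Icc 0 1) := by
    have := intervalIntegral.continuousOn_primitive_interval (μ := volume) (f := g) (a := 0) (b := 1)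
      (by rwa [uIcc_of_le zero_le_one])
    rwa [uIcc_of_le zero_le_one] at this
  -- Extended continuously to the line so that it can be averaged against the kernels.
  set H : ℝ → ℝ := IccExtend (zero_le_one' ℝ) ((Icc (0 : ℝ) 1).domRestrict fun t => f t - G t)
  have hHc : Continuous H := (hf.sub hGc).domRestrict.Icc_extend'
  have hHeq : ∀ u ∈ Icc (0 : ℝ) 1, H u = f u - G u := fun u hu => by
    simp [H, IccExtend_of_mem _ _ hu]
  have hconst : ∀ s ∈ Ioo (0 : ℝ) 1, ∀ t ∈ Ioo (0 : ℝ) 1, H s = H t := by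
    intro s hs t ht
    refine tendsto_nhds_unique (tendsto_integral_mollifier_mul hHc s)
      ((tendsto_integral_mollifier_mul hHc t).congr' ?_)
    -- For ε below this minimum, the support of the test function stays inside (0, 1).
    have hpos : 0 < min (min s (1 - s)) (min t (1 - t)) := by
      simp [hs.1, hs.2, ht.1, ht.2]
    filter_upwards [Ioo_mem_nhdsGT hpos] with ε hε
    obtain ⟨hε0, hε1⟩ := hε
    simp only [lt_min_iff] at hε1
    have hkh : ∀ s, Integrable fun u => mollifier ε (u - s) * H u := fun s => by
      refine Continuous.integrable_of_hasCompactSupport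
        (((continuous_mollifier ε).comp (by fun_prop)).mul hHc) ?_
      exact HasCompactSupport.mul_right ((hasCompactSupport_mollifier hε0).comp_homeomorph
        (Homeomorph.subRight s))
    set χ : ℝ → ℝ := fun u => smoothStep ε (u - t) - smoothStep ε (u - s) with hχ
    have hχd : ∀ u, HasDerivAt χ (mollifier ε (u - t) - mollifier ε (u - s)) u := fun u =>
      ((hasDerivAt_smoothStep ε (u - t)).comp_sub_const u t).sub
        ((hasDerivAt_smoothStep ε (u - s)).comp_sub_const u s)
    have hχC : ContDiff ℝ 1 χ :=
      ((contDiff_smoothStep ε).comp (by fun_prop)).sub ((contDiff_smoothStep ε).comp (by fun_prop))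
    set a := min s t - ε
    set b := max s t + ε
    have hz : ∀ u, u ∉ Icc a b → χ u = 0 := by
      intro u hu
      rcases lt_or_ge u a with h1 | h1
      · have h2 : u - t ≤ -ε := by have := min_le_right s t; simp only [a] at h1; linarith
        have h3 : u - s ≤ -ε := by have := min_le_left s t; simp only [a] at h1; linarith
        simp [hχ, smoothStep_of_le hε0 h2, smoothStep_of_le hε0 h3]
      · have h1 : b < u := by
          by_contra! h4; exact hu ⟨h1, h4⟩
        have h2 : ε ≤ u - t := by have := le_max_right s t; simp only [b] at h1; linarith
        have h3 : ε ≤ u - s := by have := le_max_left s t; simp only [b] at h1; linarith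
        simp [hχ, smoothStep_of_ge hε0 h2, smoothStep_of_ge hε0 h3]
    have hcs : HasCompactSupport χ := HasCompactSupport.intro isCompact_Icc hz
    have hab : Icc a b ⊆ Ioo (0 : ℝ) 1 := by
      intro u hu
      have h1 : 0 < a := by simp only [a]; rcases min_cases s t with h | h <;> linarith
      have h2 : b < 1 := by simp only [b]; rcases max_cases s t with h | h <;> linarith
      exact ⟨h1.trans_le hu.1, hu.2.trans_lt h2⟩
    have hts : tsupport χ ⊆ Ioo 0 1 := by
      refine (closure_minimal (fun u hu => ?_) isClosed_Icc).trans hab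
      by_contra h4; exact hu (hz u h4)
    have h1 := h χ hχC hcs hts
    have h2 := integral_deriv_mul_primitive hχC hg
    have hχ1 : χ 1 = 0 := hz 1 fun h4 => absurd (hab h4).2 (lt_irrefl _)
    rw [hχ1, zero_mul, zero_sub, intervalIntegral.integral_of_le zero_le_one,
      intervalIntegral.integral_of_le zero_le_one, integral_Ioc_eq_integral_Ioo,
      integral_Ioc_eq_integral_Ioo] at h2
    have hdc : Continuous (deriv χ) := hχC.continuous_deriv le_rfl
    have hi1 : IntegrableOn (fun u => deriv χ u * f u) (Ioo 0 1) :=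
      ((hdc.continuousOn.mul hf).integrableOn_Icc).mono_set Ioo_subset_Icc_self
    have hi2 : IntegrableOn (fun u => deriv χ u * G u) (Ioo 0 1) :=
      ((hdc.continuousOn.mul hGc).integrableOn_Icc).mono_set Ioo_subset_Icc_self
    have h3 : ∫ u in Ioo (0 : ℝ) 1, deriv χ u * H u = 0 := by
      have : ∫ u in Ioo (0 : ℝ) 1, deriv χ u * H u
          = ∫ u in Ioo (0 : ℝ) 1, (deriv χ u * f u - deriv χ u * G u) := by
        refine setIntegral_congr_fun measurableSet_Ioo fun u hu => ?_
        simp only [hHeq u (Ioo_subset_Icc_self hu)]; ring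
      rw [this, integral_sub hi1 hi2]
      simp only [hG] at h2 ⊢
      linarith
    have h4 : ∫ u in Ioo (0 : ℝ) 1, deriv χ u * H u = ∫ u, deriv χ u * H u := by
      refine setIntegral_eq_integral_of_forall_compl_eq_zero fun u hu => ?_
      have : u ∉ tsupport (deriv χ) := fun h5 => hu (hts (tsupport_deriv_subset h5))
      rw [image_eq_zero_of_notMem_tsupport this, zero_mul]
    rw [h4] at h3
    have h5 : ∀ u, deriv χ u * H u = mollifier ε (u - t) * H u - mollifier ε (u - s) * H u :=
      fun u => by rw [(hχd u).deriv]; ring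
    simp_rw [h5] at h3
    rw [integral_sub (hkh t) (hkh s)] at h3
    linarith
  have hall : ∀ u ∈ Icc (0 : ℝ) 1, H u = H 2⁻¹ := by
    have hcl : IsClosed {u | H u = H 2⁻¹} := isClosed_eq hHc continuous_const
    have : closure (Ioo (0 : ℝ) 1) ⊆ {u | H u = H 2⁻¹} :=
      closure_minimal (fun u hu => hconst u hu 2⁻¹ (by norm_num)) hcl
    rwa [closure_Ioo zero_ne_one] at this
  have e0 := hall 0 (by simp)
  have e1 := hall t ht
  rw [hHeq 0 (by simp)] at e0
  rw [hHeq t ht] at e1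
  have hG0 : G 0 = 0 := by simp [hG]
  rw [hG0] at e0
  simp only [hG] at e1
  linarith

end

/-! ### The continuity equation tested with functions of space alone -/

section

/-- A curve solving the continuity equation in integrated form, with families indexed by all
real times. -/
structure IsIntegratedCE (μ : ℝ → Measure ℝ) (ν : ℝ → SignedMeasure ℝ) : Prop where
  prob : ∀ t, IsProbabilityMeasure (μ t)
  measurable : ∀ A, MeasurableSet A → Measurable fun t => ν t A
  measurable_integral : ∀ (φ : ℝ → ℝ) (C : ℝ), Continuous φ → (∀ x, |φ x| ≤ C) →
    Measurable fun t => ∫ x, φ x ∂μ t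
  mass_lt_top : ∫⁻ t in Ioo (0 : ℝ) 1, (ν t).totalVariation univ < ⊤
  sub_eq : ∀ (φ φ' : ℝ → ℝ) (C : ℝ), (∀ x, HasDerivAt φ (φ' x) x) → Continuous φ' →
    HasCompactSupport φ' → (∀ x, |φ x| ≤ C) → ∀ t ∈ Icc (0 : ℝ) 1,
      ∫ x, φ x ∂μ t - ∫ x, φ x ∂μ 0 = ∫ r in (0 : ℝ)..t, ∫ᵛ x, φ' x ∂•(ν r)

lemma integrableOn_vint {ν : ℝ → SignedMeasure ℝ}
    (hm : ∀ A, MeasurableSet A → Measurable fun t => ν t A)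
    (hTV : ∫⁻ t in Ioo (0 : ℝ) 1, (ν t).totalVariation univ < ⊤) {φ : ℝ → ℝ} (hφ : Measurable φ)
    {C : ℝ} (hC : ∀ x, |φ x| ≤ C) : IntegrableOn (fun t => ∫ᵛ x, φ x ∂•(ν t)) (Ioo 0 1) := by
  refine ⟨(measurable_vint hm hφ hC).aestronglyMeasurable, ?_⟩
  calc ∫⁻ t in Ioo (0 : ℝ) 1, ‖∫ᵛ x, φ x ∂•(ν t)‖ₑ
      ≤ ∫⁻ t in Ioo (0 : ℝ) 1, ENNReal.ofReal C * (ν t).totalVariation univ :=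
        lintegral_mono fun t => enorm_vint_le _ hC
    _ = ENNReal.ofReal C * ∫⁻ t in Ioo (0 : ℝ) 1, (ν t).totalVariation univ :=
        lintegral_const_mul' _ _ ENNReal.ofReal_ne_top
    _ < ⊤ := ENNReal.mul_lt_top ENNReal.ofReal_lt_top hTV

/-- The family extended to all real times by its values at the endpoints. -/
def extendTime {α : Type*} (f : ℝ → α) (t : ℝ) : α := f (projIcc (0 : ℝ) 1 zero_le_one t)

lemma extendTime_of_mem {α : Type*} (f : ℝ → α) {t : ℝ} (ht : t ∈ Icc (0 : ℝ) 1) :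
    extendTime f t = f t := by
  simp [extendTime, projIcc_of_mem _ ht]

/-- Product test functions χ(t) φ(x) reduce the equation to a weak differential equation in time for
t ↦ ∫ φ dμ_t, whose vague continuity makes the identity valid at every t. -/
lemma IsCE.sub_eq_of_hasCompactSupport {μ : ℝ → ProbabilityMeasure ℝ} {ν : ℝ → SignedMeasure ℝ}
    (h : IsCE μ ν) (hTV : ∫⁻ t in Ioo (0 : ℝ) 1, (ν t).totalVariation univ < ⊤) {φ : ℝ → ℝ}
    (hφ : ContDiff ℝ 1 φ) (hc : HasCompactSupport φ) {t : ℝ} (ht : t ∈ Icc (0 : ℝ) 1) :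
    ∫ x, φ x ∂(μ t : Measure ℝ) - ∫ x, φ x ∂(μ 0 : Measure ℝ)
      = ∫ r in (0 : ℝ)..t, ∫ᵛ x, deriv φ x ∂•(extendTime ν r) := by
  have hdc : Continuous (deriv φ) := hφ.continuous_deriv le_rfl
  obtain ⟨C, hC⟩ := hdc.bounded_above_of_compact_support hc.deriv
  have hm : ∀ A, MeasurableSet A → Measurable fun t => extendTime ν t A := fun A hA =>
    (h.borel A hA).comp continuous_projIcc.measurable
  have hTV' : ∫⁻ t in Ioo (0 : ℝ) 1, (extendTime ν t).totalVariation univ < ⊤ := by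
    rwa [setLIntegral_congr_fun measurableSet_Ioo fun t ht => by
      rw [extendTime_of_mem ν (Ioo_subset_Icc_self ht)]]
  refine eq_primitive_of_forall_test (h.vaguely_continuous φ hφ.continuous hc)
    (integrableOn_vint hm hTV' hdc.measurable hC) (fun χ hχ hχc hχs => ?_) ht
  have hξ : ContDiff ℝ 1 fun z : ℝ × ℝ => χ z.1 * φ z.2 :=
    (hχ.comp contDiff_fst).mul (hφ.comp contDiff_snd)
  have hsub : tsupport (fun z : ℝ × ℝ => χ z.1 * φ z.2) ⊆ tsupport χ ×ˢ tsupport φ := by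
    refine closure_minimal (fun z hz => ?_) ((isClosed_tsupport χ).prod (isClosed_tsupport φ))
    have hz' : χ z.1 * φ z.2 ≠ 0 := hz
    exact ⟨subset_tsupport _ (left_ne_zero_of_mul hz'), subset_tsupport _ (right_ne_zero_of_mul hz')⟩
  have hw := h.weak_eq _ hξ
    (IsCompact.of_isClosed_subset (hχc.prod hc) (isClosed_tsupport _) hsub)
    (hsub.trans (prod_mono hχs (subset_univ _)))
  have hχd : ∀ t, HasDerivAt χ (deriv χ t) t := fun t =>
    (hχ.differentiable (by simp) t).hasDerivAt
  have hφd : ∀ t, HasDerivAt φ (deriv φ t) t := fun t =>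
    (hφ.differentiable (by simp) t).hasDerivAt
  have hF : ∀ t x, HasFDerivAt (fun z : ℝ × ℝ => χ z.1 * φ z.2)
      (χ t • ((ContinuousLinearMap.toSpanSingleton ℝ (deriv φ x)).comp
          (ContinuousLinearMap.snd ℝ ℝ ℝ))
        + φ x • ((ContinuousLinearMap.toSpanSingleton ℝ (deriv χ t)).comp
          (ContinuousLinearMap.fst ℝ ℝ ℝ))) (t, x) := fun t x =>
    HasFDerivAt.mul (c := fun z : ℝ × ℝ => χ z.1) (d := fun z : ℝ × ℝ => φ z.2)
      ((hχd t).hasFDerivAt.comp (t, x) hasFDerivAt_fst)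
      ((hφd x).hasFDerivAt.comp (t, x) hasFDerivAt_snd)
  have e1 : ∀ t x, fderiv ℝ (fun z : ℝ × ℝ => χ z.1 * φ z.2) (t, x) (1, 0)
      = deriv χ t * φ x := fun t x => by rw [(hF t x).fderiv]; simp [mul_comm]
  have e2 : ∀ t x, fderiv ℝ (fun z : ℝ × ℝ => χ z.1 * φ z.2) (t, x) (0, 1)
      = χ t * deriv φ x := fun t x => by rw [(hF t x).fderiv]; simp
  simp_rw [e1, e2, integral_const_mul] at hw
  have e3 : ∀ t, ∫ᵛ x, χ t * deriv φ x ∂•(ν t) = χ t * ∫ᵛ x, deriv φ x ∂•(ν t) := fun t => by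
    have := VectorMeasure.integral_fun_smul (μ := ν t)
      (B := ContinuousLinearMap.lsmul ℝ ℝ) (χ t) (deriv φ)
    simpa using this
  simp_rw [e3] at hw
  refine Eq.trans ?_ hw
  congr 1
  refine setIntegral_congr_fun measurableSet_Ioo fun t ht => ?_
  simp only [extendTime_of_mem ν (Ioo_subset_Icc_self ht)]

lemma eventually_abs_lt_add_one (x : ℝ) : ∀ᶠ n : ℕ in atTop, |x| < n + 1 := by
  filter_upwards [eventually_ge_atTop ⌈|x|⌉₊] with n hn
  exact (Nat.le_ceil |x|).trans_lt (by exact_mod_cast Nat.lt_succ_of_le hn)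

lemma tendsto_integral_mul_cutoff (μ : Measure ℝ) [IsFiniteMeasure μ] {φ : ℝ → ℝ}
    (hφ : Continuous φ) {C : ℝ} (hC : ∀ x, |φ x| ≤ C) :
    Tendsto (fun n : ℕ => ∫ x, φ x * cutoff (n + 1) x ∂μ) atTop (𝓝 (∫ x, φ x ∂μ)) := by
  refine tendsto_integral_of_dominated_convergence (fun _ => C) (fun n => ?_)
    (integrable_const _) (fun n => ae_of_all _ fun x => ?_) (ae_of_all _ fun x => ?_)
  · exact (hφ.mul (continuous_cutoff _)).aestronglyMeasurable
  · rw [Real.norm_eq_abs, abs_mul, abs_of_nonneg (cutoff_nonneg _ _)]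
    exact (mul_le_of_le_one_right (abs_nonneg _) (cutoff_le_one _ _)).trans (hC x)
  · refine tendsto_const_nhds.congr' ?_
    filter_upwards [eventually_abs_lt_add_one x] with n hn
    simp [cutoff_eq_one (show (0 : ℝ) < n + 1 by positivity) hn.le]

lemma IsCE.measurable_integral {μ : ℝ → ProbabilityMeasure ℝ} {ν : ℝ → SignedMeasure ℝ}
    (h : IsCE μ ν) {φ : ℝ → ℝ} (hφ : Continuous φ) {C : ℝ} (hC : ∀ x, |φ x| ≤ C) :
    Measurable fun t => ∫ x, φ x ∂(extendTime (fun t => (μ t : Measure ℝ)) t) := by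
  refine measurable_of_tendsto_metrizable
    (f := fun (n : ℕ) t => ∫ x, φ x * cutoff (n + 1) x ∂(extendTime (fun t => (μ t : Measure ℝ)) t))
    (fun n => ?_) (tendsto_pi_nhds.2 fun t => ?_)
  · have hc := h.vaguely_continuous _ (hφ.mul (continuous_cutoff (n + 1)))
      ((hasCompactSupport_cutoff (show (0 : ℝ) < n + 1 by positivity)).mul_left)
    exact (hc.comp_continuous (f := fun t => (projIcc (0 : ℝ) 1 zero_le_one t : ℝ))
      (by fun_prop) fun t => (projIcc (0 : ℝ) 1 zero_le_one t).2).measurable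
  · have : IsProbabilityMeasure (extendTime (fun t => (μ t : Measure ℝ)) t) := by
      unfold extendTime; infer_instance
    exact tendsto_integral_mul_cutoff _ hφ hC

/-- The gain is that φ is only bounded, with compactly supported derivative. This admits smooth
steps, hence the equation for distribution functions. The cutoff error tends to 0 because the flux
has finite total mass. -/
lemma IsCE.isIntegratedCE {μ : ℝ → ProbabilityMeasure ℝ} {ν : ℝ → SignedMeasure ℝ}
    (h : IsCE μ ν) (hTV : ∫⁻ t in Ioo (0 : ℝ) 1, (ν t).totalVariation univ < ⊤) :
    IsIntegratedCE (extendTime fun t => (μ t : Measure ℝ)) (extendTime ν) := by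
  have hm : ∀ A, MeasurableSet A → Measurable fun t => extendTime ν t A := fun A hA =>
    (h.borel A hA).comp continuous_projIcc.measurable
  have hTV' : ∫⁻ t in Ioo (0 : ℝ) 1, (extendTime ν t).totalVariation univ < ⊤ := by
    rwa [setLIntegral_congr_fun measurableSet_Ioo fun t ht => by
      rw [extendTime_of_mem ν (Ioo_subset_Icc_self ht)]]
  refine ⟨fun t => by unfold extendTime; infer_instance, hm,
    fun φ C hφ hC => h.measurable_integral hφ hC, hTV', ?_⟩
  intro φ φ' C hφ hφ'c hφ's hC t ht
  rw [extendTime_of_mem _ ht, extendTime_of_mem _ (by simp : (0 : ℝ) ∈ Icc (0 : ℝ) 1)]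
  have hφc : Continuous φ := continuous_iff_continuousAt.2 fun x => (hφ x).continuousAt
  have hφderiv : deriv φ = φ' := funext fun x => (hφ x).deriv
  have hφC1 : ContDiff ℝ 1 φ := contDiff_one_iff_deriv.2
    ⟨fun x => (hφ x).differentiableAt, by rwa [hφderiv]⟩
  obtain ⟨C', hC'⟩ := hφ'c.bounded_above_of_compact_support hφ's
  obtain ⟨D, hD0, hD⟩ := exists_deriv_cutoff_bound
  let W : ℕ → ℝ → ℝ := fun n => cutoff (n + 1)
  have hpos : ∀ n : ℕ, (0 : ℝ) < n + 1 := fun n => by positivity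
  have hlim : ∀ s, Tendsto (fun n => ∫ x, φ x * W n x ∂(μ s : Measure ℝ)) atTop
      (𝓝 (∫ x, φ x ∂(μ s : Measure ℝ))) := fun s => tendsto_integral_mul_cutoff _ hφc hC
  have hstep : ∀ n, ∫ x, φ x * W n x ∂(μ t : Measure ℝ) - ∫ x, φ x * W n x ∂(μ 0 : Measure ℝ)
      = ∫ r in (0 : ℝ)..t, ∫ᵛ x, deriv (fun x => φ x * W n x) x ∂•(extendTime ν r) := fun n =>
    h.sub_eq_of_hasCompactSupport hTV (hφC1.mul (contDiff_cutoff _))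
      ((hasCompactSupport_cutoff (hpos n)).mul_left) ht
  have hder : ∀ n x, deriv (fun x => φ x * W n x) x
      = φ' x * W n x + φ x * deriv (W n) x := fun n x =>
    ((hφ x).mul (hasDerivAt_cutoff _ x)).deriv
  refine tendsto_nhds_unique ((hlim t).sub (hlim 0)) ?_
  simp_rw [hstep]
  rw [tendsto_iff_norm_sub_tendsto_zero]
  set m : ℝ≥0∞ := ∫⁻ t in Ioo (0 : ℝ) 1, (extendTime ν t).totalVariation univ with hm_def
  obtain ⟨N, hN⟩ := (hφ's.isBounded).exists_norm_le
  -- Once the cutoff is 1 on the support of φ', only φ times the derivative of the cutoff is left.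
  have hsmall : ∀ᶠ n : ℕ in atTop, ∀ x,
      |deriv (fun x => φ x * W n x) x - φ' x| ≤ C * D / (n + 1) := by
    filter_upwards [eventually_abs_lt_add_one N] with n hn x
    have h1 : φ' x * W n x = φ' x := by
      by_cases hx : x ∈ tsupport φ'
      · have : |x| ≤ n + 1 := (hN x hx).trans ((le_abs_self N).trans hn.le)
        simp [W, cutoff_eq_one (hpos n) this]
      · rw [image_eq_zero_of_notMem_tsupport hx, zero_mul]
    rw [hder, h1, add_sub_cancel_left, abs_mul, mul_div_assoc]
    gcongr
    · exact (abs_nonneg _).trans (hC x)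
    · exact hC x
    · exact hD _ _ (hpos n)
  have hI : ∀ ψ : ℝ → ℝ, Continuous ψ → HasCompactSupport ψ →
      IntervalIntegrable (fun r => ∫ᵛ x, ψ x ∂•(extendTime ν r)) volume 0 t := fun ψ hψ hψs => by
    obtain ⟨B, hB⟩ := hψ.bounded_above_of_compact_support hψs
    rw [intervalIntegrable_iff_integrableOn_Ioo_of_le ht.1]
    exact (integrableOn_vint hm hTV' hψ.measurable hB).mono_set (Ioo_subset_Ioo_right ht.2)
  have hlast : Tendsto (fun n : ℕ => C * D * m.toReal * (1 / ((n : ℝ) + 1))) atTop (𝓝 0) := by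
    simpa using (tendsto_one_div_add_atTop_nhds_zero_nat (𝕜 := ℝ)).const_mul (C * D * m.toReal)
  refine squeeze_zero' (Eventually.of_forall fun _ => norm_nonneg _) ?_ hlast
  filter_upwards [hsmall] with n hn
  have hdc : Continuous (deriv fun x => φ x * W n x) :=
    (hφC1.mul (contDiff_cutoff (n + 1) (n := 1))).continuous_deriv le_rfl
  have hds : HasCompactSupport (deriv fun x => φ x * W n x) :=
    ((hasCompactSupport_cutoff (hpos n)).mul_left).deriv
  obtain ⟨B, hB⟩ := hdc.bounded_above_of_compact_support hds
  rw [← intervalIntegral.integral_sub (hI _ hdc hds) (hI _ hφ'c hφ's),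
    intervalIntegral.integral_of_le ht.1, integral_Ioc_eq_integral_Ioo]
  have hsub : ∀ r, (∫ᵛ x, deriv (fun x => φ x * W n x) x ∂•(extendTime ν r))
      - ∫ᵛ x, φ' x ∂•(extendTime ν r)
      = ∫ᵛ x, (deriv (fun x => φ x * W n x) x - φ' x) ∂•(extendTime ν r) := fun r => by
    have := isFiniteMeasure_variation (extendTime ν r)
    exact (VectorMeasure.integral_fun_sub (integrable_of_bound hdc.measurable hB)
      (integrable_of_bound hφ'c.measurable hC')).symm
  simp_rw [hsub]
  have hfin : ‖∫ r in Ioo 0 t, ∫ᵛ x, (deriv (fun x => φ x * W n x) x - φ' x) ∂•(extendTime ν r)‖ₑ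
      ≤ ENNReal.ofReal (C * D / (n + 1)) * m := by
    refine (enorm_integral_le_lintegral_enorm _).trans ?_
    calc _ ≤ ∫⁻ r in Ioo 0 t, ENNReal.ofReal (C * D / (n + 1))
            * (extendTime ν r).totalVariation univ := lintegral_mono fun r => enorm_vint_le _ hn
      _ ≤ ∫⁻ r in Ioo (0 : ℝ) 1, ENNReal.ofReal (C * D / (n + 1))
            * (extendTime ν r).totalVariation univ :=
          lintegral_mono_set (Ioo_subset_Ioo_right ht.2)
      _ = _ := lintegral_const_mul' _ _ ENNReal.ofReal_ne_top
  have hC0 : 0 ≤ C := (abs_nonneg _).trans (hC 0)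
  rw [← toReal_enorm]
  refine (ENNReal.toReal_mono (ENNReal.mul_ne_top ENNReal.ofReal_ne_top hTV'.ne) hfin).trans ?_
  rw [ENNReal.toReal_mul, ENNReal.toReal_ofReal (by positivity)]
  apply le_of_eq; ring

end

section

/-! ### The action density -/

variable {p M : ℝ} {m : ℝ → ℝ}

/-- The mobility extended continuously to the real line. -/
def mobilityExt (M : ℝ) (m : ℝ → ℝ) (x : ℝ) : ℝ := m (max 0 (min x M))

lemma mobilityExt_of_mem {x : ℝ} (hx : x ∈ Icc 0 M) : mobilityExt M m x = m x := by
  simp [mobilityExt, min_eq_left hx.2, max_eq_right hx.1]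

lemma IsMobility.continuous_ext (hm : IsMobility M m) (hM : 0 ≤ M) :
    Continuous (mobilityExt M m) :=
  hm.continuousOn.comp_continuous (by fun_prop) fun x =>
    ⟨le_max_left _ _, max_le hM (min_le_right _ _)⟩

lemma measurable_actionDensity (hm : IsMobility M m) (hM : 0 ≤ M) :
    Measurable fun z : ℝ × ℝ => actionDensity p M m z.1 z.2 := by
  have h : (fun z : ℝ × ℝ => actionDensity p M m z.1 z.2)
      = fun z : ℝ × ℝ => if z.1 < 0 ∨ M < z.1 then ⊤
        else if 0 < mobilityExt M m z.1 then
          ENNReal.ofReal (|z.2| ^ p / mobilityExt M m z.1 ^ (p - 1))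
        else if z.2 = 0 then 0 else ⊤ := by
    funext z
    unfold actionDensity
    by_cases h1 : z.1 < 0 ∨ M < z.1
    · rw [if_pos h1, if_pos h1]
    · rw [if_neg h1, if_neg h1]
      rw [not_or, not_lt, not_lt] at h1
      rw [mobilityExt_of_mem (m := m) (show z.1 ∈ Icc 0 M from h1)]
  rw [h]
  have hme := (hm.continuous_ext hM).measurable
  refine Measurable.ite ?_ measurable_const (Measurable.ite ?_ ?_ (Measurable.ite ?_ ?_ ?_))
  · exact (measurableSet_lt measurable_fst measurable_const).union
      (measurableSet_lt measurable_const measurable_fst)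
  · exact measurableSet_lt measurable_const (hme.comp measurable_fst)
  · refine ENNReal.measurable_ofReal.comp ?_
    have h1 : Measurable fun z : ℝ × ℝ => |z.2| ^ p := by fun_prop
    have h2 : Measurable fun z : ℝ × ℝ => mobilityExt M m z.1 ^ (p - 1) :=
      (hme.comp measurable_fst).pow_const _
    exact h1.div h2
  · exact measurableSet_eq_fun measurable_snd measurable_const
  · exact measurable_const
  · exact measurable_const

/-- With its converse `actionDensity_le_of_enorm_le`, this rewrites an upper bound on the action
density in Hölder form, which treats m(ρ) > 0 and m(ρ) = 0 alike. Infinite values must be excluded,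
since ⊤ * 0 = 0 would make the right side vanish. -/
lemma enorm_le_of_actionDensity_ne_top (hp : 1 < p) {ρ j : ℝ}
    (h : actionDensity p M m ρ j ≠ ⊤) :
    ‖j‖ₑ ≤ actionDensity p M m ρ j ^ (1 / p) * ENNReal.ofReal (m ρ) ^ (1 - 1 / p) := by
  have hp0 : 0 < p := by linarith
  unfold actionDensity at h ⊢
  by_cases h1 : ρ < 0 ∨ M < ρ
  · simp [h1] at h
  rw [if_neg h1] at h ⊢
  by_cases h2 : 0 < m ρ
  · rw [if_pos h2]
    have hx : 0 ≤ |j| ^ p / m ρ ^ (p - 1) := by positivity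
    rw [ENNReal.ofReal_rpow_of_nonneg hx (by positivity), ENNReal.ofReal_rpow_of_pos h2,
      ← ENNReal.ofReal_mul (by positivity), ← ofReal_norm, Real.norm_eq_abs]
    apply ENNReal.ofReal_le_ofReal
    rw [Real.div_rpow (by positivity) (by positivity), ← Real.rpow_mul (abs_nonneg _),
      ← Real.rpow_mul h2.le, mul_one_div_cancel hp0.ne', Real.rpow_one, div_mul_eq_mul_div,
      mul_div_assoc, ← Real.rpow_sub h2]
    have : 1 - 1 / p - (p - 1) * (1 / p) = 0 := by field_simp; ring
    rw [this]; simp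
  · rw [if_neg h2] at h ⊢
    by_cases h3 : j = 0
    · simp [h3]
    · simp [h3] at h

lemma actionDensity_le_of_enorm_le (hp : 1 < p) (hm : IsMobility M m) {ρ j : ℝ}
    (hρ : ρ ∈ Icc 0 M) {A : ℝ≥0∞}
    (h : ‖j‖ₑ ≤ A ^ (1 / p) * ENNReal.ofReal (m ρ) ^ (1 - 1 / p)) :
    actionDensity p M m ρ j ≤ A := by
  rcases eq_or_ne A ⊤ with rfl | hA
  · exact le_top
  have hp0 : 0 < p := by linarith
  have hq : 0 < 1 - 1 / p := by rw [sub_pos, div_lt_one hp0]; exact hp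
  unfold actionDensity
  have h1 : ¬(ρ < 0 ∨ M < ρ) := by simp [hρ.1, hρ.2]
  rw [if_neg h1]
  lift A to NNReal using hA
  split_ifs with h2 h3
  · apply ENNReal.ofReal_le_of_le_toReal
    rw [div_le_iff₀ (by positivity)]
    rw [ENNReal.ofReal_rpow_of_pos h2, ← ofReal_norm, Real.norm_eq_abs,
      ← ENNReal.ofReal_coe_nnreal, ENNReal.ofReal_rpow_of_nonneg A.coe_nonneg (by positivity),
      ← ENNReal.ofReal_mul (by positivity), ENNReal.ofReal_le_ofReal_iff (by positivity)] at h
    calc |j| ^ p ≤ ((A : ℝ) ^ (1 / p) * m ρ ^ (1 - 1 / p)) ^ p := by gcongr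
      _ = A * m ρ ^ (p - 1) := by
        rw [Real.mul_rpow (by positivity) (by positivity), ← Real.rpow_mul A.coe_nonneg,
          ← Real.rpow_mul h2.le, one_div_mul_cancel hp0.ne', Real.rpow_one]
        congr 2
        field_simp
      _ = _ := by simp
  · exact zero_le
  · exfalso
    have : m ρ = 0 := le_antisymm (not_lt.1 h2) (hm.nonneg ρ hρ)
    rw [this, ENNReal.ofReal_zero, ENNReal.zero_rpow_of_pos hq, mul_zero] at h
    simp at h
    exact h3 h

lemma mem_Icc_of_actionDensity_ne_top {ρ j : ℝ} (h : actionDensity p M m ρ j ≠ ⊤) :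
    ρ ∈ Icc 0 M := by
  unfold actionDensity at h
  by_cases h1 : ρ < 0 ∨ M < ρ
  · simp [h1] at h
  · rw [not_or, not_lt, not_lt] at h1; exact h1

/-- Jensen's inequality for the action density. -/
lemma actionDensity_integral_le (hp : 1 < p) (hM : 0 ≤ M) (hm : IsMobility M m) {Ω : Type*}
    [MeasurableSpace Ω] (κ : Measure Ω) [IsProbabilityMeasure κ] {ρ j : Ω → ℝ} (hρ : Measurable ρ)
    (hj : Measurable j) (hρM : ∀ᵐ u ∂κ, ρ u ∈ Icc 0 M) :
    actionDensity p M m (∫ u, ρ u ∂κ) (∫ u, j u ∂κ)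
      ≤ ∫⁻ u, actionDensity p M m (ρ u) (j u) ∂κ := by
  have hp0 : 0 < p := by linarith
  have hq : 0 < 1 - 1 / p := by rw [sub_pos, div_lt_one hp0]; exact hp
  have hAD : Measurable fun u => actionDensity p M m (ρ u) (j u) :=
    (measurable_actionDensity hm hM).comp (hρ.prodMk hj)
  rcases eq_or_ne (∫⁻ u, actionDensity p M m (ρ u) (j u) ∂κ) ⊤ with htop | htop
  · rw [htop]; exact le_top
  have hρi : Integrable ρ κ := Integrable.of_mem_Icc 0 M hρ.aemeasurable hρM
  have hmeas : Measurable fun u => mobilityExt M m (ρ u) :=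
    (hm.continuous_ext hM).measurable.comp hρ
  have hext : ∀ᵐ u ∂κ, mobilityExt M m (ρ u) = m (ρ u) := by
    filter_upwards [hρM] with u h using mobilityExt_of_mem h
  obtain ⟨B, hB⟩ := isCompact_Icc.exists_bound_of_continuousOn hm.continuousOn
  have hmi : Integrable (fun u => m (ρ u)) κ := by
    refine Integrable.of_bound (hmeas.aestronglyMeasurable.congr hext) B ?_
    filter_upwards [hρM] with u h using hB _ h
  have hmean : ∫ u, ρ u ∂κ ∈ Icc 0 M :=
    (convex_Icc (0 : ℝ) M).integral_mem isClosed_Icc hρM hρi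
  refine actionDensity_le_of_enorm_le hp hm hmean ?_
  -- Hölder with exponents p and p/(p-1) separates action and mobility; Jensen for the concave m
  -- then moves the mean of ρ inside.
  calc ‖∫ u, j u ∂κ‖ₑ ≤ ∫⁻ u, ‖j u‖ₑ ∂κ := enorm_integral_le_lintegral_enorm _
    _ ≤ ∫⁻ u, actionDensity p M m (ρ u) (j u) ^ (1 / p)
          * ENNReal.ofReal (mobilityExt M m (ρ u)) ^ (1 - 1 / p) ∂κ := by
        refine lintegral_mono_ae ?_
        filter_upwards [ae_lt_top hAD htop, hext] with u h1 h2
        rw [h2]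
        exact enorm_le_of_actionDensity_ne_top hp h1.ne
    _ ≤ (∫⁻ u, actionDensity p M m (ρ u) (j u) ∂κ) ^ (1 / p)
          * (∫⁻ u, ENNReal.ofReal (mobilityExt M m (ρ u)) ∂κ) ^ (1 - 1 / p) :=
        ENNReal.lintegral_mul_norm_pow_le hAD.aemeasurable hmeas.ennreal_ofReal.aemeasurable
          (by positivity) hq.le (by ring)
    _ ≤ (∫⁻ u, actionDensity p M m (ρ u) (j u) ∂κ) ^ (1 / p)
          * ENNReal.ofReal (m (∫ u, ρ u ∂κ)) ^ (1 - 1 / p) := by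
        gcongr
        rw [lintegral_congr_ae (hext.mono fun u h => by rw [h]),
          ← ofReal_integral_eq_lintegral_ofReal hmi
            (hρM.mono fun u h => hm.nonneg _ h)]
        exact ENNReal.ofReal_le_ofReal
          (hm.concaveOn.le_map_integral hm.continuousOn isClosed_Icc hρM hρi hmi)

lemma actionDensity_zero_flux {ρ : ℝ} (hp : 1 < p) (hρ : ρ ∈ Icc 0 M) :
    actionDensity p M m ρ 0 = 0 := by
  unfold actionDensity
  have h1 : ¬(ρ < 0 ∨ M < ρ) := by simp [hρ.1, hρ.2]
  have hp0 : p ≠ 0 := by linarith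
  rw [if_neg h1]
  simp [Real.zero_rpow hp0]

/-- Convexity of the action density along a segment. -/
lemma actionDensity_convex_le (hp : 1 < p) (hM : 0 ≤ M) (hm : IsMobility M m) {a ρ₁ ρ₂ j₁ j₂ : ℝ}
    (ha : a ∈ Icc (0 : ℝ) 1) (h₁ : ρ₁ ∈ Icc 0 M) (h₂ : ρ₂ ∈ Icc 0 M) :
    actionDensity p M m (a * ρ₁ + (1 - a) * ρ₂) (a * j₁ + (1 - a) * j₂)
      ≤ actionDensity p M m ρ₁ j₁ + actionDensity p M m ρ₂ j₂ := by
  -- Jensen on a two-point probability space; the weights on the right are then bounded by 1.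
  let κ : Measure Bool := ENNReal.ofReal a • Measure.dirac true
    + ENNReal.ofReal (1 - a) • Measure.dirac false
  have hκ : IsProbabilityMeasure κ := ⟨by
    simp only [κ, Measure.add_apply, Measure.smul_apply, measure_univ, smul_eq_mul, mul_one]
    rw [← ENNReal.ofReal_add ha.1 (by linarith [ha.2])]; simp⟩
  have hint : ∀ x y : ℝ, ∫ b, (if b then x else y) ∂κ = a * x + (1 - a) * y := fun x y => by
    rw [integral_add_measure]
    · simp [ha.1, ha.2]
    · exact (integrable_dirac (by finiteness)).smul_measure (by finiteness)
    · exact (integrable_dirac (by finiteness)).smul_measure (by finiteness)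
  have hJ := actionDensity_integral_le (p := p) hp hM hm κ
    (ρ := fun b => if b then ρ₁ else ρ₂) (j := fun b => if b then j₁ else j₂)
    (measurable_of_countable _) (measurable_of_countable _)
    (ae_of_all _ fun b : Bool => by cases b <;> simpa)
  rw [hint, hint] at hJ
  refine hJ.trans ?_
  simp only [κ, lintegral_add_measure, lintegral_smul_measure, lintegral_dirac, smul_eq_mul]
  gcongr
  · simpa using mul_le_of_le_one_left zero_le (ENNReal.ofReal_le_one.2 ha.2)
  · simpa using mul_le_of_le_one_left zero_le (ENNReal.ofReal_le_one.2 (by linarith [ha.1]))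

lemma rpow_mul_rpow_le_add {r : ℝ} (hr : 0 ≤ r) (hr1 : r ≤ 1) (x y : ℝ≥0∞) :
    x ^ r * y ^ (1 - r) ≤ x + y := by
  calc x ^ r * y ^ (1 - r) ≤ (x + y) ^ r * (x + y) ^ (1 - r) := by
        have hr2 : 0 ≤ 1 - r := by linarith
        gcongr
        · exact le_self_add
        · exact le_add_self
    _ = x + y := by
      rw [← ENNReal.rpow_add_of_nonneg _ _ hr (by linarith)]; simp

lemma BoundedTheta.exists_bound (h : BoundedTheta M m) (hm : IsMobility M m) :
    ∃ Θ : ℝ, 0 ≤ Θ ∧ ∀ ρ ∈ Icc 0 M, m ρ ≤ Θ * ρ := by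
  obtain ⟨B, hB⟩ := h
  refine ⟨max B 0, le_max_right _ _, fun ρ hρ => ?_⟩
  rcases hρ.1.eq_or_lt with h0 | h0
  · rw [← h0, hm.map_zero]; simp
  · have := hB ⟨ρ, ⟨h0, hρ.2⟩, rfl⟩
    simp only [div_le_iff₀ h0] at this
    exact this.trans (by gcongr; exact le_max_left _ _)

/-- Boundedness of θ enters: m(ρ) ≤ Θ ρ turns the Hölder form into a majorant of |j| that is
integrable whenever the action is finite. -/
lemma enorm_le_actionDensity_add (hp : 1 < p) {Θ : ℝ}
    (hΘ : ∀ ρ ∈ Icc 0 M, m ρ ≤ Θ * ρ) (ρ j : ℝ) :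
    ‖j‖ₑ ≤ actionDensity p M m ρ j + ENNReal.ofReal (Θ * ρ) := by
  have hp0 : 0 < p := by linarith
  rcases eq_or_ne (actionDensity p M m ρ j) ⊤ with h | h
  · simp [h]
  refine (enorm_le_of_actionDensity_ne_top hp h).trans
    ((rpow_mul_rpow_le_add (by positivity) ?_ _ _).trans ?_)
  · rw [div_le_one hp0]; exact hp.le
  · gcongr
    exact hΘ _ (mem_Icc_of_actionDensity_ne_top h)

lemma totalVariation_withDensity {j : ℝ → ℝ} (hj : Integrable j) :
    SignedMeasure.totalVariation (volume.withDensityᵥ j)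
      = volume.withDensity fun x => ‖j x‖ₑ := by
  rw [SignedMeasure.totalVariation_eq_variation, Measure.variation_withDensityᵥ hj]

lemma withDensity_rnDeriv_of_totalVariation {ν : SignedMeasure ℝ}
    (h : ν.totalVariation ≪ volume) : volume.withDensityᵥ (ν.rnDeriv volume) = ν := by
  apply SignedMeasure.withDensityᵥ_rnDeriv_eq
  rw [SignedMeasure.absolutelyContinuous_ennreal_iff]
  have e : (volume : Measure ℝ).toENNRealVectorMeasure.ennrealToMeasure = volume :=
    VectorMeasure.equivMeasure.right_inv (volume : Measure ℝ)
  rwa [e]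

/-- Finite total action therefore gives a flux of finite mass on (0, 1) × ℝ, not just a locally
finite one. -/
lemma totalVariation_univ_le_action (hp : 1 < p) {Θ : ℝ} (hΘ0 : 0 ≤ Θ)
    (hΘ : ∀ ρ ∈ Icc 0 M, m ρ ≤ Θ * ρ) (μ : Measure ℝ) [IsProbabilityMeasure μ]
    (ν : SignedMeasure ℝ) :
    ν.totalVariation univ ≤ action p M m μ ν + ENNReal.ofReal Θ := by
  unfold action
  split_ifs with h
  · have hν := withDensity_rnDeriv_of_totalVariation h.2
    conv_lhs => rw [← hν, totalVariation_withDensity (SignedMeasure.integrable_rnDeriv _ _),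
      withDensity_apply _ MeasurableSet.univ, Measure.restrict_univ]
    calc ∫⁻ x, ‖ν.rnDeriv volume x‖ₑ
        ≤ ∫⁻ x, (actionDensity p M m (μ.rnDeriv volume x).toReal (ν.rnDeriv volume x)
          + ENNReal.ofReal Θ * μ.rnDeriv volume x) := by
          refine lintegral_mono fun x => (enorm_le_actionDensity_add hp hΘ
            (μ.rnDeriv volume x).toReal _).trans ?_
          gcongr
          rw [ENNReal.ofReal_mul hΘ0]
          gcongr
          exact ENNReal.ofReal_toReal_le
      _ = _ := by
          rw [lintegral_add_right _ ((Measure.measurable_rnDeriv _ _).const_mul _),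
            lintegral_const_mul _ (Measure.measurable_rnDeriv _ _),
            Measure.lintegral_rnDeriv h.1]
          simp
  · simp

/-- Mollification does not increase the action. -/
lemma lintegral_actionDensity_conv_le (hp : 1 < p) (hM : 0 ≤ M) (hm : IsMobility M m) {ε : ℝ}
    (hε : 0 < ε) {μ : Measure ℝ} [IsProbabilityMeasure μ]
    (hμM : ∀ᵐ x, μ.rnDeriv volume x ≤ ENNReal.ofReal M) (ν : SignedMeasure ℝ) :
    ∫⁻ y, actionDensity p M m (convMeasure (mollifier ε) μ y) (convSigned (mollifier ε) ν y)
      ≤ action p M m μ ν := by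
  unfold action
  split_ifs with h
  swap
  · exact le_top
  set ρ : ℝ → ℝ := fun x => (μ.rnDeriv volume x).toReal with hρ_def
  set j : ℝ → ℝ := ν.rnDeriv volume with hj_def
  have hρ : Measurable ρ := (Measure.measurable_rnDeriv _ _).ennreal_toReal
  have hj : Measurable j := SignedMeasure.measurable_rnDeriv _ _
  have hji : Integrable j := SignedMeasure.integrable_rnDeriv _ _
  have hν : volume.withDensityᵥ j = ν := withDensity_rnDeriv_of_totalVariation h.2
  have hk : ∀ y, Measurable fun x => mollifier ε (y - x) := fun y =>
    (continuous_mollifier ε).measurable.comp (by fun_prop)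
  obtain ⟨C, hC⟩ := (continuous_mollifier ε).bounded_above_of_compact_support
    (hasCompactSupport_mollifier hε)
  -- The kernel centred at y is a probability measure, and both mollifications at y are averages
  -- against it. Jensen applies for each y, and Tonelli integrates the kernel out again.
  let κ : ℝ → Measure ℝ := fun y => volume.withDensity fun x => ENNReal.ofReal (mollifier ε (y - x))
  have hκ : ∀ y, IsProbabilityMeasure (κ y) := fun y => ⟨by
    rw [withDensity_apply _ MeasurableSet.univ, Measure.restrict_univ,
      ← ofReal_integral_eq_lintegral_ofReal ((integrable_mollifier hε).comp_sub_left y)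
        (ae_of_all _ fun x => mollifier_nonneg hε _),
      integral_sub_left_eq_self (mollifier ε) volume y, integral_mollifier hε]
    simp⟩
  have hκi : ∀ y (g : ℝ → ℝ), ∫ x, g x ∂κ y = ∫ x, mollifier ε (y - x) * g x := fun y g => by
    rw [integral_withDensity_eq_integral_toReal_smul (hk y).ennreal_ofReal (by simp)]
    simp [ENNReal.toReal_ofReal (mollifier_nonneg hε _)]
  have e1 : ∀ y, convMeasure (mollifier ε) μ y = ∫ x, ρ x ∂κ y := fun y => by
    rw [hκi, convMeasure, ← integral_rnDeriv_smul h.1]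
    simp [hρ_def, mul_comm]
  have e2 : ∀ y, convSigned (mollifier ε) ν y = ∫ x, j x ∂κ y := fun y => by
    rw [hκi, convSigned]
    conv_lhs => rw [← hν]
    exact vint_withDensity hji (hk y) fun x => hC _
  have hρM : ∀ᵐ x, ρ x ∈ Icc 0 M := by
    filter_upwards [hμM] with x hx
    exact ⟨ENNReal.toReal_nonneg, ENNReal.toReal_le_of_le_ofReal hM hx⟩
  have hAD : Measurable fun x => actionDensity p M m (ρ x) (j x) :=
    (measurable_actionDensity hm hM).comp (hρ.prodMk hj)
  have hk' : ∀ x, Measurable fun y => mollifier ε (y - x) := fun x =>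
    (continuous_mollifier ε).measurable.comp (by fun_prop)
  have hk2 : Measurable fun z : ℝ × ℝ => ENNReal.ofReal (mollifier ε (z.1 - z.2)) :=
    ((continuous_mollifier ε).measurable.comp (by fun_prop)).ennreal_ofReal
  calc ∫⁻ y, actionDensity p M m (convMeasure (mollifier ε) μ y) (convSigned (mollifier ε) ν y)
      ≤ ∫⁻ y, ∫⁻ x, ENNReal.ofReal (mollifier ε (y - x)) * actionDensity p M m (ρ x) (j x) := by
        refine lintegral_mono fun y => ?_
        rw [e1, e2]
        refine (actionDensity_integral_le hp hM hm (κ y) hρ hj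
          ((withDensity_absolutelyContinuous _ _).ae_le hρM)).trans ?_
        rw [lintegral_withDensity_eq_lintegral_mul _ (hk y).ennreal_ofReal hAD]
        rfl
    _ = ∫⁻ x, ∫⁻ y, ENNReal.ofReal (mollifier ε (y - x)) * actionDensity p M m (ρ x) (j x) := by
        rw [lintegral_lintegral_swap]
        exact (hk2.mul (hAD.comp measurable_snd)).aemeasurable
    _ = ∫⁻ x, actionDensity p M m (ρ x) (j x) := by
        refine lintegral_congr fun x => ?_
        rw [lintegral_mul_const _ (hk' x).ennreal_ofReal,
          ← ofReal_integral_eq_lintegral_ofReal ((integrable_mollifier hε).comp_sub_right x)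
            (ae_of_all _ fun y => mollifier_nonneg hε _),
          integral_sub_right_eq_self (mollifier ε) x, integral_mollifier hε]
        simp

end

section

/-! ### Mollified solutions -/

variable {μ : ℝ → Measure ℝ} {ν : ℝ → SignedMeasure ℝ}

lemma hasDerivAt_mollifier (ε u : ℝ) :
    HasDerivAt (mollifier ε) (deriv (mollifier ε) u) u :=
  ((contDiff_mollifier ε (n := 1)).differentiable (by simp) u).hasDerivAt

lemma continuous_deriv_mollifier (ε : ℝ) : Continuous (deriv (mollifier ε)) :=
  (contDiff_mollifier ε (n := 1)).continuous_deriv le_rfl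

lemma exists_mollifier_bound {ε : ℝ} (hε : 0 < ε) :
    ∃ C : ℝ, 0 ≤ C ∧ (∀ x, |mollifier ε x| ≤ C) ∧ ∀ x, |deriv (mollifier ε) x| ≤ C := by
  obtain ⟨C₁, h₁⟩ := (continuous_mollifier ε).bounded_above_of_compact_support
    (hasCompactSupport_mollifier hε)
  obtain ⟨C₂, h₂⟩ := (continuous_deriv_mollifier ε).bounded_above_of_compact_support
    (hasCompactSupport_mollifier hε).deriv
  exact ⟨max C₁ C₂, ((norm_nonneg _).trans (h₁ 0)).trans (le_max_left _ _),
    fun x => (h₁ x).trans (le_max_left _ _), fun x => (h₂ x).trans (le_max_right _ _)⟩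

/-- The test function is x ↦ φ(y - x); the reflection produces the sign. With the mollifier for φ
this reads ∂_t ρ_ε = -∂_y j_ε, with the smooth step ∂_t F_ε = -j_ε, both for every y. -/
lemma IsIntegratedCE.conv_sub_eq (h : IsIntegratedCE μ ν) {φ φ' : ℝ → ℝ} {C : ℝ}
    (hφ : ∀ x, HasDerivAt φ (φ' x) x) (hφ' : Continuous φ') (hs : HasCompactSupport φ')
    (hC : ∀ x, |φ x| ≤ C) (y : ℝ) {t : ℝ} (ht : t ∈ Icc (0 : ℝ) 1) :
    convMeasure φ (μ t) y - convMeasure φ (μ 0) y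
      = -∫ r in (0 : ℝ)..t, convSigned φ' (ν r) y := by
  have h1 := h.sub_eq (fun x => φ (y - x)) (fun x => -φ' (y - x)) C
    (fun x => by simpa using (hφ (y - x)).comp_const_sub y x)
    (hφ'.comp (by fun_prop)).neg ?_ (fun x => hC _) t ht
  · simp_rw [convMeasure]
    rw [h1, ← intervalIntegral.integral_neg]
    congr 1
    funext r
    exact VectorMeasure.integral_fun_neg (μ := ν r) (B := ContinuousLinearMap.lsmul ℝ ℝ)
      fun x => φ' (y - x)
  · exact (hs.comp_homeomorph (Homeomorph.subLeft y)).neg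

/-- Exchange of the order of integration combined with an integration by parts in space. -/
lemma integral_swap_parts {ξ ξ' J J' : ℝ → ℝ → ℝ} {T N C : ℝ} {B : ℝ → ℝ≥0∞}
    (hξ : ∀ t y, HasDerivAt (ξ t) (ξ' t y) y) (hξc : Continuous fun z : ℝ × ℝ => ξ z.1 z.2)
    (hξ' : ∀ t, Continuous (ξ' t)) (hξs : ∀ t y, y ∉ Icc (-N) N → ξ t y = 0)
    (hC : ∀ t y, |ξ t y| ≤ C) (hJ : ∀ t y, HasDerivAt (J t) (J' t y) y)
    (hJ' : ∀ t, Continuous (J' t)) (hJm : Measurable fun z : ℝ × ℝ => J' z.1 z.2)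
    (hB : ∀ t y, ‖J' t y‖ₑ ≤ B t) (hBT : ∫⁻ t in Ioo 0 T, B t < ⊤) :
    ∫ y, ∫ t in Ioo 0 T, ξ t y * J' t y = -∫ t in Ioo 0 T, ∫ y, ξ' t y * J t y := by
  have hint : Integrable (fun z : ℝ × ℝ => ξ z.1 z.2 * J' z.1 z.2)
      ((volume.restrict (Ioo 0 T)).prod volume) := by
    refine ⟨(hξc.measurable.mul hJm).aestronglyMeasurable, ?_⟩
    rw [HasFiniteIntegral, lintegral_prod _ (show Measurable fun z : ℝ × ℝ => ‖ξ z.1 z.2 * J' z.1 z.2‖ₑ from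
      (hξc.measurable.mul hJm).enorm).aemeasurable]
    calc ∫⁻ t in Ioo 0 T, ∫⁻ y, ‖ξ t y * J' t y‖ₑ
        ≤ ∫⁻ t in Ioo 0 T, B t * (ENNReal.ofReal C * volume (Icc (-N) N)) := by
          refine lintegral_mono fun t => ?_
          calc ∫⁻ y, ‖ξ t y * J' t y‖ₑ
              ≤ ∫⁻ y, (Icc (-N) N).indicator (fun _ => B t * ENNReal.ofReal C) y := by
                refine lintegral_mono fun y => ?_
                by_cases hy : y ∈ Icc (-N) N
                · rw [indicator_of_mem hy, enorm_mul, mul_comm]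
                  gcongr
                  · exact hB t y
                  · rw [← ofReal_norm]; exact ENNReal.ofReal_le_ofReal (hC t y)
                · simp [hξs t y hy]
            _ = _ := by rw [lintegral_indicator_const measurableSet_Icc, mul_assoc]
      _ = (∫⁻ t in Ioo 0 T, B t) * (ENNReal.ofReal C * volume (Icc (-N) N)) :=
          lintegral_mul_const' _ _ (by simp [ENNReal.mul_eq_top])
      _ < ⊤ := ENNReal.mul_lt_top hBT (by simp [ENNReal.mul_lt_top_iff])
  have hswap := integral_integral_swap (f := fun t y => ξ t y * J' t y) hint
  rw [← hswap, ← integral_neg]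
  congr 1
  funext t
  have hcs : HasCompactSupport (ξ t) := HasCompactSupport.intro isCompact_Icc (hξs t)
  have hcs' : HasCompactSupport (ξ' t) := by
    have : ξ' t = deriv (ξ t) := funext fun y => ((hξ t y).deriv).symm
    rw [this]; exact hcs.deriv
  have hcξ : Continuous (ξ t) := continuous_iff_continuousAt.2 fun y => (hξ t y).continuousAt
  have hcJ : Continuous (J t) := continuous_iff_continuousAt.2 fun y => (hJ t y).continuousAt
  exact integral_mul_deriv_eq_deriv_mul_of_integrable (fun y _ => hξ t y) (fun y _ => hJ t y)
    ((hcξ.mul (hJ' t)).integrable_of_hasCompactSupport hcs.mul_right)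
    (((hξ' t).mul hcJ).integrable_of_hasCompactSupport hcs'.mul_right)
    ((hcξ.mul hcJ).integrable_of_hasCompactSupport hcs.mul_right)

/-- A pair of functions whose time increments are given by the space derivative of the flux
solves the continuity equation in the sense of distributions. -/
lemma weak_eq_of_pointwise {D J J' : ℝ → ℝ → ℝ} {c C : ℝ} {B : ℝ → ℝ≥0∞}
    (hD : ∀ y, ∀ t ∈ Icc (0 : ℝ) 1, D t y - D 0 y = -∫ r in (0 : ℝ)..t, J' r y)
    (hDm : Measurable fun z : ℝ × ℝ => D z.1 z.2) (hDC : ∀ t ∈ Icc (0 : ℝ) 1, ∀ y, |D t y| ≤ C)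
    (hJ : ∀ t y, HasDerivAt (J t) (J' t y) y)
    (hJ' : ∀ t, Continuous (J' t)) (hJm : Measurable fun z : ℝ × ℝ => J' z.1 z.2)
    (hB : ∀ t y, ‖J' t y‖ₑ ≤ B t) (hBT : ∫⁻ t in Ioo (0 : ℝ) 1, B t < ⊤)
    (hJs : ∀ t y, y ∉ Icc (-c) c → J' t y = 0)
    {ξ : ℝ × ℝ → ℝ} (hξ : ContDiff ℝ 1 ξ) (hξs : HasCompactSupport ξ)
    (hξt : tsupport ξ ⊆ Ioo (0 : ℝ) 1 ×ˢ (univ : Set ℝ)) :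
    (∫ t in Ioo (0 : ℝ) 1, ∫ y in Icc (-c) c, fderiv ℝ ξ (t, y) (1, 0) * D t y)
      + (∫ t in Ioo (0 : ℝ) 1, ∫ y, fderiv ℝ ξ (t, y) (0, 1) * J t y) = 0 := by
  have hdiff : ∀ z, HasFDerivAt ξ (fderiv ℝ ξ z) z := fun z =>
    (hξ.differentiable (by simp) z).hasFDerivAt
  have hdc : Continuous (fderiv ℝ ξ) := hξ.continuous_fderiv (by simp)
  have hdt : ∀ t y, HasDerivAt (fun t => ξ (t, y)) (fderiv ℝ ξ (t, y) (1, 0)) t := fun t y =>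
    (hdiff (t, y)).comp_hasDerivAt t ((hasDerivAt_id t).prodMk (hasDerivAt_const t y))
  have hdy : ∀ t y, HasDerivAt (fun y => ξ (t, y)) (fderiv ℝ ξ (t, y) (0, 1)) y := fun t y =>
    (hdiff (t, y)).comp_hasDerivAt y ((hasDerivAt_const y t).prodMk (hasDerivAt_id y))
  obtain ⟨C₁, hC₁⟩ := hξ.continuous.bounded_above_of_compact_support hξs
  have hc1 : Continuous fun z : ℝ × ℝ => fderiv ℝ ξ z (1, 0) := hdc.clm_apply continuous_const
  have hc2 : Continuous fun z : ℝ × ℝ => fderiv ℝ ξ z (0, 1) := hdc.clm_apply continuous_const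
  obtain ⟨C₂, hC₂⟩ := hc1.bounded_above_of_compact_support
    ((hξs.fderiv ℝ).comp_left (g := fun L : ℝ × ℝ →L[ℝ] ℝ => L (1, 0)) (by simp))
  obtain ⟨N, hN⟩ := hξs.isBounded.exists_norm_le
  have hsupp : ∀ t y, y ∉ Icc (-N) N → ξ (t, y) = 0 := by
    intro t y hy
    apply image_eq_zero_of_notMem_tsupport
    intro hz
    have h1 : |y| ≤ N := (norm_snd_le (t, y)).trans (hN _ hz)
    exact hy (abs_le.1 h1)
  have hend : ∀ t, t ∉ Ioo (0 : ℝ) 1 → ∀ y, ξ (t, y) = 0 := fun t ht y =>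
    image_eq_zero_of_notMem_tsupport fun hz => ht (hξt hz).1
  have hJi : ∀ y, IntegrableOn (fun t => J' t y) (Ioo 0 1) := fun y =>
    ⟨(hJm.comp (by fun_prop : Measurable fun t : ℝ => (t, y))).aestronglyMeasurable,
      (lintegral_mono fun t => hB t y).trans_lt hBT⟩
  have hfirst : (∫ t in Ioo (0 : ℝ) 1, ∫ y in Icc (-c) c, fderiv ℝ ξ (t, y) (1, 0) * D t y)
      = ∫ y in Icc (-c) c, ∫ t in Ioo (0 : ℝ) 1, fderiv ℝ ξ (t, y) (1, 0) * D t y := by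
    apply integral_integral_swap
    refine Integrable.mono' (g := fun _ => C₂ * C) (integrable_const _)
      (hc1.measurable.mul hDm).aestronglyMeasurable ?_
    rw [Measure.prod_restrict]
    refine (ae_restrict_mem (measurableSet_Ioo.prod measurableSet_Icc)).mono fun z hz => ?_
    rw [Function.uncurry, norm_mul]
    gcongr
    · exact (norm_nonneg _).trans (hC₂ 0)
    · exact hC₂ _
    · exact hDC _ (Ioo_subset_Icc_self hz.1) _
  -- Integration by parts in time at fixed y. The initial value D 0 y drops out because ξ vanishes
  -- at t = 0 and t = 1.
  have hinner : ∀ y, ∫ t in Ioo (0 : ℝ) 1, fderiv ℝ ξ (t, y) (1, 0) * D t y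
      = ∫ t in Ioo (0 : ℝ) 1, ξ (t, y) * J' t y := by
    intro y
    have hχ : ContDiff ℝ 1 fun t => ξ (t, y) := hξ.comp (by fun_prop)
    have hχd : deriv (fun t => ξ (t, y)) = fun t => fderiv ℝ ξ (t, y) (1, 0) :=
      funext fun t => (hdt t y).deriv
    have h1 := integral_deriv_mul_primitive hχ (hJi y)
    rw [hend 1 (by simp), zero_mul, zero_sub, intervalIntegral.integral_of_le zero_le_one,
      intervalIntegral.integral_of_le zero_le_one, integral_Ioc_eq_integral_Ioo,
      integral_Ioc_eq_integral_Ioo, hχd] at h1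
    have hcd : Continuous fun t => fderiv ℝ ξ (t, y) (1, 0) := hc1.comp (by fun_prop)
    have hconst : ∫ t in Ioo (0 : ℝ) 1, fderiv ℝ ξ (t, y) (1, 0) * D 0 y = 0 := by
      rw [integral_mul_const, ← integral_Ioc_eq_integral_Ioo,
        ← intervalIntegral.integral_of_le zero_le_one,
        intervalIntegral.integral_eq_sub_of_hasDerivAt (fun t _ => hdt t y)
          (hcd.intervalIntegrable _ _), hend 1 (by simp), hend 0 (by simp)]
      simp
    have hJii : IntegrableOn (fun t => J' t y) (Icc 0 1) := by
      rw [integrableOn_Icc_iff_integrableOn_Ioo]; exact hJi y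
    have hprim : ContinuousOn (fun t => ∫ r in (0 : ℝ)..t, J' r y) (Icc 0 1) := by
      have := intervalIntegral.continuousOn_primitive_interval (μ := volume)
        (f := fun t => J' t y) (a := 0) (b := 1) (by rwa [uIcc_of_le zero_le_one])
      rwa [uIcc_of_le zero_le_one] at this
    have hi1 : IntegrableOn (fun t => fderiv ℝ ξ (t, y) (1, 0) * D 0 y) (Ioo 0 1) :=
      ((hcd.mul continuous_const).continuousOn.integrableOn_Icc).mono_set Ioo_subset_Icc_self
    have hi2 : IntegrableOn (fun t => fderiv ℝ ξ (t, y) (1, 0) * ∫ r in (0 : ℝ)..t, J' r y)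
        (Ioo 0 1) :=
      ((hcd.continuousOn.mul hprim).integrableOn_Icc).mono_set Ioo_subset_Icc_self
    calc ∫ t in Ioo (0 : ℝ) 1, fderiv ℝ ξ (t, y) (1, 0) * D t y
        = ∫ t in Ioo (0 : ℝ) 1, (fderiv ℝ ξ (t, y) (1, 0) * D 0 y
            - fderiv ℝ ξ (t, y) (1, 0) * ∫ r in (0 : ℝ)..t, J' r y) := by
          refine setIntegral_congr_fun measurableSet_Ioo fun t ht => ?_
          have := hD y t (Ioo_subset_Icc_self ht)
          rw [← mul_sub]
          congr 1
          linarith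
      _ = _ := by rw [integral_sub hi1 hi2, hconst, h1]; ring
  have hswap := integral_swap_parts (ξ := fun t y => ξ (t, y))
    (ξ' := fun t y => fderiv ℝ ξ (t, y) (0, 1)) (J := J) (J' := J') (T := 1) (N := N) (C := C₁)
    (B := B) hdy hξ.continuous (fun t => hc2.comp (by fun_prop)) hsupp (fun t y => hC₁ _)
    hJ hJ' hJm hB hBT
  rw [hfirst]
  simp_rw [hinner]
  rw [setIntegral_eq_integral_of_forall_compl_eq_zero, hswap, neg_add_cancel]
  intro y hy
  simp [hJs _ y hy]

end

section

/-! ### Uniform integrability of the moments -/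

variable {μ : ℝ → Measure ℝ} {ν : ℝ → SignedMeasure ℝ} {p M : ℝ} {m : ℝ → ℝ}

lemma continuous_convMeasure (μ : Measure ℝ) [IsFiniteMeasure μ] {φ : ℝ → ℝ} (hφ : Continuous φ)
    {C : ℝ} (hC : ∀ x, |φ x| ≤ C) : Continuous (convMeasure φ μ) :=
  continuous_of_dominated (bound := fun _ => C)
    (fun y => (hφ.comp (by fun_prop : Continuous fun x => y - x)).aestronglyMeasurable)
    (fun y => ae_of_all _ fun x => hC _) (integrable_const _)
    (ae_of_all _ fun x => hφ.comp (by fun_prop))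

lemma IsIntegratedCE.measurable_convMeasure (h : IsIntegratedCE μ ν) {φ : ℝ → ℝ}
    (hφ : Continuous φ) {C : ℝ} (hC : ∀ x, |φ x| ≤ C) :
    Measurable fun z : ℝ × ℝ => convMeasure φ (μ z.1) z.2 := by
  have h1 : ∀ y, Measurable fun t => convMeasure φ (μ t) y := fun y =>
    h.measurable_integral (fun x => φ (y - x)) C (hφ.comp (by fun_prop)) fun x => hC _
  have h2 : ∀ t, Continuous fun y => convMeasure φ (μ t) y := fun t => by
    have := h.prob t
    exact continuous_convMeasure (μ t) hφ hC
  have h3 : Measurable (Function.uncurry fun y t => convMeasure φ (μ t) y) :=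
    measurable_uncurry_of_continuous_of_measurable h2 h1
  have h4 : (fun z : ℝ × ℝ => convMeasure φ (μ z.1) z.2)
      = (Function.uncurry fun y t => convMeasure φ (μ t) y) ∘ Prod.swap := by
    funext z; simp only [Function.comp_apply, Function.uncurry, Prod.swap]
  rw [h4]
  exact h3.comp measurable_swap

lemma convMeasure_mollifier_nonneg {ε : ℝ} (hε : 0 < ε) (μ : Measure ℝ) (y : ℝ) :
    0 ≤ convMeasure (mollifier ε) μ y :=
  integral_nonneg fun _ => mollifier_nonneg hε _

lemma lintegral_mollifier_sub {ε : ℝ} (hε : 0 < ε) (x : ℝ) :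
    ∫⁻ y, ENNReal.ofReal (mollifier ε (y - x)) = 1 := by
  rw [← ofReal_integral_eq_lintegral_ofReal ((integrable_mollifier hε).comp_sub_right x)
      (ae_of_all _ fun y => mollifier_nonneg hε _),
    integral_sub_right_eq_self (mollifier ε) x, integral_mollifier hε]
  simp

lemma ofReal_convMeasure_mollifier {ε : ℝ} (hε : 0 < ε) (μ : Measure ℝ) [IsFiniteMeasure μ] (y : ℝ) :
    ENNReal.ofReal (convMeasure (mollifier ε) μ y)
      = ∫⁻ x, ENNReal.ofReal (mollifier ε (y - x)) ∂μ := by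
  obtain ⟨C, _, hC, _⟩ := exists_mollifier_bound hε
  exact ofReal_integral_eq_lintegral_ofReal
    (integrable_of_bound ((continuous_mollifier ε).measurable.comp (by fun_prop)) fun x => hC _)
    (ae_of_all _ fun x => mollifier_nonneg hε _)

lemma measurable_mollifier_sub (ε : ℝ) :
    Measurable fun z : ℝ × ℝ => ENNReal.ofReal (mollifier ε (z.2 - z.1)) :=
  ((continuous_mollifier ε).measurable.comp (by fun_prop)).ennreal_ofReal

lemma lintegral_mul_convMeasure {ε : ℝ} (hε : 0 < ε) (μ : Measure ℝ) [IsFiniteMeasure μ]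
    {f : ℝ → ℝ≥0∞} (hf : Measurable f) :
    ∫⁻ y, f y * ENNReal.ofReal (convMeasure (mollifier ε) μ y)
      = ∫⁻ x, (∫⁻ y, f y * ENNReal.ofReal (mollifier ε (y - x))) ∂μ := by
  rw [lintegral_lintegral_swap]
  · refine lintegral_congr fun y => ?_
    rw [ofReal_convMeasure_mollifier hε, lintegral_const_mul]
    exact ((continuous_mollifier ε).measurable.comp (by fun_prop)).ennreal_ofReal
  · exact ((hf.comp measurable_snd).mul (measurable_mollifier_sub ε)).aemeasurable

/-- Continuity from above of the finite measure f μ along sets decreasing to ∅. -/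
lemma exists_forall_setLIntegral_tail_le (μ : Measure ℝ) {f : ℝ → ℝ≥0∞}
    (hfi : ∫⁻ x, f x ∂μ ≠ ⊤) {θ : ℝ≥0∞} (hθ : 0 < θ) :
    ∃ R₀ : ℝ, 1 ≤ R₀ ∧ ∀ R, R₀ ≤ R → ∫⁻ x in {x | R ≤ |x|}, f x ∂μ ≤ θ := by
  have hS : ∀ R : ℝ, MeasurableSet {x : ℝ | R ≤ |x|} := fun R =>
    measurableSet_le measurable_const (by fun_prop)
  have hlim := tendsto_measure_iInter_atTop (μ := μ.withDensity f)
    (s := fun n : ℕ => {x : ℝ | (n : ℝ) ≤ |x|}) (fun n => (hS n).nullMeasurableSet)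
    (fun a b hab x hx => by
      have hx' : (b : ℝ) ≤ |x| := hx
      have : (a : ℝ) ≤ b := by exact_mod_cast hab
      exact this.trans hx')
    ⟨0, by
      rw [withDensity_apply _ (hS _)]
      exact ((setLIntegral_le_lintegral _ _).trans_lt hfi.lt_top).ne⟩
  have hempty : ⋂ n : ℕ, {x : ℝ | (n : ℝ) ≤ |x|} = ∅ := by
    ext x
    simp only [mem_iInter, mem_ofPred_eq, mem_empty_iff_false, iff_false, not_forall, not_le]
    exact exists_nat_gt |x|
  rw [hempty, measure_empty] at hlim
  obtain ⟨n, hn1, hn⟩ := ((eventually_ge_atTop 1).and (hlim.eventually_lt_const hθ)).exists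
  refine ⟨n, by exact_mod_cast hn1, fun R hR => ?_⟩
  rw [Function.comp_apply, withDensity_apply _ (hS _)] at hn
  exact (lintegral_mono_set fun x (hx : R ≤ |x|) => hR.trans hx).trans hn.le

lemma exists_young_bound (hp : 1 < p) {c θ : ℝ} (hc : 0 < c) (hθ : 0 < θ) :
    ∃ C : ℝ, 0 < C ∧ ∀ x y : ℝ≥0∞, ENNReal.ofReal c * (x ^ (1 / p) * y ^ (1 - 1 / p))
      ≤ ENNReal.ofReal C * x + ENNReal.ofReal θ * y := by
  have hp0 : 0 < p := by linarith
  have hr : 1 / p ≤ 1 := by rw [div_le_one hp0]; exact hp.le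
  have hq : 0 ≤ 1 - 1 / p := by linarith
  -- C is determined by C^(1/p) θ^(1-1/p) = c.
  refine ⟨(c * θ ^ (-(1 - 1 / p))) ^ p, by positivity, fun x y => ?_⟩
  refine le_trans (le_of_eq ?_) (rpow_mul_rpow_le_add (r := 1 / p) (by positivity) hr _ _)
  rw [ENNReal.mul_rpow_of_nonneg _ _ (by positivity : 0 ≤ 1 / p), ENNReal.mul_rpow_of_nonneg _ _ hq,
    ENNReal.ofReal_rpow_of_nonneg (by positivity) (by positivity),
    ENNReal.ofReal_rpow_of_nonneg hθ.le hq, ← Real.rpow_mul (by positivity),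
    mul_one_div_cancel hp0.ne', Real.rpow_one]
  have : ENNReal.ofReal c = ENNReal.ofReal (c * θ ^ (-(1 - 1 / p)))
      * ENNReal.ofReal (θ ^ (1 - 1 / p)) := by
    rw [← ENNReal.ofReal_mul (by positivity), mul_assoc, ← Real.rpow_add hθ]
    simp
  rw [this]
  ring

/-- A smooth compactly supported function comparable with `|y|` for `2R ≤ |y| ≤ N`. -/
def tailWeight (R N y : ℝ) : ℝ := √(1 + y ^ 2) * ((1 - cutoff R y) * cutoff N y)

lemma tailWeight_nonneg (R N y : ℝ) : 0 ≤ tailWeight R N y :=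
  mul_nonneg (Real.sqrt_nonneg _)
    (mul_nonneg (sub_nonneg.2 (cutoff_le_one _ _)) (cutoff_nonneg _ _))

lemma sqrt_one_add_sq_le (y : ℝ) : √(1 + y ^ 2) ≤ 1 + |y| := by
  rw [Real.sqrt_le_left (by positivity)]
  nlinarith [sq_abs y, abs_nonneg y]

lemma tailWeight_le (R N y : ℝ) : tailWeight R N y ≤ 1 + |y| := by
  refine le_trans (mul_le_of_le_one_right (Real.sqrt_nonneg _) ?_) (sqrt_one_add_sq_le y)
  exact mul_le_one₀ (by linarith [cutoff_nonneg R y]) (cutoff_nonneg _ _) (cutoff_le_one _ _)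

lemma tailWeight_eq_zero_of_le {R N y : ℝ} (hR : 0 < R) (hy : |y| ≤ R) : tailWeight R N y = 0 := by
  simp [tailWeight, cutoff_eq_one hR hy]

lemma tailWeight_eq_zero_of_ge {R N y : ℝ} (hN : 0 < N) (hy : 2 * N ≤ |y|) :
    tailWeight R N y = 0 := by
  simp [tailWeight, cutoff_eq_zero hN hy]

lemma abs_le_tailWeight {R N y : ℝ} (hR : 0 < R) (hN : 0 < N) (h1 : 2 * R ≤ |y|) (h2 : |y| ≤ N) :
    |y| ≤ tailWeight R N y := by
  rw [tailWeight, cutoff_eq_zero hR h1, cutoff_eq_one hN h2]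
  simp only [sub_zero, mul_one]
  exact Real.abs_le_sqrt (by linarith)

lemma contDiff_tailWeight (R N : ℝ) : ContDiff ℝ 1 (tailWeight R N) := by
  have h1 : ContDiff ℝ 1 fun y : ℝ => √(1 + y ^ 2) :=
    ContDiff.sqrt (by fun_prop) fun y => by positivity
  exact h1.mul ((contDiff_const.sub (contDiff_cutoff R)).mul (contDiff_cutoff N))

/-- The weight grows linearly, but a cutoff of scale R varies only where |y| ≤ 2R, with slope at
most D/R. The product is bounded independently of R, and likewise for N. -/
lemma exists_deriv_tailWeight_bound : ∃ C : ℝ, 0 < C ∧ ∀ R N y : ℝ, 1 ≤ R → 1 ≤ N →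
    |deriv (tailWeight R N) y| ≤ C := by
  obtain ⟨D, hD0, hD⟩ := exists_deriv_cutoff_bound
  have key : ∀ R y : ℝ, 1 ≤ R → √(1 + y ^ 2) * |deriv (cutoff R) y| ≤ 3 * D := by
    intro R y hR
    have hR0 : 0 < R := by linarith
    rcases lt_or_ge |y| (2 * R) with hy | hy
    · calc √(1 + y ^ 2) * |deriv (cutoff R) y| ≤ (1 + |y|) * (D / R) := by
            gcongr
            · exact sqrt_one_add_sq_le y
            · exact hD R y hR0
        _ ≤ (3 * R) * (D / R) := by gcongr; linarith
        _ = 3 * D := by field_simp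
    · rw [deriv_cutoff_eq_zero_of_ge hR0 hy]; simp; positivity
  -- 1 comes from the square root and 3D from each of the two cutoffs.
  refine ⟨1 + 6 * D, by positivity, fun R N y hR hN => ?_⟩
  have hs : HasDerivAt (fun y : ℝ => √(1 + y ^ 2)) (y / √(1 + y ^ 2)) y := by
    have h0 : HasDerivAt (fun y : ℝ => 1 + y ^ 2) (2 * y) y := by
      simpa using (hasDerivAt_pow 2 y).const_add 1
    convert h0.sqrt (by positivity) using 1
    field_simp
  have hd : HasDerivAt (tailWeight R N) _ y :=
    hs.mul (((hasDerivAt_cutoff R y).const_sub 1).mul (hasDerivAt_cutoff N y))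
  rw [hd.deriv]
  set a := √(1 + y ^ 2) with ha
  have ha0 : 0 < a := by positivity
  have hya : |y / a| ≤ 1 := by
    rw [abs_div, abs_of_pos ha0, div_le_one ha0]
    exact Real.abs_le_sqrt (by linarith)
  have hu0 : 0 ≤ 1 - cutoff R y := by linarith [cutoff_le_one R y]
  have hu1 : 1 - cutoff R y ≤ 1 := by linarith [cutoff_nonneg R y]
  have hv0 := cutoff_nonneg N y
  have hv1 := cutoff_le_one N y
  have e1 : |y / a * ((1 - cutoff R y) * cutoff N y)| ≤ 1 := by
    rw [abs_mul]
    refine mul_le_one₀ hya (abs_nonneg _) ?_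
    rw [abs_of_nonneg (mul_nonneg hu0 hv0)]
    exact mul_le_one₀ hu1 hv0 hv1
  have e2 : |a * (-deriv (cutoff R) y * cutoff N y)| ≤ 3 * D := by
    rw [abs_mul, abs_mul, abs_neg, abs_of_pos ha0, abs_of_nonneg hv0, ← mul_assoc]
    exact (mul_le_of_le_one_right (by positivity) hv1).trans (key R y hR)
  have e3 : |a * ((1 - cutoff R y) * deriv (cutoff N) y)| ≤ 3 * D := by
    rw [abs_mul, abs_mul, abs_of_pos ha0, abs_of_nonneg hu0, mul_left_comm]
    exact (mul_le_of_le_one_left (by positivity) hu1).trans (key N y hN)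
  rw [mul_add]
  calc _ ≤ |y / a * ((1 - cutoff R y) * cutoff N y)| + (|a * (-deriv (cutoff R) y * cutoff N y)|
        + |a * ((1 - cutoff R y) * deriv (cutoff N) y)|) :=
        (abs_add_le _ _).trans (by gcongr; exact abs_add_le _ _)
    _ ≤ 1 + 6 * D := by linarith

/-- The pointwise equation for ρ_ε is multiplied by ψ and integrated by parts in y. The flux then
appears as the function j_ε, to which pointwise action bounds apply. -/
lemma IsIntegratedCE.integral_mul_conv_sub_eq (h : IsIntegratedCE μ ν) {ε : ℝ} (hε : 0 < ε)
    {ψ ψ' : ℝ → ℝ} (hψ : ∀ y, HasDerivAt ψ (ψ' y) y) (hψ' : Continuous ψ') {N : ℝ}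
    (hs : ∀ y, y ∉ Icc (-N) N → ψ y = 0) {t : ℝ} (ht : t ∈ Icc (0 : ℝ) 1) :
    (∫ y, ψ y * convMeasure (mollifier ε) (μ t) y)
        - (∫ y, ψ y * convMeasure (mollifier ε) (μ 0) y)
      = ∫ r in Ioo 0 t, ∫ y, ψ' y * convSigned (mollifier ε) (ν r) y := by
  obtain ⟨C, hC0, hC, hC'⟩ := exists_mollifier_bound hε
  have hcψ : Continuous ψ := continuous_iff_continuousAt.2 fun y => (hψ y).continuousAt
  have hcs : HasCompactSupport ψ := HasCompactSupport.intro isCompact_Icc hs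
  obtain ⟨K, hK⟩ := hcψ.bounded_above_of_compact_support hcs
  have hcd := (hasCompactSupport_mollifier hε).deriv
  have hi : ∀ t, Integrable fun y => ψ y * convMeasure (mollifier ε) (μ t) y := fun t => by
    have := h.prob t
    exact (hcψ.mul (continuous_convMeasure _ (continuous_mollifier ε) hC)).integrable_of_hasCompactSupport
      hcs.mul_right
  have hsw := integral_swap_parts (ξ := fun _ => ψ) (ξ' := fun _ => ψ')
    (J := fun r => convSigned (mollifier ε) (ν r))
    (J' := fun r => convSigned (deriv (mollifier ε)) (ν r)) (T := t) (N := N) (C := K)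
    (B := fun r => ENNReal.ofReal C * (ν r).totalVariation univ) (fun _ => hψ) (by fun_prop)
    (fun _ => hψ') (fun _ => hs) (fun _ => hK)
    (fun r => hasDerivAt_convSigned _ (hasDerivAt_mollifier ε)
      (continuous_deriv_mollifier ε).measurable hC hC')
    (fun r => (contDiff_convSigned (ν r) (n := 0)
      (contDiff_zero.2 (continuous_deriv_mollifier ε)) hcd).continuous)
    (measurable_convSigned_uncurry h.measurable (continuous_deriv_mollifier ε) hcd)
    (fun r y => enorm_convSigned_le (ν r) hC' y)
    (by
      rw [lintegral_const_mul' _ _ ENNReal.ofReal_ne_top]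
      exact ENNReal.mul_lt_top ENNReal.ofReal_lt_top
        ((lintegral_mono_set (Ioo_subset_Ioo_right ht.2)).trans_lt h.mass_lt_top))
  rw [← integral_sub (hi t) (hi 0), eq_comm, ← neg_eq_iff_eq_neg.2 hsw, ← integral_neg]
  congr 1
  funext y
  rw [← mul_sub, h.conv_sub_eq (hasDerivAt_mollifier ε) (continuous_deriv_mollifier ε) hcd hC y ht,
    intervalIntegral.integral_of_le ht.1, integral_Ioc_eq_integral_Ioo, integral_const_mul, mul_neg]

lemma IsIntegratedCE.measurable_actionDensity_conv (h : IsIntegratedCE μ ν) (hM : 0 ≤ M)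
    (hm : IsMobility M m) {ε : ℝ} (hε : 0 < ε) :
    Measurable fun z : ℝ × ℝ => actionDensity p M m (convMeasure (mollifier ε) (μ z.1) z.2)
      (convSigned (mollifier ε) (ν z.1) z.2) := by
  obtain ⟨C, _, hC, _⟩ := exists_mollifier_bound hε
  exact (measurable_actionDensity hm hM).comp
    ((h.measurable_convMeasure (continuous_mollifier ε) hC).prodMk
      (measurable_convSigned_uncurry h.measurable (continuous_mollifier ε)
        (hasCompactSupport_mollifier hε)))

end

/-! ### Propagation of moment tails in time -/

section

variable {μ : ℝ → Measure ℝ} {ν : ℝ → SignedMeasure ℝ} {p M : ℝ} {m : ℝ → ℝ}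

/-- The absorption step; finiteness of s is essential. -/
lemma le_two_mul_of_le_add_half {x s : ℝ≥0∞} (hs : s ≠ ⊤) (h : s ≤ x + s / 2) : s ≤ 2 * x := by
  have h1 : s / 2 + s / 2 ≤ x + s / 2 := by rwa [ENNReal.add_halves]
  have h2 : s / 2 ≤ x :=
    (ENNReal.add_le_add_iff_right (ENNReal.div_ne_top hs (by norm_num))).1 h1
  calc s = 2 * (s / 2) := (ENNReal.mul_div_cancel (by norm_num) (by norm_num)).symm
    _ ≤ 2 * x := by gcongr

/-- A weighted bound of the flux by the action and the density. -/
lemma exists_weighted_flux_bound (hp : 1 < p) {Θ : ℝ} (hΘ0 : 0 < Θ)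
    (hΘ : ∀ ρ ∈ Icc 0 M, m ρ ≤ Θ * ρ) {c : ℝ} (hc : 0 < c) :
    ∃ C : ℝ, 0 < C ∧ ∀ ρ j g : ℝ, 0 ≤ g →
      ENNReal.ofReal (c * g ^ (p - 1)) * ‖j‖ₑ
        ≤ ENNReal.ofReal C * actionDensity p M m ρ j
          + ENNReal.ofReal (1 / 2) * (ENNReal.ofReal (g ^ p) * ENNReal.ofReal ρ) := by
  have hp0 : 0 < p := by linarith
  have hq : 0 ≤ 1 - 1 / p := by rw [sub_nonneg, div_le_one hp0]; exact hp.le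
  -- The factor 1/(2Θ) cancels the Θ of m(ρ) ≤ Θ ρ and leaves 1/2 in front of the moment term, which
  -- can then be absorbed.
  obtain ⟨C, hC0, hC⟩ := exists_young_bound hp hc (show 0 < 1 / (2 * Θ) by positivity)
  refine ⟨C, hC0, fun ρ j g hg => ?_⟩
  rcases eq_or_ne (actionDensity p M m ρ j) ⊤ with h | h
  · rw [h, ENNReal.mul_top (by simpa using hC0)]; simp
  have hρ := mem_Icc_of_actionDensity_ne_top h
  have hg1 : ENNReal.ofReal (g ^ (p - 1)) = ENNReal.ofReal (g ^ p) ^ (1 - 1 / p) := by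
    rw [ENNReal.ofReal_rpow_of_nonneg (by positivity) hq, ← Real.rpow_mul hg]
    congr 2
    field_simp
  calc ENNReal.ofReal (c * g ^ (p - 1)) * ‖j‖ₑ
      ≤ ENNReal.ofReal (c * g ^ (p - 1)) * (actionDensity p M m ρ j ^ (1 / p)
          * ENNReal.ofReal (Θ * ρ) ^ (1 - 1 / p)) := by
        gcongr
        refine (enorm_le_of_actionDensity_ne_top hp h).trans ?_
        gcongr
        exact hΘ _ hρ
    _ = ENNReal.ofReal c * (actionDensity p M m ρ j ^ (1 / p)
          * (ENNReal.ofReal (g ^ p) * ENNReal.ofReal (Θ * ρ)) ^ (1 - 1 / p)) := by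
        rw [ENNReal.mul_rpow_of_nonneg _ _ hq, ENNReal.ofReal_mul hc.le, hg1]
        ring
    _ ≤ _ := hC _ _
    _ = _ := by
        congr 1
        rw [ENNReal.ofReal_mul hΘ0.le,
          show 1 / (2 * Θ) = 1 / 2 * Θ⁻¹ by field_simp, ENNReal.ofReal_mul (by norm_num)]
        have : ENNReal.ofReal Θ⁻¹ * ENNReal.ofReal Θ = 1 := by
          rw [← ENNReal.ofReal_mul (by positivity), inv_mul_cancel₀ hΘ0.ne', ENNReal.ofReal_one]
        calc _ = ENNReal.ofReal (1 / 2) * (ENNReal.ofReal (g ^ p) * ENNReal.ofReal ρ)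
              * (ENNReal.ofReal Θ⁻¹ * ENNReal.ofReal Θ) := by ring
          _ = _ := by rw [this, mul_one]

/-- The weighted mass of the mollified curve is controlled by its initial value and by the action
away from the origin. -/
lemma IsIntegratedCE.lintegral_tailWeight_le (h : IsIntegratedCE μ ν) (hp : 1 < p) (hM : 0 ≤ M)
    (hm : IsMobility M m) {C c : ℝ}
    (hc : ∀ R N y : ℝ, 1 ≤ R → 1 ≤ N → |deriv (tailWeight R N) y| ≤ c)
    (hC : ∀ ρ j g : ℝ, 0 ≤ g →
      ENNReal.ofReal (p * c * g ^ (p - 1)) * ‖j‖ₑ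
        ≤ ENNReal.ofReal C * actionDensity p M m ρ j
          + ENNReal.ofReal (1 / 2) * (ENNReal.ofReal (g ^ p) * ENNReal.ofReal ρ))
    {R N : ℝ} (hR : 1 ≤ R) (hN : 1 ≤ N) {t : ℝ} (ht : t ∈ Icc (0 : ℝ) 1) :
    ∫⁻ y, ENNReal.ofReal (tailWeight R N y ^ p)
        * ENNReal.ofReal (convMeasure (mollifier 1) (μ t) y)
      ≤ 2 * ((∫⁻ y, ENNReal.ofReal (tailWeight R N y ^ p)
            * ENNReal.ofReal (convMeasure (mollifier 1) (μ 0) y))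
          + ENNReal.ofReal C * ∫⁻ y in {y | R ≤ |y|}, ∫⁻ r in Ioo (0 : ℝ) 1,
            actionDensity p M m (convMeasure (mollifier 1) (μ r) y)
              (convSigned (mollifier 1) (ν r) y)) := by
  have hp0 : 0 < p := by linarith
  set g := tailWeight R N with hg
  have hg0 : ∀ y, 0 ≤ g y := tailWeight_nonneg R N
  have hgd : ∀ y, HasDerivAt g (deriv g y) y := fun y =>
    ((contDiff_tailWeight R N).differentiable (by simp) y).hasDerivAt
  have hgc : Continuous g := (contDiff_tailWeight R N).continuous
  have hgdc : Continuous (deriv g) := (contDiff_tailWeight R N).continuous_deriv le_rfl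
  set ψ : ℝ → ℝ := fun y => g y ^ p with hψ
  set ψ' : ℝ → ℝ := fun y => deriv g y * p * g y ^ (p - 1) with hψ'
  have hψd : ∀ y, HasDerivAt ψ (ψ' y) y := fun y => (hgd y).rpow_const (Or.inr hp.le)
  have hψc : Continuous ψ := hgc.rpow_const fun y => Or.inr hp0.le
  have hψ'c : Continuous ψ' :=
    (hgdc.mul continuous_const).mul (hgc.rpow_const fun y => Or.inr (by linarith))
  have hψ0 : ∀ y, 0 ≤ ψ y := fun y => Real.rpow_nonneg (hg0 y) _
  have hsupp : ∀ y, y ∉ Icc (-(2 * N)) (2 * N) → ψ y = 0 := by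
    intro y hy
    have : 2 * N ≤ |y| := by
      by_contra! h1; exact hy ⟨(abs_lt.1 h1).1.le, (abs_lt.1 h1).2.le⟩
    simp [hψ, hg, tailWeight_eq_zero_of_ge (by linarith) this, Real.zero_rpow hp0.ne']
  have hψcs : HasCompactSupport ψ := HasCompactSupport.intro isCompact_Icc hsupp
  obtain ⟨C₁, _, hC₁, _⟩ := exists_mollifier_bound one_pos
  set ρ : ℝ → ℝ → ℝ := fun t => convMeasure (mollifier 1) (μ t) with hρ
  set j : ℝ → ℝ → ℝ := fun t => convSigned (mollifier 1) (ν t) with hj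
  have hρ0 : ∀ t y, 0 ≤ ρ t y := fun t y => convMeasure_mollifier_nonneg one_pos _ _
  have hρc : ∀ t, Continuous (ρ t) := fun t => by
    have := h.prob t
    exact continuous_convMeasure _ (continuous_mollifier 1) hC₁
  set S : ℝ → ℝ≥0∞ := fun t => ∫⁻ y, ENNReal.ofReal (ψ y) * ENNReal.ofReal (ρ t y) with hS
  have hi : ∀ t, Integrable fun y => ψ y * ρ t y := fun t =>
    (hψc.mul (hρc t)).integrable_of_hasCompactSupport hψcs.mul_right
  have hSG : ∀ t, S t = ENNReal.ofReal (∫ y, ψ y * ρ t y) := fun t => by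
    rw [ofReal_integral_eq_lintegral_ofReal (hi t)
      (ae_of_all _ fun y => mul_nonneg (hψ0 y) (hρ0 t y))]
    exact lintegral_congr fun y => (ENNReal.ofReal_mul (hψ0 y)).symm
  have hAm := h.measurable_actionDensity_conv (p := p) hM hm one_pos
  -- The weight, hence ψ', vanishes for |y| ≤ R, so only the action far from the origin contributes.
  have hflux : ∀ r y, ‖ψ' y * j r y‖ₑ
      ≤ ENNReal.ofReal C * {y : ℝ | R ≤ |y|}.indicator
          (fun y => actionDensity p M m (ρ r y) (j r y)) y
        + ENNReal.ofReal (1 / 2) * (ENNReal.ofReal (ψ y) * ENNReal.ofReal (ρ r y)) := by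
    intro r y
    by_cases hy : R ≤ |y|
    · rw [indicator_of_mem (show y ∈ {y : ℝ | R ≤ |y|} from hy)]
      refine le_trans ?_ (hC (ρ r y) (j r y) (g y) (hg0 y))
      rw [enorm_mul]
      gcongr
      rw [← ofReal_norm]
      apply ENNReal.ofReal_le_ofReal
      rw [hψ', Real.norm_eq_abs, abs_mul, abs_mul, abs_of_pos hp0,
        abs_of_nonneg (Real.rpow_nonneg (hg0 y) _), mul_comm p c]
      gcongr
      · exact Real.rpow_nonneg (hg0 y) _
      · exact hc R N y hR hN
    · have : g y = 0 := tailWeight_eq_zero_of_le (by linarith) (not_le.1 hy).le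
      simp [hψ', this, Real.zero_rpow (show p - 1 ≠ 0 by linarith)]
  set A : ℝ≥0∞ := ∫⁻ y in {y | R ≤ |y|}, ∫⁻ r in Ioo (0 : ℝ) 1,
    actionDensity p M m (ρ r y) (j r y) with hA
  have hmeasS : MeasurableSet {y : ℝ | R ≤ |y|} := measurableSet_le measurable_const (by fun_prop)
  -- The time interval has length 1, so the moment terms of the flux bound add up to at most Smax /
  -- 2.
  set Smax : ℝ≥0∞ := ⨆ t ∈ Icc (0 : ℝ) 1, S t with hSmax
  have hinc : ∀ t ∈ Icc (0 : ℝ) 1, S t ≤ S 0 + ENNReal.ofReal C * A + Smax / 2 := by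
    intro t ht
    have heq := h.integral_mul_conv_sub_eq one_pos hψd hψ'c hsupp ht
    have hbound : ‖∫ r in Ioo 0 t, ∫ y, ψ' y * j r y‖ₑ ≤ ENNReal.ofReal C * A + Smax / 2 := by
      calc ‖∫ r in Ioo 0 t, ∫ y, ψ' y * j r y‖ₑ
          ≤ ∫⁻ r in Ioo 0 t, ‖∫ y, ψ' y * j r y‖ₑ := enorm_integral_le_lintegral_enorm _
        _ ≤ ∫⁻ r in Ioo (0 : ℝ) 1, ‖∫ y, ψ' y * j r y‖ₑ :=
            lintegral_mono_set (Ioo_subset_Ioo_right ht.2)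
        _ ≤ ∫⁻ r in Ioo (0 : ℝ) 1, (ENNReal.ofReal C * (∫⁻ y in {y | R ≤ |y|},
              actionDensity p M m (ρ r y) (j r y)) + Smax / 2) := by
            refine setLIntegral_mono' measurableSet_Ioo fun r hr => ?_
            refine (enorm_integral_le_lintegral_enorm _).trans
              ((lintegral_mono fun y => hflux r y).trans ?_)
            have hmr : Measurable fun y => actionDensity p M m (ρ r y) (j r y) :=
              hAm.comp (measurable_const.prodMk measurable_id)
            have hmρ : Measurable fun y => ENNReal.ofReal (ψ y) * ENNReal.ofReal (ρ r y) :=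
              hψc.measurable.ennreal_ofReal.mul (hρc r).measurable.ennreal_ofReal
            rw [lintegral_add_right _ (hmρ.const_mul _),
              lintegral_const_mul _ (hmr.indicator hmeasS),
              lintegral_indicator hmeasS, lintegral_const_mul _ hmρ]
            gcongr
            rw [ENNReal.div_eq_inv_mul, one_div, ENNReal.ofReal_inv_of_pos two_pos,
              ENNReal.ofReal_ofNat]
            gcongr
            exact le_iSup₂_of_le r (Ioo_subset_Icc_self hr) le_rfl
        _ = ENNReal.ofReal C * A + Smax / 2 := by
            rw [lintegral_add_right _ measurable_const, lintegral_const_mul' _ _ ENNReal.ofReal_ne_top,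
              lintegral_lintegral_swap hAm.aemeasurable]
            simp
            rfl
    have h1 : ∫ y, ψ y * ρ t y = (∫ y, ψ y * ρ 0 y) + ∫ r in Ioo 0 t, ∫ y, ψ' y * j r y := by
      rw [← heq]; ring
    rw [hSG t, h1, hSG 0, add_assoc]
    refine ENNReal.ofReal_add_le.trans ?_
    gcongr
    refine le_trans ?_ hbound
    rw [← ofReal_norm]
    exact ENNReal.ofReal_le_ofReal (le_abs_self _)
  -- The truncation at N serves this purpose only: the bound K may depend on N, but it permits the
  -- absorption, after which N no longer enters the constants.
  have hfin : Smax ≠ ⊤ := by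
    obtain ⟨K, hK⟩ := hψc.bounded_above_of_compact_support hψcs
    refine ((iSup₂_le fun t ht => ?_ : Smax ≤ ENNReal.ofReal K).trans_lt ENNReal.ofReal_lt_top).ne
    have := h.prob t
    calc S t ≤ ∫⁻ y, ENNReal.ofReal K * ENNReal.ofReal (ρ t y) := by
          refine lintegral_mono fun y => ?_
          gcongr
          exact (le_abs_self _).trans (hK y)
      _ = ENNReal.ofReal K := by
          rw [lintegral_mul_convMeasure one_pos (μ t) measurable_const]
          have : ∀ x, ∫⁻ y, ENNReal.ofReal K * ENNReal.ofReal (mollifier 1 (y - x))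
              = ENNReal.ofReal K := fun x => by
            rw [lintegral_const_mul' _ _ ENNReal.ofReal_ne_top, lintegral_mollifier_sub one_pos,
              mul_one]
          simp [this]
  have hle : Smax ≤ (S 0 + ENNReal.ofReal C * A) + Smax / 2 := iSup₂_le hinc
  exact (le_iSup₂_of_le t ht le_rfl).trans (le_two_mul_of_le_add_half hfin hle)

/-- The `p`-th moments of a curve of finite action are uniformly integrable. -/
lemma IsIntegratedCE.exists_tail_bound (h : IsIntegratedCE μ ν) (hp : 1 < p) (hM : 0 ≤ M)
    (hm : IsMobility M m) {Θ : ℝ} (hΘ : ∀ ρ ∈ Icc 0 M, m ρ ≤ Θ * ρ)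
    (hA : ∫⁻ t in Ioo (0 : ℝ) 1, ∫⁻ y, actionDensity p M m (convMeasure (mollifier 1) (μ t) y)
      (convSigned (mollifier 1) (ν t) y) < ⊤)
    (h0 : ∫⁻ x, ENNReal.ofReal (|x| ^ p) ∂μ 0 < ⊤) {θ : ℝ≥0∞} (hθ : 0 < θ) :
    ∃ R₀ : ℝ, 1 ≤ R₀ ∧ ∀ t ∈ Icc (0 : ℝ) 1,
      ∫⁻ x in {x | R₀ ≤ |x|}, ENNReal.ofReal (|x| ^ p) ∂μ t ≤ θ := by
  have hp0 : 0 < p := by linarith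
  obtain ⟨c, hc0, hc⟩ := exists_deriv_tailWeight_bound
  obtain ⟨C, hC0, hC⟩ := exists_weighted_flux_bound (p := p) (M := M) (m := m) hp
    (show 0 < max Θ 1 by positivity)
    (fun ρ hρ => (hΘ ρ hρ).trans (by gcongr; exacts [hρ.1, le_max_left _ _]))
    (show 0 < p * c by positivity)
  have hAm := h.measurable_actionDensity_conv (p := p) hM hm one_pos
  rw [lintegral_lintegral_swap hAm.aemeasurable] at hA
  -- The final factors of the initial tail and of the action tail. With thresholds θ / 2 / (a + 1)
  -- each contributes at most θ / 2; adding 1 keeps the denominators nonzero.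
  set a₁ : ℝ≥0∞ := ENNReal.ofReal (2 ^ p) * (2 * ENNReal.ofReal (3 ^ p)) with ha₁
  set a₂ : ℝ≥0∞ := ENNReal.ofReal (2 ^ p) * (2 * ENNReal.ofReal C) with ha₂
  have ha₁t : a₁ ≠ ⊤ := by simp [ha₁, ENNReal.mul_eq_top]
  have ha₂t : a₂ ≠ ⊤ := by simp [ha₂, ENNReal.mul_eq_top]
  obtain ⟨R₁, hR₁, hR₁'⟩ := exists_forall_setLIntegral_tail_le (μ 0) h0.ne
    (θ := θ / 2 / (a₁ + 1)) (ENNReal.div_pos (ENNReal.half_pos hθ.ne').ne' (by simp [ha₁t]))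
  obtain ⟨R₂, hR₂, hR₂'⟩ := exists_forall_setLIntegral_tail_le volume hA.ne
    (θ := θ / 2 / (a₂ + 1)) (ENNReal.div_pos (ENNReal.half_pos hθ.ne').ne' (by simp [ha₂t]))
  -- The shift by 1 accounts for the unit mollification radius: a point y with |y| > R only sees x
  -- with |x| ≥ R - 1 ≥ R₁.
  set R := max (R₁ + 1) R₂ with hR
  have hR2 : 2 ≤ R := le_trans (by linarith) (le_max_left _ _)
  have hRpos : 0 < R := by linarith
  refine ⟨2 * R + 1, by linarith, fun t ht => ?_⟩
  have hprob := h.prob t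
  have hprob0 := h.prob 0
  have hmS : ∀ R : ℝ, MeasurableSet {x : ℝ | R ≤ |x|} := fun R =>
    measurableSet_le measurable_const (by fun_prop)
  have hmS2 : ∀ N : ℝ, MeasurableSet {x : ℝ | 2 * R + 1 ≤ |x| ∧ |x| ≤ N - 1} := fun N =>
    (hmS _).inter (measurableSet_le (by fun_prop : Measurable fun x : ℝ => |x|) measurable_const)
  have hmw : ∀ N, Measurable fun y => ENNReal.ofReal (tailWeight R N y ^ p) := fun N =>
    ((contDiff_tailWeight R N).continuous.measurable.pow_const p).ennreal_ofReal
  have hmp : Measurable fun x : ℝ => ENNReal.ofReal (|x| ^ p) := by fun_prop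
  -- Where the weight and the kernel are nonzero, the weight is at most 1 + |y| ≤ 2 + |x| ≤ 3 |x|,
  -- as |x| ≥ R - 1 ≥ 1.
  have hinit : ∀ N, ∫⁻ y, ENNReal.ofReal (tailWeight R N y ^ p)
      * ENNReal.ofReal (convMeasure (mollifier 1) (μ 0) y)
      ≤ ENNReal.ofReal (3 ^ p) * ∫⁻ x in {x | R - 1 ≤ |x|}, ENNReal.ofReal (|x| ^ p) ∂μ 0 := by
    intro N
    rw [lintegral_mul_convMeasure one_pos _ (hmw N), ← lintegral_indicator (hmS _),
      ← lintegral_const_mul _ (hmp.indicator (hmS _))]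
    refine lintegral_mono fun x => ?_
    calc ∫⁻ y, ENNReal.ofReal (tailWeight R N y ^ p) * ENNReal.ofReal (mollifier 1 (y - x))
        ≤ ∫⁻ y, (ENNReal.ofReal (3 ^ p) * {x : ℝ | R - 1 ≤ |x|}.indicator
            (fun x => ENNReal.ofReal (|x| ^ p)) x) * ENNReal.ofReal (mollifier 1 (y - x)) := by
          refine lintegral_mono fun y => ?_
          rcases le_or_gt 1 |y - x| with hyx | hyx
          · simp [mollifier_eq_zero one_pos hyx]
          · gcongr
            have hxy : |y| ≤ |x| + 1 := by
              have := abs_sub_abs_le_abs_sub y x; linarith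
            rcases le_or_gt |y| R with hy | hy
            · simp [tailWeight_eq_zero_of_le hRpos hy, Real.zero_rpow hp0.ne']
            · have hx : R - 1 ≤ |x| := by linarith
              rw [indicator_of_mem (show x ∈ {x : ℝ | R - 1 ≤ |x|} from hx),
                ← ENNReal.ofReal_mul (by positivity), ← Real.mul_rpow (by norm_num) (abs_nonneg x)]
              apply ENNReal.ofReal_le_ofReal
              have := tailWeight_nonneg R N y
              gcongr
              have := tailWeight_le R N y
              linarith
      _ = _ := by
          have hk : Measurable fun y => ENNReal.ofReal (mollifier 1 (y - x)) :=
            ((continuous_mollifier 1).measurable.comp (by fun_prop)).ennreal_ofReal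
          rw [lintegral_const_mul _ hk, lintegral_mollifier_sub one_pos, mul_one]
  -- The margins of 1 in the set of x put y in 2R ≤ |y| ≤ N, where the weight dominates |y|; then
  -- |x| ≤ |y| + 1 ≤ 2 |y|.
  have hlow : ∀ N, 1 ≤ N → ∫⁻ x in {x | 2 * R + 1 ≤ |x| ∧ |x| ≤ N - 1}, ENNReal.ofReal (|x| ^ p) ∂μ t
      ≤ ENNReal.ofReal (2 ^ p) * ∫⁻ y, ENNReal.ofReal (tailWeight R N y ^ p)
      * ENNReal.ofReal (convMeasure (mollifier 1) (μ t) y) := by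
    intro N hN
    rw [lintegral_mul_convMeasure one_pos _ (hmw N),
      ← lintegral_const_mul' _ _ ENNReal.ofReal_ne_top,
      ← lintegral_indicator (hmS2 N)]
    refine lintegral_mono fun x => ?_
    by_cases hx : x ∈ {x : ℝ | 2 * R + 1 ≤ |x| ∧ |x| ≤ N - 1}
    swap
    · rw [indicator_of_notMem hx]
      exact bot_le
    rw [indicator_of_mem hx]
    calc ENNReal.ofReal (|x| ^ p)
        = ∫⁻ y, ENNReal.ofReal (|x| ^ p) * ENNReal.ofReal (mollifier 1 (y - x)) := by
          rw [lintegral_const_mul' _ _ ENNReal.ofReal_ne_top, lintegral_mollifier_sub one_pos,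
            mul_one]
      _ ≤ ∫⁻ y, ENNReal.ofReal (2 ^ p) * (ENNReal.ofReal (tailWeight R N y ^ p)
            * ENNReal.ofReal (mollifier 1 (y - x))) := by
          refine lintegral_mono fun y => ?_
          rcases le_or_gt 1 |y - x| with hyx | hyx
          · simp [mollifier_eq_zero one_pos hyx]
          · rw [← mul_assoc]
            gcongr
            have h1 : |y| ≤ |x| + 1 := by
              have := abs_sub_abs_le_abs_sub y x; linarith
            have h2 : |x| ≤ |y| + 1 := by
              have := abs_sub_abs_le_abs_sub x y; rw [abs_sub_comm x y] at this; linarith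
            have h3 := abs_le_tailWeight (R := R) (N := N) (y := y) hRpos (by linarith)
              (by linarith [hx.1]) (by linarith [hx.2])
            have h4 := tailWeight_nonneg R N y
            rw [← ENNReal.ofReal_mul (by positivity), ← Real.mul_rpow (by norm_num) h4]
            apply ENNReal.ofReal_le_ofReal
            gcongr
            have := hx.1
            linarith
      _ = _ := by rw [lintegral_const_mul' _ _ ENNReal.ofReal_ne_top]
  have hall : ∀ N, 1 ≤ N → ∫⁻ x in {x | 2 * R + 1 ≤ |x| ∧ |x| ≤ N - 1}, ENNReal.ofReal (|x| ^ p) ∂μ t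
      ≤ θ := by
    intro N hN
    refine (hlow N hN).trans ?_
    have h1 := h.lintegral_tailWeight_le hp hM hm hc hC (R := R) (N := N) (by linarith) hN ht
    have e1 := hR₁' (R - 1) (by linarith [le_max_left (R₁ + 1) R₂])
    have e2 := hR₂' R (le_max_right _ _)
    have small : ∀ a : ℝ≥0∞, a ≠ ⊤ → a * (θ / 2 / (a + 1)) ≤ θ / 2 := fun a ha => by
      calc a * (θ / 2 / (a + 1)) ≤ (a + 1) * (θ / 2 / (a + 1)) := by gcongr; exact le_self_add
        _ = θ / 2 := ENNReal.mul_div_cancel (by simp) (by simp [ha])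
    calc _ ≤ ENNReal.ofReal (2 ^ p) * (2 * (ENNReal.ofReal (3 ^ p) * (θ / 2 / (a₁ + 1))
            + ENNReal.ofReal C * (θ / 2 / (a₂ + 1)))) := by
          gcongr
          refine h1.trans ?_
          gcongr
          refine (hinit N).trans ?_
          gcongr
      _ = a₁ * (θ / 2 / (a₁ + 1)) + a₂ * (θ / 2 / (a₂ + 1)) := by
          generalize θ / 2 / (a₁ + 1) = u
          generalize θ / 2 / (a₂ + 1) = v
          rw [ha₁, ha₂]; ring
      _ ≤ θ / 2 + θ / 2 := add_le_add (small a₁ ha₁t) (small a₂ ha₂t)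
      _ = θ := ENNReal.add_halves θ
  -- The bound is uniform in N, so the sets may be exhausted by N → ∞.
  have hunion : {x : ℝ | 2 * R + 1 ≤ |x|} = ⋃ n : ℕ, {x : ℝ | 2 * R + 1 ≤ |x| ∧ |x| ≤ (n + 1 : ℝ) - 1} := by
    ext x
    simp only [mem_ofPred_eq, mem_iUnion, exists_and_left, add_sub_cancel_right]
    exact ⟨fun hx => ⟨hx, exists_nat_ge _⟩, fun hx => hx.1⟩
  have hmono : Monotone fun n : ℕ => {x : ℝ | 2 * R + 1 ≤ |x| ∧ |x| ≤ (n + 1 : ℝ) - 1} := by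
    intro a b hab x hx
    have : (a : ℝ) ≤ b := by exact_mod_cast hab
    exact ⟨hx.1, hx.2.trans (by linarith)⟩
  rw [← withDensity_apply _ (hmS _), hunion, hmono.measure_iUnion]
  refine iSup_le fun n => ?_
  rw [withDensity_apply _ (hmS2 _)]
  exact hall _ (by linarith [(Nat.cast_nonneg n : (0 : ℝ) ≤ n)])

end

section

/-! ### Couplings and the Wasserstein distance -/

lemma wasserstein_rpow_le {q : ℝ} (hq : 0 < q) {μ μ' : Measure ℝ} {π : Measure (ℝ × ℝ)}
    (h₁ : π.map Prod.fst = μ) (h₂ : π.map Prod.snd = μ') :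
    wasserstein q μ μ' ^ q ≤ ∫⁻ z, ENNReal.ofReal (|z.1 - z.2| ^ q) ∂π := by
  rw [wasserstein, ← ENNReal.rpow_mul, one_div_mul_cancel hq.ne', ENNReal.rpow_one]
  exact iInf₂_le π ⟨h₁, h₂⟩

/-- A coupling built from a subcoupling with density `g` with respect to `μ ⊗ dx` and the product
of the remaining parts of the two marginals. -/
lemma lintegral_coupling_le {μ μ' b' : Measure ℝ} [IsProbabilityMeasure μ]
    [IsProbabilityMeasure μ'] {g : ℝ × ℝ → ℝ≥0∞} (hg : Measurable g)
    (ha : ∀ x, ∫⁻ z, g (x, z) ≤ 1)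
    (hμ' : μ' = volume.withDensity (fun z => ∫⁻ x, g (x, z) ∂μ) + b')
    {f : ℝ × ℝ → ℝ≥0∞} (hf : Measurable f) {F : ℝ → ℝ≥0∞}
    (hF : ∀ x, ∀ᵐ z ∂b', f (x, z) ≤ F x) :
    ∃ π : Measure (ℝ × ℝ), π.map Prod.fst = μ ∧ π.map Prod.snd = μ' ∧
      ∫⁻ z, f z ∂π ≤ (∫⁻ x, ∫⁻ z, g (x, z) * f (x, z) ∂volume ∂μ)
        + ∫⁻ x, (1 - ∫⁻ z, g (x, z)) * F x ∂μ := by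
  set a : ℝ → ℝ≥0∞ := fun x => ∫⁻ z, g (x, z) with hadef
  have ham : Measurable a := hg.lintegral_prod_right'
  -- The part of μ left over by the subcoupling. It has the same mass as b', so their product,
  -- divided by this mass, completes the coupling.
  obtain ⟨b, hb⟩ : ∃ b : Measure ℝ, b = μ.withDensity (1 - a) := ⟨_, rfl⟩
  have hbm : Measurable (1 - a) := measurable_const.sub ham
  have hab : μ = μ.withDensity a + b := by
    rw [hb, ← withDensity_add_left ham, add_tsub_cancel_of_le (fun x => ha x), withDensity_one]
  have hbf : IsFiniteMeasure b := ⟨by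
    have : b univ ≤ μ univ := by rw [hab]; simp
    exact this.trans_lt (measure_lt_top _ _)⟩
  have hb'f : IsFiniteMeasure b' := ⟨by
    have : b' univ ≤ μ' univ := by rw [hμ']; simp
    exact this.trans_lt (measure_lt_top _ _)⟩
  set A : ℝ≥0∞ := ∫⁻ x, a x ∂μ with hA
  have e1 : A + b univ = 1 := by
    have := congrArg (fun κ : Measure ℝ => κ univ) hab
    simp only [measure_univ, Measure.add_apply] at this
    rw [this, withDensity_apply _ MeasurableSet.univ, setLIntegral_univ]
  have e2 : A + b' univ = 1 := by
    have := congrArg (fun κ : Measure ℝ => κ univ) hμ'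
    simp only [measure_univ, Measure.add_apply] at this
    rw [this, withDensity_apply _ MeasurableSet.univ, setLIntegral_univ, hA, hadef,
      lintegral_lintegral_swap (f := fun z x => g (x, z)) (hg.comp measurable_swap).aemeasurable]
  have hAt : A ≠ ⊤ := fun h => by simp [h] at e1
  have hmass : b univ = b' univ := by
    rw [← e2] at e1
    exact (ENNReal.add_right_inj hAt).1 e1
  -- When the residual mass is 0 the normalizing factor is infinite, but the measures it concerns
  -- are zero.
  have hcancel : ∀ κ : Measure ℝ, κ univ = b univ → ((b univ)⁻¹ * b univ) • κ = κ := by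
    intro κ hκ
    rcases eq_or_ne (b univ) 0 with h0 | h0
    · rw [h0, Measure.measure_univ_eq_zero] at hκ
      simp [hκ]
    · rw [ENNReal.inv_mul_cancel h0 (measure_ne_top _ _), one_smul]
  refine ⟨(μ.prod volume).withDensity g + (b univ)⁻¹ • b.prod b', ?_, ?_, ?_⟩
  · rw [Measure.map_add _ _ measurable_fst, Measure.map_smul]
    have : (b.prod b').map Prod.fst = b' univ • b := Measure.map_fst_prod
    rw [this, smul_smul, ← hmass, hcancel b rfl]
    refine Eq.trans ?_ hab.symm
    congr 1
    ext s hs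
    rw [Measure.map_apply measurable_fst hs, withDensity_apply _ (measurable_fst hs),
      withDensity_apply _ hs, ← prod_univ, ← Measure.prod_restrict, Measure.restrict_univ,
      lintegral_prod _ hg.aemeasurable]
  · rw [Measure.map_add _ _ measurable_snd, Measure.map_smul]
    have : (b.prod b').map Prod.snd = b univ • b' := Measure.map_snd_prod
    rw [this, smul_smul, hcancel b' hmass.symm, hμ']
    congr 1
    ext s hs
    rw [Measure.map_apply measurable_snd hs, withDensity_apply _ (measurable_snd hs),
      withDensity_apply _ hs, ← univ_prod, ← Measure.prod_restrict, Measure.restrict_univ,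
      lintegral_prod_symm _ hg.aemeasurable]
  · rw [lintegral_add_measure, lintegral_withDensity_eq_lintegral_mul _ hg hf,
      lintegral_prod _ (hg.mul hf).aemeasurable]
    refine add_le_add le_rfl ?_
    rw [lintegral_smul_measure, lintegral_prod _ hf.aemeasurable]
    calc (b univ)⁻¹ • ∫⁻ x, ∫⁻ z, f (x, z) ∂b' ∂b
        ≤ (b univ)⁻¹ • ∫⁻ x, F x * b' univ ∂b := by
          gcongr with x
          rw [← lintegral_const]
          exact lintegral_mono_ae (hF x)
      _ = ((b univ)⁻¹ * b univ) * ∫⁻ x, F x ∂b := by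
          rw [lintegral_mul_const' _ _ (measure_ne_top _ _), smul_eq_mul, hmass]; ring
      _ ≤ ∫⁻ x, F x ∂b := mul_le_of_le_one_left bot_le (ENNReal.inv_mul_le_one _)
      _ ≤ ∫⁻ x, (1 - a x) * F x ∂μ := by
          rw [hb]
          exact lintegral_withDensity_le_lintegral_mul _ hbm _

/-- Wasserstein estimate for a mollified, truncated and perturbed measure, together with the
weight by the diameter of the support. -/
lemma rpow_mul_wasserstein_le {p q : ℝ} (hq : 1 ≤ q) (hqp : q ≤ p) {μ μ' : Measure ℝ}
    [IsProbabilityMeasure μ] [IsProbabilityMeasure μ'] {R δ ε : ℝ} (hR : 2 ≤ R) (hδ : 0 < δ)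
    (hδ1 : δ < 1) (hε : 0 < ε) (hε1 : ε ≤ 1) {s : ℝ → ℝ≥0∞} (hs : Measurable s)
    (hμ' : μ' = volume.withDensity (fun z =>
      ENNReal.ofReal ((1 - δ) * cutoff R z * convMeasure (mollifier ε) μ z)
        + (Icc (-(2 * R)) (2 * R)).indicator s z))
    {Mom τ : ℝ≥0∞} (hMom : ∫⁻ x, ENNReal.ofReal (|x| ^ p) ∂μ ≤ Mom)
    (hτ : ∫⁻ x in {x | R - 1 ≤ |x|}, ENNReal.ofReal (|x| ^ p) ∂μ ≤ τ) :
    ENNReal.ofReal (max ((4 * R) ^ (p - q)) 1) * wasserstein q μ μ' ^ q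
      ≤ ENNReal.ofReal ((4 * R) ^ p * ε) + ENNReal.ofReal (2 ^ p)
        * (ENNReal.ofReal (δ * (4 * R) ^ p) * (2 + Mom) + ENNReal.ofReal (2 * 8 ^ p) * τ) := by
  have hq0 : 0 < q := by linarith
  have hp0 : 0 < p := by linarith
  have hR0 : 0 < R := by linarith
  have hδ' : 0 ≤ 1 - δ := by linarith
  set c := 2 * R with hc
  have hS : MeasurableSet {x : ℝ | R - 1 ≤ |x|} := measurableSet_le measurable_const (by fun_prop)
  -- Mass at x is spread by the kernel, so it moves by less than ε, and is damped by the factor (1 -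
  -- δ) χ at its target.
  set g : ℝ × ℝ → ℝ≥0∞ := fun z =>
    ENNReal.ofReal ((1 - δ) * cutoff R z.2) * ENNReal.ofReal (mollifier ε (z.2 - z.1)) with hg
  have hwm : Measurable fun z : ℝ => ENNReal.ofReal ((1 - δ) * cutoff R z) :=
    ((continuous_cutoff R).measurable.const_mul _).ennreal_ofReal
  have hgm : Measurable g := (hwm.comp measurable_snd).mul (measurable_mollifier_sub ε)
  have hw1 : ∀ z, ENNReal.ofReal ((1 - δ) * cutoff R z) ≤ 1 := fun z => by
    rw [ENNReal.ofReal_le_one]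
    exact mul_le_one₀ (by linarith) (cutoff_nonneg _ _) (cutoff_le_one _ _)
  have hga : ∀ x, ∫⁻ z, g (x, z) ≤ 1 := fun x => by
    refine le_trans (lintegral_mono fun z => ?_) (lintegral_mollifier_sub hε x).le
    exact mul_le_of_le_one_left bot_le (hw1 z)
  -- For |x| < R - 1 the kernel at x lives where χ = 1, and exactly the fraction δ is not
  -- transported locally. Farther out the trivial bound 1 suffices because the tail is small.
  have hgb : ∀ x, 1 - ∫⁻ z, g (x, z) ≤ ENNReal.ofReal δ + {x : ℝ | R - 1 ≤ |x|}.indicator 1 x := by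
    intro x
    by_cases hx : x ∈ {x : ℝ | R - 1 ≤ |x|}
    · rw [indicator_of_mem hx]
      exact tsub_le_self.trans le_add_self
    · rw [indicator_of_notMem hx, add_zero]
      have hx' : |x| < R - 1 := not_le.1 hx
      have : ∫⁻ z, g (x, z) = ENNReal.ofReal (1 - δ) := by
        rw [← mul_one (ENNReal.ofReal (1 - δ)), ← lintegral_mollifier_sub hε x,
          ← lintegral_const_mul' _ _ ENNReal.ofReal_ne_top]
        refine lintegral_congr fun z => ?_
        rcases le_or_gt ε |z - x| with h | h
        · simp [hg, mollifier_eq_zero hε h]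
        · have hz : |z| ≤ R := by
            have := abs_sub_abs_le_abs_sub z x; linarith
          simp [hg, cutoff_eq_one hR0 hz]
      rw [this, ← ENNReal.ofReal_one, ← ENNReal.ofReal_sub _ hδ']
      simp
  have hsplit : μ' = volume.withDensity (fun z => ∫⁻ x, g (x, z) ∂μ)
      + volume.withDensity ((Icc (-c) c).indicator s) := by
    rw [← withDensity_add_right _ (hs.indicator measurableSet_Icc), hμ']
    congr 1
    funext z
    simp only [Pi.add_apply]
    congr 1
    have hk : Measurable fun x => ENNReal.ofReal (mollifier ε (z - x)) :=
      ((continuous_mollifier ε).measurable.comp (by fun_prop)).ennreal_ofReal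
    simp only [hg]
    rw [lintegral_const_mul _ hk, ← ofReal_convMeasure_mollifier hε,
      ENNReal.ofReal_mul (mul_nonneg hδ' (cutoff_nonneg _ _))]
  have hfm : Measurable fun z : ℝ × ℝ => ENNReal.ofReal (|z.1 - z.2| ^ q) := by fun_prop
  obtain ⟨π, hπ1, hπ2, hπ⟩ := lintegral_coupling_le hgm hga hsplit hfm
    (F := fun x => ENNReal.ofReal (2 ^ q * (|x| ^ q + c ^ q))) (fun x => by
      rw [ae_withDensity_iff (hs.indicator measurableSet_Icc)]
      refine ae_of_all _ fun z hz => ?_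
      have hz' : z ∈ Icc (-c) c := by
        by_contra h; exact hz (indicator_of_notMem h _)
      have hzc : |z| ≤ c := abs_le.2 hz'
      apply ENNReal.ofReal_le_ofReal
      have h1 : |x - z| ≤ 2 * max |x| c := by
        have := abs_sub x z
        have h2 := le_max_left |x| c
        have h3 := le_max_right |x| c
        linarith
      calc |x - z| ^ q ≤ (2 * max |x| c) ^ q := by gcongr
        _ = 2 ^ q * max |x| c ^ q := Real.mul_rpow (by norm_num) (by positivity)
        _ ≤ 2 ^ q * (|x| ^ q + c ^ q) := by
          gcongr
          rcases le_total |x| c with h | h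
          · rw [max_eq_right h]; linarith [Real.rpow_nonneg (abs_nonneg x) q]
          · rw [max_eq_left h]; linarith [Real.rpow_nonneg (by positivity : 0 ≤ c) q])
  have hmax : max ((4 * R) ^ (p - q)) 1 = (4 * R) ^ (p - q) :=
    max_eq_left (Real.one_le_rpow (by linarith) (by linarith))
  have h4 : 1 ≤ 4 * R := by linarith
  have hle : (4 * R) ^ (p - q) ≤ (4 * R) ^ p := Real.rpow_le_rpow_of_exponent_le h4 (by linarith)
  have hsum : (4 * R) ^ (p - q) * (4 * R) ^ q = (4 * R) ^ p := by
    rw [← Real.rpow_add (by linarith)]; simp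
  rw [hmax]
  set w := ENNReal.ofReal ((4 * R) ^ (p - q)) with hw
  refine (mul_le_mul' le_rfl ((wasserstein_rpow_le hq0 hπ1 hπ2).trans hπ)).trans ?_
  rw [mul_add]
  refine add_le_add ?_ ?_
  · have h1 : ∫⁻ x, ∫⁻ z, g (x, z) * ENNReal.ofReal (|x - z| ^ q) ∂volume ∂μ
        ≤ ENNReal.ofReal ε := by
      calc _ ≤ ∫⁻ x, ENNReal.ofReal ε ∂μ := by
            refine lintegral_mono fun x => ?_
            calc _ ≤ ∫⁻ z, ENNReal.ofReal ε * g (x, z) := by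
                  refine lintegral_mono fun z => ?_
                  dsimp only
                  rcases le_or_gt ε |z - x| with h | h
                  · simp [hg, mollifier_eq_zero hε h]
                  · rw [mul_comm]
                    gcongr
                    rw [abs_sub_comm]
                    calc |z - x| ^ q ≤ ε ^ q := by gcongr
                      _ ≤ ε ^ (1 : ℝ) := Real.rpow_le_rpow_of_exponent_ge hε hε1 hq
                      _ = ε := Real.rpow_one ε
              _ ≤ ENNReal.ofReal ε := by
                  rw [lintegral_const_mul' _ _ ENNReal.ofReal_ne_top]
                  exact mul_le_of_le_one_right bot_le (hga x)
        _ = ENNReal.ofReal ε := by simp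
    rw [ENNReal.ofReal_mul (by positivity)]
    exact mul_le_mul' (ENNReal.ofReal_le_ofReal hle) h1
  · rw [← lintegral_const_mul' _ _ ENNReal.ofReal_ne_top]
    have hpt : ∀ x, w * ((1 - ∫⁻ z, g (x, z)) * ENNReal.ofReal (2 ^ q * (|x| ^ q + c ^ q)))
        ≤ ENNReal.ofReal (2 ^ p) * (ENNReal.ofReal (δ * (4 * R) ^ p)
            * (2 + ENNReal.ofReal (|x| ^ p))
          + ENNReal.ofReal (2 * 8 ^ p)
            * {x : ℝ | R - 1 ≤ |x|}.indicator (fun x => ENNReal.ofReal (|x| ^ p)) x) := by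
      intro x
      have hcq : c ^ q ≤ (4 * R) ^ q := by gcongr; linarith
      -- In the bulk the full weight (4R)^p appears and is later compensated by the factor δ.
      have e1 : (4 * R) ^ (p - q) * (|x| ^ q + c ^ q) ≤ (4 * R) ^ p * (2 + |x| ^ p) := by
        have : |x| ^ q ≤ 1 + |x| ^ p := by
          rcases le_total |x| 1 with h | h
          · have := Real.rpow_le_one (abs_nonneg x) h hq0.le
            linarith [Real.rpow_nonneg (abs_nonneg x) p]
          · have := Real.rpow_le_rpow_of_exponent_le h hqp
            linarith
        calc (4 * R) ^ (p - q) * (|x| ^ q + c ^ q)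
            ≤ (4 * R) ^ (p - q) * (1 + |x| ^ p) + (4 * R) ^ (p - q) * (4 * R) ^ q := by
              rw [← mul_add]; gcongr
          _ ≤ (4 * R) ^ p * (1 + |x| ^ p) + (4 * R) ^ p := by rw [hsum]; gcongr
          _ = _ := by ring
      -- In the tail there is no factor δ, but R ≥ 2 gives 4R ≤ 8 |x|, so powers of R are traded for
      -- powers of |x|.
      have e2 : R - 1 ≤ |x| → (4 * R) ^ (p - q) * (|x| ^ q + c ^ q) ≤ 2 * 8 ^ p * |x| ^ p := by
        intro hx
        have h8 : 4 * R ≤ 8 * |x| := by linarith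
        calc (4 * R) ^ (p - q) * (|x| ^ q + c ^ q)
            ≤ (8 * |x|) ^ (p - q) * ((8 * |x|) ^ q + (8 * |x|) ^ q) := by
              have hpq : 0 ≤ p - q := by linarith
              gcongr
              · linarith [abs_nonneg x]
              · linarith
          _ = 2 * ((8 * |x|) ^ (p - q) * (8 * |x|) ^ q) := by ring
          _ = 2 * (8 * |x|) ^ p := by
              rw [← Real.rpow_add (by linarith)]; simp
          _ = _ := by rw [Real.mul_rpow (by norm_num) (abs_nonneg x)]; ring
      calc w * ((1 - ∫⁻ z, g (x, z)) * ENNReal.ofReal (2 ^ q * (|x| ^ q + c ^ q)))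
          ≤ w * ((ENNReal.ofReal δ + {x : ℝ | R - 1 ≤ |x|}.indicator 1 x)
              * (ENNReal.ofReal (2 ^ p) * ENNReal.ofReal (|x| ^ q + c ^ q))) := by
            rw [ENNReal.ofReal_mul (by positivity)]
            gcongr
            · exact hgb x
            · norm_num
        _ = ENNReal.ofReal (2 ^ p) * (ENNReal.ofReal δ
              * ENNReal.ofReal ((4 * R) ^ (p - q) * (|x| ^ q + c ^ q))
            + ENNReal.ofReal ((4 * R) ^ (p - q) * (|x| ^ q + c ^ q))
              * {x : ℝ | R - 1 ≤ |x|}.indicator 1 x) := by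
            rw [ENNReal.ofReal_mul (p := (4 * R) ^ (p - q)) (by positivity)]; ring
        _ ≤ _ := by
            refine mul_le_mul' le_rfl (add_le_add ?_ ?_)
            · rw [ENNReal.ofReal_mul (p := δ) hδ.le, mul_assoc]
              gcongr
              refine (ENNReal.ofReal_le_ofReal e1).trans ?_
              rw [ENNReal.ofReal_mul (by positivity), ENNReal.ofReal_add (by norm_num)
                (by positivity)]
              simp
            · by_cases hx : x ∈ {x : ℝ | R - 1 ≤ |x|}
              · rw [indicator_of_mem hx, indicator_of_mem hx, Pi.one_apply, mul_one,
                  ← ENNReal.ofReal_mul (by positivity)]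
                exact ENNReal.ofReal_le_ofReal (e2 hx)
              · rw [indicator_of_notMem hx, mul_zero]
                exact bot_le
    refine (lintegral_mono hpt).trans ?_
    have hmp : Measurable fun x : ℝ => ENNReal.ofReal (|x| ^ p) := by fun_prop
    rw [lintegral_const_mul' _ _ ENNReal.ofReal_ne_top,
      lintegral_add_right _ ((hmp.indicator hS).const_mul _),
      lintegral_const_mul' _ _ ENNReal.ofReal_ne_top,
      lintegral_const_mul' _ _ ENNReal.ofReal_ne_top, lintegral_indicator hS,
      lintegral_add_right _ hmp]
    simp only [lintegral_const, measure_univ, mul_one]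
    gcongr

end

section

variable {p M : ℝ} {m : ℝ → ℝ}

/-! ### The regularized density and flux -/

/-- The density at time `t` of the regularized curve: the mollified measure `κ` is truncated by a
cutoff function and the lost mass is put back, up to a small constant and a small drift. -/
def regDensity (ε R δ α : ℝ) (κ : Measure ℝ) (t y : ℝ) : ℝ :=
  (1 - δ) * (cutoff R y * convMeasure (mollifier ε) κ y
    + deriv (cutoff R) y * (convMeasure (smoothStep ε) κ y - smoothStep 1 y))
  + (δ / (4 * R) + α * t * deriv (cutoff R) y)

/-- The flux of the regularized curve. -/
def regFlux (ε R δ α : ℝ) (ν : SignedMeasure ℝ) (y : ℝ) : ℝ :=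
  cutoff R y * ((1 - δ) * convSigned (mollifier ε) ν y - α)

lemma abs_smoothStep_le (ε x : ℝ) : |smoothStep ε x| ≤ 1 := by
  rw [abs_of_nonneg (smoothStep_nonneg _ _)]; exact smoothStep_le_one _ _

lemma hasDerivAt_convMeasure_smoothStep {ε : ℝ} (hε : 0 < ε) (κ : Measure ℝ) [IsFiniteMeasure κ]
    (y : ℝ) :
    HasDerivAt (convMeasure (smoothStep ε) κ) (convMeasure (mollifier ε) κ y) y := by
  obtain ⟨C, _, hC, _⟩ := exists_mollifier_bound hε
  exact hasDerivAt_convMeasure κ (hasDerivAt_smoothStep ε) (continuous_mollifier ε).measurable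
    (abs_smoothStep_le ε) hC y

lemma contDiff_convMeasure_smoothStep {ε : ℝ} (hε : 0 < ε) (κ : Measure ℝ) [IsFiniteMeasure κ] :
    ContDiff ℝ ∞ (convMeasure (smoothStep ε) κ) := by
  rw [contDiff_infty_iff_deriv]
  refine ⟨fun y => (hasDerivAt_convMeasure_smoothStep hε κ y).differentiableAt, ?_⟩
  rw [funext fun y => (hasDerivAt_convMeasure_smoothStep hε κ y).deriv]
  exact contDiff_convMeasure κ (contDiff_mollifier ε) (hasCompactSupport_mollifier hε)

lemma contDiff_regDensity {ε : ℝ} (hε : 0 < ε) (R δ α : ℝ) (κ : Measure ℝ) [IsFiniteMeasure κ]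
    (t : ℝ) : ContDiff ℝ ∞ (regDensity ε R δ α κ t) := by
  have h1 : ContDiff ℝ ∞ (cutoff R) := contDiff_cutoff R
  have h2 := contDiff_deriv_cutoff R
  have h3 : ContDiff ℝ ∞ (convMeasure (mollifier ε) κ) :=
    contDiff_convMeasure κ (contDiff_mollifier ε) (hasCompactSupport_mollifier hε)
  have h4 := contDiff_convMeasure_smoothStep hε κ
  have h5 : ContDiff ℝ ∞ (smoothStep 1) := contDiff_smoothStep 1
  unfold regDensity
  fun_prop

lemma contDiff_regFlux {ε : ℝ} (hε : 0 < ε) (R δ α : ℝ) (ν : SignedMeasure ℝ) :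
    ContDiff ℝ ∞ (regFlux ε R δ α ν) := by
  have h1 : ContDiff ℝ ∞ (cutoff R) := contDiff_cutoff R
  have h2 : ContDiff ℝ ∞ (convSigned (mollifier ε) ν) :=
    contDiff_convSigned ν (contDiff_mollifier ε) (hasCompactSupport_mollifier hε)
  unfold regFlux
  fun_prop

lemma regFlux_eq_zero {ε R δ α : ℝ} (hR : 0 < R) (ν : SignedMeasure ℝ) {y : ℝ}
    (hy : y ∉ Icc (-(2 * R)) (2 * R)) : regFlux ε R δ α ν y = 0 := by
  have : 2 * R ≤ |y| := by
    by_contra! h; exact hy ⟨(abs_lt.1 h).1.le, (abs_lt.1 h).2.le⟩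
  simp [regFlux, cutoff_eq_zero hR this]

lemma integrable_regFlux {ε R δ α : ℝ} (hε : 0 < ε) (hR : 0 < R) (ν : SignedMeasure ℝ) :
    Integrable (regFlux ε R δ α ν) :=
  (contDiff_regFlux hε R δ α ν).continuous.integrable_of_hasCompactSupport
    (HasCompactSupport.intro isCompact_Icc fun _ hy => regFlux_eq_zero hR ν hy)

/-- An explicit primitive exists: (1 - δ)(χ F_ε + (1 - χ) H) + δ y/(4R) + α t χ. Its derivative
differs from the density only by a multiple of (1 - χ) H', which is zero since H' vanishes unless
|y| < 1 ≤ R. At the endpoints χ = 0, so κ does not influence the total. -/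
lemma integral_regDensity {ε R δ α : ℝ} (hε : 0 < ε) (hR : 1 ≤ R) (κ : Measure ℝ)
    [IsFiniteMeasure κ] (t : ℝ) :
    ∫ y in Icc (-(2 * R)) (2 * R), regDensity ε R δ α κ t y = 1 := by
  have hR0 : 0 < R := by linarith
  have hd : ∀ y, HasDerivAt (fun y => (1 - δ) * (cutoff R y * convMeasure (smoothStep ε) κ y
      + (1 - cutoff R y) * smoothStep 1 y) + (δ / (4 * R) * y + α * t * cutoff R y))
      (regDensity ε R δ α κ t y) y := by
    intro y
    have hw := hasDerivAt_cutoff R y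
    have hz : (1 - cutoff R y) * mollifier 1 y = 0 := by
      rcases le_or_gt 1 |y| with h | h
      · rw [mollifier_eq_zero one_pos h, mul_zero]
      · rw [cutoff_eq_one hR0 (by linarith), sub_self, zero_mul]
    refine HasDerivAt.congr_deriv ((((hw.mul (hasDerivAt_convMeasure_smoothStep hε κ y)).add
      ((hw.const_sub 1).mul (hasDerivAt_smoothStep 1 y))).const_mul (1 - δ)).add
      (((hasDerivAt_id y).const_mul (δ / (4 * R))).add (hw.const_mul (α * t)))) ?_
    unfold regDensity
    linear_combination (1 - δ) * hz
  rw [integral_Icc_eq_integral_Ioc, ← intervalIntegral.integral_of_le (by linarith),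
    intervalIntegral.integral_eq_sub_of_hasDerivAt (fun y _ => hd y)
      ((contDiff_regDensity hε R δ α κ t).continuous.intervalIntegrable _ _)]
  have e1 : cutoff R (2 * R) = 0 := cutoff_eq_zero hR0 (le_abs_self _)
  have e2 : cutoff R (-(2 * R)) = 0 := cutoff_eq_zero hR0 (by rw [abs_neg]; exact le_abs_self _)
  rw [e1, e2, smoothStep_of_ge one_pos (by linarith), smoothStep_of_le one_pos (by linarith)]
  field_simp
  ring

/-- The derivative of the cutoff vanishes for |y| < R. For |y| ≥ R and |x| < R - 1 both steps equal
the same constant, 0 or 1, so the difference only sees the mass of κ beyond R - 1. -/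
lemma abs_deriv_cutoff_mul_le {ε R D : ℝ} (hε : 0 < ε) (hε1 : ε ≤ 1) (hR : 1 ≤ R)
    (hD : ∀ x, |deriv (cutoff R) x| ≤ D / R) (κ : Measure ℝ) [IsProbabilityMeasure κ] (y : ℝ) :
    |deriv (cutoff R) y * (convMeasure (smoothStep ε) κ y - smoothStep 1 y)|
      ≤ D / R * κ.real {x | R - 1 ≤ |x|} := by
  have hR0 : 0 < R := by linarith
  have hDR : 0 ≤ D / R := (abs_nonneg _).trans (hD 0)
  rcases lt_or_ge |y| R with hy | hy
  · rw [deriv_cutoff_eq_zero_of_lt hR0 hy, zero_mul, abs_zero]; positivity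
  rw [abs_mul]
  refine mul_le_mul (hD y) ?_ (abs_nonneg _) hDR
  have hS : MeasurableSet {x : ℝ | R - 1 ≤ |x|} := measurableSet_le measurable_const (by fun_prop)
  have hpt : ∀ x, |smoothStep ε (y - x) - smoothStep 1 y|
      ≤ {x : ℝ | R - 1 ≤ |x|}.indicator (fun _ => (1 : ℝ)) x := by
    intro x
    by_cases hx : x ∈ {x : ℝ | R - 1 ≤ |x|}
    · rw [indicator_of_mem hx, abs_le]
      constructor <;> linarith [smoothStep_nonneg ε (y - x), smoothStep_le_one ε (y - x),
        smoothStep_nonneg 1 y, smoothStep_le_one 1 y]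
    · rw [indicator_of_notMem hx]
      have hx' : |x| < R - 1 := not_le.1 hx
      obtain ⟨h1, h2⟩ := abs_lt.1 hx'
      rcases le_abs.1 hy with h | h
      · rw [smoothStep_of_ge hε (by linarith), smoothStep_of_ge one_pos (by linarith)]; simp
      · rw [smoothStep_of_le hε (by linarith), smoothStep_of_le one_pos (by linarith)]; simp
  have hi : Integrable (fun x => smoothStep ε (y - x)) κ :=
    integrable_of_bound ((continuous_smoothStep ε).measurable.comp (by fun_prop))
      fun x => abs_smoothStep_le ε _
  have e : convMeasure (smoothStep ε) κ y - smoothStep 1 y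
      = ∫ x, (smoothStep ε (y - x) - smoothStep 1 y) ∂κ := by
    rw [integral_sub hi (integrable_const _), convMeasure]; simp
  rw [e]
  refine (norm_integral_le_of_norm_le
    (f := fun x => smoothStep ε (y - x) - smoothStep 1 y) ((integrable_const (1 : ℝ)).indicator hS)
    (ae_of_all _ hpt)).trans ?_
  rw [integral_indicator_const _ hS, smul_eq_mul, mul_one]

/-- The regularized density is a convex combination of the mollified density and of a function
bounded from above and away from zero. -/
lemma exists_regDensity_eq {ε R δ α D : ℝ} (hε : 0 < ε) (hε1 : ε ≤ 1) (hR : 1 ≤ R) (hδ : 0 < δ)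
    (hδ1 : δ < 1) (hD : ∀ x, |deriv (cutoff R) x| ≤ D / R) (hα : D * |α| ≤ δ / 16)
    (κ : Measure ℝ) [IsProbabilityMeasure κ] (hκ : D * κ.real {x | R - 1 ≤ |x|} ≤ δ / 16) {t : ℝ}
    (ht : t ∈ Icc (0 : ℝ) 1) (y : ℝ) :
    ∃ s ∈ Icc (δ / (8 * R)) (3 / (8 * R)), δ / (8 * R) ≤ (1 - (1 - δ) * cutoff R y) * s ∧
      regDensity ε R δ α κ t y = (1 - δ) * cutoff R y * convMeasure (mollifier ε) κ y
        + (1 - (1 - δ) * cutoff R y) * s := by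
  have hR0 : 0 < R := by linarith
  have hw0 := cutoff_nonneg R y
  have hw1 := cutoff_le_one R y
  have h1 := abs_deriv_cutoff_mul_le hε hε1 hR hD κ y
  set e := deriv (cutoff R) y * (convMeasure (smoothStep ε) κ y - smoothStep 1 y) with he
  set l := 1 - (1 - δ) * cutoff R y with hl
  have hl0 : δ ≤ l := by nlinarith
  have hl1 : l ≤ 1 := by nlinarith
  have hlpos : 0 < l := by linarith
  have b1 : |e| ≤ δ / (16 * R) := h1.trans (by
    rw [div_mul_eq_mul_div, div_le_div_iff₀ hR0 (by positivity)]
    nlinarith)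
  have b2 : |(1 - δ) * e| ≤ δ / (16 * R) := by
    rw [abs_mul, abs_of_nonneg (by linarith : 0 ≤ 1 - δ)]
    exact (mul_le_of_le_one_left (abs_nonneg _) (by linarith)).trans b1
  have b3 : |α * t * deriv (cutoff R) y| ≤ δ / (16 * R) := by
    rw [abs_mul, abs_mul, abs_of_nonneg ht.1]
    calc |α| * t * |deriv (cutoff R) y| ≤ |α| * 1 * (D / R) := by
          gcongr
          · exact ht.2
          · exact hD y
      _ = D * |α| / R := by ring
      _ ≤ (δ / 16) / R := by gcongr
      _ = _ := by field_simp
  -- In units of δ/(16R): the constant term is 4 and each of the two corrections is at most 1 in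
  -- absolute value, so r lies between 2 and 6.
  set r := (1 - δ) * e + (δ / (4 * R) + α * t * deriv (cutoff R) y) with hr
  have e1 : δ / (4 * R) = 4 * (δ / (16 * R)) := by field_simp; norm_num
  have e2 : δ / (8 * R) = 2 * (δ / (16 * R)) := by field_simp; norm_num
  have e3 : 3 / (8 * R) * δ = 6 * (δ / (16 * R)) := by field_simp; norm_num
  obtain ⟨c1, c2⟩ := abs_le.1 b2
  obtain ⟨c3, c4⟩ := abs_le.1 b3
  have r1 : δ / (8 * R) ≤ r := by rw [e2, hr, e1]; linarith
  have r2 : r ≤ 3 / (8 * R) * δ := by rw [e3, hr, e1]; linarith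
  have hr0 : 0 ≤ r := le_trans (by positivity) r1
  -- Since δ ≤ l ≤ 1, dividing by the weight keeps the lower bound on r and turns 3δ/(8R) into
  -- 3/(8R).
  refine ⟨r / l, ⟨?_, ?_⟩, ?_, ?_⟩
  · rw [le_div_iff₀ hlpos]
    exact (mul_le_of_le_one_right (by positivity) hl1).trans r1
  · rw [div_le_iff₀ hlpos]
    exact r2.trans (by gcongr)
  · rwa [mul_div_cancel₀ _ hlpos.ne']
  · rw [mul_div_cancel₀ _ hlpos.ne', regDensity, hr, he]
    ring

lemma le_regDensity {ε R δ α D : ℝ} (hε : 0 < ε) (hε1 : ε ≤ 1) (hR : 1 ≤ R) (hδ : 0 < δ)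
    (hδ1 : δ < 1) (hD : ∀ x, |deriv (cutoff R) x| ≤ D / R) (hα : D * |α| ≤ δ / 16)
    (κ : Measure ℝ) [IsProbabilityMeasure κ] (hκ : D * κ.real {x | R - 1 ≤ |x|} ≤ δ / 16) {t : ℝ}
    (ht : t ∈ Icc (0 : ℝ) 1) (y : ℝ) :
    (1 - δ) * cutoff R y * convMeasure (mollifier ε) κ y + δ / (8 * R)
      ≤ regDensity ε R δ α κ t y := by
  obtain ⟨s, _, hs, he⟩ := exists_regDensity_eq hε hε1 hR hδ hδ1 hD hα κ hκ ht y
  rw [he]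
  gcongr

lemma regDensity_pos {ε R δ α D : ℝ} (hε : 0 < ε) (hε1 : ε ≤ 1) (hR : 1 ≤ R) (hδ : 0 < δ)
    (hδ1 : δ < 1) (hD : ∀ x, |deriv (cutoff R) x| ≤ D / R) (hα : D * |α| ≤ δ / 16)
    (κ : Measure ℝ) [IsProbabilityMeasure κ] (hκ : D * κ.real {x | R - 1 ≤ |x|} ≤ δ / 16) {t : ℝ}
    (ht : t ∈ Icc (0 : ℝ) 1) (y : ℝ) : δ / (16 * R) < regDensity ε R δ α κ t y := by
  refine lt_of_lt_of_le ?_ (le_regDensity hε hε1 hR hδ hδ1 hD hα κ hκ ht y)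
  have h1 : 0 ≤ (1 - δ) * cutoff R y * convMeasure (mollifier ε) κ y :=
    mul_nonneg (mul_nonneg (by linarith) (cutoff_nonneg _ _)) (convMeasure_mollifier_nonneg hε _ _)
  have h2 : δ / (16 * R) < δ / (8 * R) := by gcongr; norm_num
  linarith

/-- A convex combination of values below B. Strictness comes from the second weight, which is at
least δ. -/
lemma regDensity_lt {ε R δ α D A B : ℝ} (hε : 0 < ε) (hε1 : ε ≤ 1) (hR : 1 ≤ R) (hδ : 0 < δ)
    (hδ1 : δ < 1) (hD : ∀ x, |deriv (cutoff R) x| ≤ D / R) (hα : D * |α| ≤ δ / 16)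
    (κ : Measure ℝ) [IsProbabilityMeasure κ] (hκ : D * κ.real {x | R - 1 ≤ |x|} ≤ δ / 16) {t : ℝ}
    (ht : t ∈ Icc (0 : ℝ) 1) {y : ℝ} (hA : convMeasure (mollifier ε) κ y ≤ A) (hAB : A < B)
    (hRB : 3 / (8 * R) < B) : regDensity ε R δ α κ t y < B := by
  obtain ⟨s, hs, _, he⟩ := exists_regDensity_eq hε hε1 hR hδ hδ1 hD hα κ hκ ht y
  rw [he]
  have hw0 := cutoff_nonneg R y
  have hw1 := cutoff_le_one R y
  set l := (1 - δ) * cutoff R y with hl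
  have hl0 : 0 ≤ l := mul_nonneg (by linarith) hw0
  have hl1 : l ≤ 1 - δ := by nlinarith
  calc l * convMeasure (mollifier ε) κ y + (1 - l) * s
      ≤ l * A + (1 - l) * s := by gcongr
    _ < l * B + (1 - l) * B :=
        add_lt_add_of_le_of_lt (by gcongr) (mul_lt_mul_of_pos_left (hs.2.trans_lt hRB) (by linarith))
    _ = B := by ring

/-- The flux splits with the same weights as the density: j_ε with weight l = (1 - δ) χ, and -α χ /
(1 - l) with weight 1 - l. As 1 - l ≥ δ, the second flux is at most |α|/δ, and convexity applies. -/
lemma actionDensity_reg_le (hp : 1 < p) (hM : 0 ≤ M) (hm : IsMobility M m) {ε R δ α D : ℝ}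
    (hε : 0 < ε) (hε1 : ε ≤ 1) (hR : 1 ≤ R) (hδ : 0 < δ)
    (hδ1 : δ < 1) (hD : ∀ x, |deriv (cutoff R) x| ≤ D / R) (hα : D * |α| ≤ δ / 16)
    (κ : Measure ℝ) [IsProbabilityMeasure κ] (hκ : D * κ.real {x | R - 1 ≤ |x|} ≤ δ / 16) {t : ℝ}
    (ht : t ∈ Icc (0 : ℝ) 1) {y : ℝ} (hy : convMeasure (mollifier ε) κ y ≤ M) {E : ℝ≥0∞}
    (hRM : 3 / (8 * R) ≤ M) (ν : SignedMeasure ℝ)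
    (hE : ∀ s ∈ Icc (δ / (8 * R)) (3 / (8 * R)), ∀ τ, |τ| ≤ |α| / δ →
      actionDensity p M m s τ ≤ E) :
    actionDensity p M m (regDensity ε R δ α κ t y) (regFlux ε R δ α ν y)
      ≤ actionDensity p M m (convMeasure (mollifier ε) κ y) (convSigned (mollifier ε) ν y)
        + E := by
  obtain ⟨s, hs, _, he⟩ := exists_regDensity_eq hε hε1 hR hδ hδ1 hD hα κ hκ ht y
  have hw0 := cutoff_nonneg R y
  have hw1 := cutoff_le_one R y
  have hl0 : 0 ≤ (1 - δ) * cutoff R y := mul_nonneg (by linarith) hw0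
  have hl1 : (1 - δ) * cutoff R y ≤ 1 - δ := by nlinarith
  have hl2 : 0 < 1 - (1 - δ) * cutoff R y := by linarith
  have hf : regFlux ε R δ α ν y = (1 - δ) * cutoff R y * convSigned (mollifier ε) ν y
      + (1 - (1 - δ) * cutoff R y) * (-(α * cutoff R y) / (1 - (1 - δ) * cutoff R y)) := by
    rw [mul_div_cancel₀ _ hl2.ne', regFlux]; ring
  rw [he, hf]
  refine (actionDensity_convex_le hp hM hm ⟨hl0, by linarith⟩
    ⟨convMeasure_mollifier_nonneg hε _ _, hy⟩
    ⟨le_trans (by positivity) hs.1, hs.2.trans hRM⟩).trans ?_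
  gcongr
  refine hE s hs _ ?_
  rw [abs_div, abs_neg, abs_mul, abs_of_nonneg hw0, abs_of_pos hl2]
  gcongr
  · exact mul_le_of_le_one_right (abs_nonneg _) hw1
  · linarith

/-- A measure charging every interval inside `(-c, c)` and nothing else has support `[-c, c]`. -/
lemma support_eq_Icc {κ : Measure ℝ} {c : ℝ} (hc : 0 < c)
    (hpos : ∀ a b, a < b → Ioo a b ⊆ Ioo (-c) c → κ (Ioo a b) ≠ 0)
    (hzero : κ (Icc (-c) c)ᶜ = 0) : κ.support = Icc (-c) c := by
  refine Subset.antisymm (Measure.support_subset_of_isClosed isClosed_Icc hzero) ?_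
  rw [← closure_Ioo (by linarith : -c ≠ c)]
  refine closure_minimal (fun x hx => ?_) Measure.isClosed_support
  rw [Measure.mem_support_iff_forall]
  intro U hU
  obtain ⟨a, b, hab, hsub⟩ := mem_nhds_iff_exists_Ioo_subset.1
    (Filter.inter_mem hU (isOpen_Ioo.mem_nhds hx))
  exact (pos_iff_ne_zero.2 (hpos a b (hab.1.trans hab.2)
    (hsub.trans inter_subset_right))).trans_le (measure_mono (hsub.trans inter_subset_left))

end

section

/-! ### Solutions with densities -/

lemma integral_withDensity_ofReal {κ : Measure ℝ} {f φ : ℝ → ℝ} (hf : Measurable f)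
    (h0 : ∀ᵐ y ∂κ, 0 ≤ f y) :
    ∫ y, φ y ∂(κ.withDensity fun y => ENNReal.ofReal (f y)) = ∫ y, φ y * f y ∂κ := by
  rw [integral_withDensity_eq_integral_toReal_smul hf.ennreal_ofReal
    (ae_of_all _ fun _ => ENNReal.ofReal_lt_top)]
  refine integral_congr_ae ?_
  filter_upwards [h0] with y hy
  rw [ENNReal.toReal_ofReal hy, smul_eq_mul, mul_comm]

/-- A curve with continuous densities solving the continuity equation pointwise, in integrated
form, is a solution in the sense of distributions. -/
lemma isCE_of_density {D J J' : ℝ → ℝ → ℝ} {c C : ℝ} {B : ℝ → ℝ≥0∞}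
    (hD : ∀ y, ∀ t ∈ Icc (0 : ℝ) 1, D t y - D 0 y = -∫ r in (0 : ℝ)..t, J' r y)
    (hDm : Measurable fun z : ℝ × ℝ => D z.1 z.2) (hDC : ∀ t ∈ Icc (0 : ℝ) 1, ∀ y, |D t y| ≤ C)
    (hD0 : ∀ t ∈ Icc (0 : ℝ) 1, ∀ y, 0 ≤ D t y)
    (hJ : ∀ t y, HasDerivAt (J t) (J' t y) y)
    (hJ' : ∀ t, Continuous (J' t)) (hJm : Measurable fun z : ℝ × ℝ => J z.1 z.2)
    (hJm' : Measurable fun z : ℝ × ℝ => J' z.1 z.2)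
    (hB : ∀ t y, ‖J t y‖ₑ ≤ B t) (hB' : ∀ t y, ‖J' t y‖ₑ ≤ B t)
    (hBT : ∫⁻ t in Ioo (0 : ℝ) 1, B t < ⊤)
    (hJs : ∀ t y, y ∉ Icc (-c) c → J t y = 0) (hJs' : ∀ t y, y ∉ Icc (-c) c → J' t y = 0)
    {μ : ℝ → ProbabilityMeasure ℝ} {ν : ℝ → SignedMeasure ℝ} {G : Set ℝ}
    (hμ : ∀ t ∈ Icc (0 : ℝ) 1, (μ t : Measure ℝ)
      = (volume.restrict (Icc (-c) c)).withDensity fun y => ENNReal.ofReal (D t y))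
    (hνG : ∀ t ∈ G, ν t = volume.withDensityᵥ (J t)) (hν0 : ∀ t ∉ G, ν t = 0)
    (hGm : MeasurableSet G) (hG : ∀ᵐ t, t ∈ Ioo (0 : ℝ) 1 → t ∈ G) : IsCE μ ν := by
  have hDt : ∀ t, Measurable (D t) := fun t => hDm.comp (measurable_const.prodMk measurable_id)
  have hJc : ∀ t, Continuous (J t) := fun t =>
    continuous_iff_continuousAt.2 fun y => (hJ t y).continuousAt
  have hJi : ∀ t, Integrable (J t) := fun t => (hJc t).integrable_of_hasCompactSupport
    (HasCompactSupport.intro isCompact_Icc fun y hy => hJs t y hy)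
  have hint : ∀ φ : ℝ → ℝ, ∀ t ∈ Icc (0 : ℝ) 1,
      ∫ y, φ y ∂(μ t : Measure ℝ) = ∫ y in Icc (-c) c, φ y * D t y := fun φ t ht => by
    rw [hμ t ht, integral_withDensity_ofReal (hDt t) (ae_of_all _ (hD0 t ht))]
  -- At fixed y the density is a primitive in time; dominated convergence then yields vague
  -- continuity.
  have hDcont : ∀ y, ContinuousOn (fun t => D t y) (Icc 0 1) := by
    intro y
    have hi : IntegrableOn (fun r => J' r y) (Icc 0 1) := by
      rw [integrableOn_Icc_iff_integrableOn_Ioo]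
      exact ⟨(hJm'.comp (measurable_id.prodMk measurable_const)).aestronglyMeasurable,
        (lintegral_mono fun t => hB' t y).trans_lt hBT⟩
    rw [← uIcc_of_le (zero_le_one' ℝ)] at hi
    have := intervalIntegral.continuousOn_primitive_interval hi
    rw [uIcc_of_le (zero_le_one' ℝ)] at this
    refine (continuousOn_const.sub this : ContinuousOn (fun t => D 0 y - _) _).congr fun t ht => ?_
    rw [Pi.sub_apply, sub_eq_add_neg, ← hD y t ht]
    ring
  refine ⟨fun φ hφ hφs => ?_, fun A hA => ?_, fun a b R ha hb => ?_, fun ξ hξ hξs hξt => ?_⟩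
  · have key : ContinuousOn (fun t => ∫ y in Icc (-c) c, φ y * D t y) (Icc 0 1) := by
      refine continuousOn_of_dominated (bound := fun y => |φ y| * C) (fun t _ => ?_)
        (fun t ht => ae_of_all _ fun y => ?_) ?_ (ae_of_all _ fun y => ?_)
      · exact (hφ.measurable.mul (hDt t)).aestronglyMeasurable
      · rw [Real.norm_eq_abs, abs_mul]
        exact mul_le_mul_of_nonneg_left (hDC t ht y) (abs_nonneg _)
      · exact (hφ.abs.mul continuous_const).continuousOn.integrableOn_Icc
      · exact continuousOn_const.mul (hDcont y)
    exact key.congr fun t ht => hint φ t ht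
  · have h1 : Measurable fun t => ∫ y in A, J t y :=
      (StronglyMeasurable.integral_prod_right' (f := fun z : ℝ × ℝ => J z.1 z.2)
        hJm.stronglyMeasurable).measurable
    classical
    have h2 : (fun t => ν t A) = fun t => if t ∈ G then ∫ y in A, J t y else 0 := by
      funext t
      split_ifs with h
      · rw [hνG t h, withDensityᵥ_apply (hJi t) hA]
      · rw [hν0 t h]; rfl
    have h3 : Measurable fun t => ν t A := by
      rw [h2]; exact Measurable.ite hGm h1 measurable_const
    exact h3.comp measurable_subtype_coe
  · have h1 : ∀ t, (ν t).totalVariation (Icc (-R) R) ≤ B t * ENNReal.ofReal (2 * c) := by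
      intro t
      by_cases h : t ∈ G
      · rw [hνG t h, totalVariation_withDensity (hJi t)]
        refine (measure_mono (subset_univ _)).trans ?_
        rw [withDensity_apply _ MeasurableSet.univ, setLIntegral_univ]
        calc ∫⁻ y, ‖J t y‖ₑ ≤ ∫⁻ y, (Icc (-c) c).indicator (fun _ => B t) y := by
              refine lintegral_mono fun y => ?_
              by_cases hy : y ∈ Icc (-c) c
              · rw [indicator_of_mem hy]; exact hB t y
              · rw [hJs t y hy]; simp
          _ = _ := by
              rw [lintegral_indicator measurableSet_Icc, setLIntegral_const, Real.volume_Icc]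
              congr 2; ring
      · rw [hν0 t h, SignedMeasure.totalVariation_zero]; simp
    calc _ ≤ ∫⁻ t in Ioo (0 : ℝ) 1, B t * ENNReal.ofReal (2 * c) :=
          (lintegral_mono h1).trans (lintegral_mono_set fun t ht =>
            ⟨ha.trans_le ht.1, ht.2.trans_lt hb⟩)
      _ = (∫⁻ t in Ioo (0 : ℝ) 1, B t) * ENNReal.ofReal (2 * c) :=
          lintegral_mul_const' _ _ ENNReal.ofReal_ne_top
      _ < ⊤ := ENNReal.mul_lt_top hBT ENNReal.ofReal_lt_top
  · have hdc : Continuous (fderiv ℝ ξ) := hξ.continuous_fderiv (by simp)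
    obtain ⟨K, hK⟩ := hdc.bounded_above_of_compact_support (hξs.fderiv (𝕜 := ℝ))
    have hb : ∀ t y, |fderiv ℝ ξ (t, y) (0, 1)| ≤ K * ‖((0, 1) : ℝ × ℝ)‖ := fun t y =>
      ((fderiv ℝ ξ (t, y)).le_opNorm _).trans (by gcongr; exact hK _)
    refine Eq.trans ?_ (weak_eq_of_pointwise hD hDm hDC hJ hJ' hJm' hB' hBT hJs' hξ hξs hξt)
    congr 1
    · exact setIntegral_congr_fun measurableSet_Ioo fun t ht =>
        hint (fun y => fderiv ℝ ξ (t, y) (1, 0)) t (Ioo_subset_Icc_self ht)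
    -- Times outside G form a null set, so replacing the flux by 0 there does not affect the
    -- equation.
    · refine setIntegral_congr_ae measurableSet_Ioo ?_
      filter_upwards [hG] with t ht ht'
      rw [hνG t (ht ht')]
      refine vint_withDensity (hJi t) ?_ (hb t)
      exact ((hdc.comp (by fun_prop)).clm_apply continuous_const).measurable

end

section

variable {p M : ℝ} {m : ℝ → ℝ}

/-! ### The regularized curve -/

/-- The conditions on the parameters of the regularization: `D / R` bounds the derivative of the
cutoff function, and the drift `α` is small. -/
structure IsAdmissible (ε R δ α D : ℝ) : Prop where
  ε_pos : 0 < ε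
  ε_le : ε ≤ 1
  two_le : 2 ≤ R
  δ_pos : 0 < δ
  δ_lt : δ < 1
  deriv_le : ∀ x, |deriv (cutoff R) x| ≤ D / R
  drift_le : D * |α| ≤ δ / 16

/-- The measure with density `regDensity` on `[-2R, 2R]`. -/
def regMeasure (ε R δ α : ℝ) (κ : Measure ℝ) (t : ℝ) : Measure ℝ :=
  (volume.restrict (Icc (-(2 * R)) (2 * R))).withDensity
    fun y => ENNReal.ofReal (regDensity ε R δ α κ t y)

lemma regMeasure_eq_withDensity_indicator (ε R δ α : ℝ) (κ : Measure ℝ) (t : ℝ) :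
    regMeasure ε R δ α κ t = volume.withDensity ((Icc (-(2 * R)) (2 * R)).indicator
      fun y => ENNReal.ofReal (regDensity ε R δ α κ t y)) := by
  rw [regMeasure, withDensity_indicator measurableSet_Icc]

section

variable {ε R δ α D : ℝ} {κ : Measure ℝ} [IsProbabilityMeasure κ] {t : ℝ}

lemma IsAdmissible.R_pos (h : IsAdmissible ε R δ α D) : 0 < R := by linarith [h.two_le]

lemma IsAdmissible.lt_regDensity (h : IsAdmissible ε R δ α D)
    (hκ : D * κ.real {x | R - 1 ≤ |x|} ≤ δ / 16) (ht : t ∈ Icc (0 : ℝ) 1) (y : ℝ) :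
    δ / (16 * R) < regDensity ε R δ α κ t y :=
  regDensity_pos h.ε_pos h.ε_le (by linarith [h.two_le]) h.δ_pos h.δ_lt h.deriv_le h.drift_le κ hκ
    ht y

lemma IsAdmissible.zero_lt_regDensity (h : IsAdmissible ε R δ α D)
    (hκ : D * κ.real {x | R - 1 ≤ |x|} ≤ δ / 16) (ht : t ∈ Icc (0 : ℝ) 1) (y : ℝ) :
    0 < regDensity ε R δ α κ t y := by
  have := h.R_pos
  have := h.δ_pos
  exact lt_trans (by positivity) (h.lt_regDensity hκ ht y)

lemma IsAdmissible.continuous_regDensity (h : IsAdmissible ε R δ α D) :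
    Continuous (regDensity ε R δ α κ t) :=
  (contDiff_regDensity h.ε_pos R δ α κ t).continuous

lemma IsAdmissible.isProbabilityMeasure_regMeasure (h : IsAdmissible ε R δ α D)
    (hκ : D * κ.real {x | R - 1 ≤ |x|} ≤ δ / 16) (ht : t ∈ Icc (0 : ℝ) 1) :
    IsProbabilityMeasure (regMeasure ε R δ α κ t) := ⟨by
  rw [regMeasure, withDensity_apply _ MeasurableSet.univ, Measure.restrict_univ,
    ← ofReal_integral_eq_lintegral_ofReal h.continuous_regDensity.continuousOn.integrableOn_Icc
      (ae_of_all _ fun y => (h.zero_lt_regDensity hκ ht y).le),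
    integral_regDensity h.ε_pos (by linarith [h.two_le]), ENNReal.ofReal_one]⟩

lemma IsAdmissible.support_regMeasure (h : IsAdmissible ε R δ α D)
    (hκ : D * κ.real {x | R - 1 ≤ |x|} ≤ δ / 16) (ht : t ∈ Icc (0 : ℝ) 1) :
    (regMeasure ε R δ α κ t).support = Icc (-(2 * R)) (2 * R) := by
  have hm : Measurable fun y => ENNReal.ofReal (regDensity ε R δ α κ t y) :=
    h.continuous_regDensity.measurable.ennreal_ofReal
  refine support_eq_Icc (by linarith [h.R_pos]) (fun a b hab hsub h0 => ?_) ?_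
  · rw [regMeasure, withDensity_apply_eq_zero hm] at h0
    have hset : {y | ENNReal.ofReal (regDensity ε R δ α κ t y) ≠ 0} ∩ Ioo a b = Ioo a b := by
      refine inter_eq_right.2 fun y _ => ?_
      simpa using h.zero_lt_regDensity hκ ht y
    rw [hset, Measure.restrict_apply measurableSet_Ioo,
      inter_eq_left.2 (hsub.trans Ioo_subset_Icc_self), Real.volume_Ioo] at h0
    simp only [ENNReal.ofReal_eq_zero, tsub_le_iff_right, zero_add] at h0
    linarith
  · rw [regMeasure, withDensity_apply_eq_zero hm]
    exact measure_mono_null inter_subset_right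
      (by rw [Measure.restrict_apply measurableSet_Icc.compl]; simp)

/-- The shape required by `rpow_mul_wasserstein_le`: the locally transported part plus a remainder
on the window, nonnegative by `le_regDensity`. -/
lemma IsAdmissible.regMeasure_eq_add (h : IsAdmissible ε R δ α D)
    (hκ : D * κ.real {x | R - 1 ≤ |x|} ≤ δ / 16) (ht : t ∈ Icc (0 : ℝ) 1) :
    regMeasure ε R δ α κ t = volume.withDensity (fun z =>
      ENNReal.ofReal ((1 - δ) * cutoff R z * convMeasure (mollifier ε) κ z)
        + (Icc (-(2 * R)) (2 * R)).indicator (fun z => ENNReal.ofReal (regDensity ε R δ α κ t z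
          - (1 - δ) * cutoff R z * convMeasure (mollifier ε) κ z)) z) := by
  rw [regMeasure_eq_withDensity_indicator]
  congr 1
  funext z
  have hR := h.R_pos
  by_cases hz : z ∈ Icc (-(2 * R)) (2 * R)
  · have h1 := le_regDensity h.ε_pos h.ε_le (by linarith [h.two_le]) h.δ_pos h.δ_lt h.deriv_le
      h.drift_le κ hκ ht z
    have h2 : 0 ≤ δ / (8 * R) := by have := h.δ_pos; positivity
    have h3 : 0 ≤ (1 - δ) * cutoff R z * convMeasure (mollifier ε) κ z :=
      mul_nonneg (mul_nonneg (by linarith [h.δ_lt]) (cutoff_nonneg _ _))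
        (convMeasure_mollifier_nonneg h.ε_pos _ _)
    rw [indicator_of_mem hz, indicator_of_mem hz, ← ENNReal.ofReal_add h3 (by linarith)]
    congr 1
    ring
  · have : 2 * R ≤ |z| := by
      by_contra! h; exact hz ⟨(abs_lt.1 h).1.le, (abs_lt.1 h).2.le⟩
    rw [indicator_of_notMem hz, indicator_of_notMem hz, cutoff_eq_zero hR this]
    simp

/-- The extra cost E is paid only on the window of length 4R; outside it density and flux both
vanish. -/
lemma IsAdmissible.action_regMeasure_le (h : IsAdmissible ε R δ α D) (hp : 1 < p) (hM : 0 ≤ M)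
    (hm : IsMobility M m) (hκ : D * κ.real {x | R - 1 ≤ |x|} ≤ δ / 16) (ht : t ∈ Icc (0 : ℝ) 1)
    (hκM : ∀ y, convMeasure (mollifier ε) κ y ≤ M) (hRM : 3 / (8 * R) ≤ M) {E : ℝ≥0∞}
    (hE : ∀ s ∈ Icc (δ / (8 * R)) (3 / (8 * R)), ∀ τ, |τ| ≤ |α| / δ → actionDensity p M m s τ ≤ E)
    (ν : SignedMeasure ℝ) :
    action p M m (regMeasure ε R δ α κ t) (volume.withDensityᵥ (regFlux ε R δ α ν))
      ≤ (∫⁻ y, actionDensity p M m (convMeasure (mollifier ε) κ y) (convSigned (mollifier ε) ν y))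
        + ENNReal.ofReal (4 * R) * E := by
  have hR := h.R_pos
  have hi := integrable_regFlux (δ := δ) (α := α) h.ε_pos hR ν
  have hm1 : Measurable ((Icc (-(2 * R)) (2 * R)).indicator
      fun y => ENNReal.ofReal (regDensity ε R δ α κ t y)) :=
    (h.continuous_regDensity.measurable.ennreal_ofReal).indicator measurableSet_Icc
  have hac1 : regMeasure ε R δ α κ t ≪ volume := by
    rw [regMeasure_eq_withDensity_indicator]; exact withDensity_absolutelyContinuous _ _
  have hac2 : SignedMeasure.totalVariation (volume.withDensityᵥ (regFlux ε R δ α ν)) ≪ volume := by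
    rw [totalVariation_withDensity hi]; exact withDensity_absolutelyContinuous _ _
  have hr1 : (regMeasure ε R δ α κ t).rnDeriv volume =ᵐ[volume]
      (Icc (-(2 * R)) (2 * R)).indicator fun y => ENNReal.ofReal (regDensity ε R δ α κ t y) := by
    rw [regMeasure_eq_withDensity_indicator]
    exact Measure.rnDeriv_withDensity _ hm1
  have hr2 : SignedMeasure.rnDeriv (volume.withDensityᵥ (regFlux ε R δ α ν)) volume
      =ᵐ[volume] regFlux ε R δ α ν := by
    refine (Integrable.ae_eq_of_withDensityᵥ_eq (SignedMeasure.integrable_rnDeriv _ _) hi ?_)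
    exact withDensity_rnDeriv_of_totalVariation hac2
  rw [action, if_pos ⟨hac1, hac2⟩]
  calc _ ≤ ∫⁻ y, (actionDensity p M m (convMeasure (mollifier ε) κ y)
            (convSigned (mollifier ε) ν y) + (Icc (-(2 * R)) (2 * R)).indicator (fun _ => E) y) := by
        refine lintegral_mono_ae ?_
        filter_upwards [hr1, hr2] with y h1 h2
        rw [h1, h2]
        by_cases hy : y ∈ Icc (-(2 * R)) (2 * R)
        · rw [indicator_of_mem hy, indicator_of_mem hy,
            ENNReal.toReal_ofReal (h.zero_lt_regDensity hκ ht y).le]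
          exact actionDensity_reg_le hp hM hm h.ε_pos h.ε_le (by linarith [h.two_le]) h.δ_pos h.δ_lt
            h.deriv_le h.drift_le κ hκ ht (hκM y) hRM ν hE
        · rw [indicator_of_notMem hy, regFlux_eq_zero hR ν hy, ENNReal.toReal_zero,
            actionDensity_zero_flux hp ⟨le_rfl, hM⟩]
          exact bot_le
    _ = _ := by
        rw [lintegral_add_right _ (measurable_const.indicator measurableSet_Icc),
          lintegral_indicator measurableSet_Icc, setLIntegral_const, Real.volume_Icc, mul_comm E]
        congr 3; ring

end

/-- A signed measure whose continuous density vanishes outside `[-c, c]` and at no rational point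
inside has support `[-c, c]`. -/
lemma support_totalVariation_withDensity {f : ℝ → ℝ} (hf : Continuous f) (hi : Integrable f)
    {c : ℝ} (hc : 0 < c) (h0 : ∀ y, y ∉ Icc (-c) c → f y = 0)
    (hne : ∀ q : ℚ, |(q : ℝ)| < c → f q ≠ 0) :
    (SignedMeasure.totalVariation (volume.withDensityᵥ f)).support = Icc (-c) c := by
  have hm : Measurable fun y => ‖f y‖ₑ := hf.measurable.enorm
  rw [totalVariation_withDensity hi]
  refine support_eq_Icc hc (fun a b hab hsub hz => ?_) ?_
  · rw [withDensity_apply_eq_zero hm] at hz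
    -- Nonvanishing at one rational point spreads by continuity to an open set of positive measure
    -- in the interval.
    obtain ⟨q, hqa, hqb⟩ := exists_rat_btwn hab
    have hq : |(q : ℝ)| < c := abs_lt.2 (hsub ⟨hqa, hqb⟩)
    have hopen : IsOpen ({y | ‖f y‖ₑ ≠ 0} ∩ Ioo a b) := by
      have : {y | ‖f y‖ₑ ≠ 0} = f ⁻¹' {0}ᶜ := by ext y; simp
      rw [this]
      exact (isOpen_compl_singleton.preimage hf).inter isOpen_Ioo
    exact (hopen.measure_pos volume ⟨q, by simpa using hne q hq, hqa, hqb⟩).ne' hz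
  · rw [withDensity_apply_eq_zero hm]
    convert measure_empty (μ := (volume : Measure ℝ)) using 2
    ext y
    simp only [mem_inter_iff, mem_ofPred_eq, mem_compl_iff, mem_empty_iff_false, iff_false]
    rintro ⟨h1, h2⟩
    exact h1 (by rw [h0 y h2]; simp)

lemma withDensityᵥ_restrict_Icc {f : ℝ → ℝ} (hi : Integrable f) {c : ℝ}
    (h0 : ∀ y, y ∉ Icc (-c) c → f y = 0) :
    volume.withDensityᵥ f = (volume.restrict (Icc (-c) c)).withDensityᵥ f := by
  ext s hs
  rw [withDensityᵥ_apply hi hs, withDensityᵥ_apply hi.integrableOn hs,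
    Measure.restrict_restrict hs, ← setIntegral_indicator measurableSet_Icc]
  congr 1
  funext y
  by_cases hy : y ∈ Icc (-c) c
  · rw [indicator_of_mem hy]
  · rw [indicator_of_notMem hy, h0 y hy]

end

/-! ### The continuity equation for the regularized curve -/

section

variable {μ : ℝ → Measure ℝ} {ν : ℝ → SignedMeasure ℝ} {ε R δ α D : ℝ}

/-- The spatial derivative of `regFlux`. -/
def regFluxDeriv (ε R δ α : ℝ) (ν : SignedMeasure ℝ) (y : ℝ) : ℝ :=
  deriv (cutoff R) y * ((1 - δ) * convSigned (mollifier ε) ν y - α)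
    + cutoff R y * ((1 - δ) * convSigned (deriv (mollifier ε)) ν y)

lemma hasDerivAt_regFlux (hε : 0 < ε) (R δ α : ℝ) (ν : SignedMeasure ℝ) (y : ℝ) :
    HasDerivAt (regFlux ε R δ α ν) (regFluxDeriv ε R δ α ν y) y := by
  obtain ⟨C, hC0, hC, hC'⟩ := exists_mollifier_bound hε
  exact (hasDerivAt_cutoff R y).mul (((hasDerivAt_convSigned ν (hasDerivAt_mollifier ε)
    (continuous_deriv_mollifier ε).measurable hC hC' y).const_mul (1 - δ)).sub_const α)

lemma measurable_regFlux (hν : ∀ A, MeasurableSet A → Measurable fun t => ν t A) (hε : 0 < ε)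
    (R δ α : ℝ) : Measurable fun z : ℝ × ℝ => regFlux ε R δ α (ν z.1) z.2 := by
  have h1 := measurable_convSigned_uncurry hν (continuous_mollifier ε)
    (hasCompactSupport_mollifier hε)
  have h2 : Measurable fun z : ℝ × ℝ => cutoff R z.2 :=
    (continuous_cutoff R).measurable.comp measurable_snd
  exact h2.mul ((h1.const_mul _).sub_const _)

lemma IsIntegratedCE.isCE_reg (h : IsIntegratedCE μ ν) (ha : IsAdmissible ε R δ α D)
    (hμ : ∀ t ∈ Icc (0 : ℝ) 1, D * (μ t).real {x | R - 1 ≤ |x|} ≤ δ / 16)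
    {μ' : ℝ → ProbabilityMeasure ℝ} {ν' : ℝ → SignedMeasure ℝ} {G : Set ℝ}
    (hμ' : ∀ t ∈ Icc (0 : ℝ) 1, (μ' t : Measure ℝ) = regMeasure ε R δ α (μ t) t)
    (hνG : ∀ t ∈ G, ν' t = volume.withDensityᵥ (regFlux ε R δ α (ν t)))
    (hν0 : ∀ t ∉ G, ν' t = 0) (hGm : MeasurableSet G)
    (hG : ∀ᵐ t, t ∈ Ioo (0 : ℝ) 1 → t ∈ G) : IsCE μ' ν' := by
  have hε := ha.ε_pos
  have hR := ha.R_pos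
  have hδ := ha.δ_pos
  have hδ1 := ha.δ_lt
  obtain ⟨C, hC0, hC, hC'⟩ := exists_mollifier_bound hε
  have hcs := hasCompactSupport_mollifier hε
  have hcd := hcs.deriv
  have hkc := continuous_mollifier ε
  have hkc' := continuous_deriv_mollifier ε
  have hprob := h.prob
  have hwm : Measurable fun z : ℝ × ℝ => cutoff R z.2 :=
    (continuous_cutoff R).measurable.comp measurable_snd
  have hwm' : Measurable fun z : ℝ × ℝ => deriv (cutoff R) z.2 :=
    (contDiff_deriv_cutoff R).continuous.measurable.comp measurable_snd
  have hfm := measurable_convSigned_uncurry (T := ℝ) h.measurable hkc hcs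
  have hfm' := measurable_convSigned_uncurry (T := ℝ) h.measurable hkc' hcd
  have hflux : ∀ y, IntegrableOn (fun r => convSigned (mollifier ε) (ν r) y) (Ioo 0 1) := fun y =>
    integrableOn_vint h.measurable h.mass_lt_top (hkc.measurable.comp (by fun_prop))
      fun x => hC _
  have hflux' : ∀ y, IntegrableOn (fun r => convSigned (deriv (mollifier ε)) (ν r) y) (Ioo 0 1) :=
    fun y => integrableOn_vint h.measurable h.mass_lt_top (hkc'.measurable.comp (by fun_prop))
      fun x => hC' _
  have hii : ∀ {f : ℝ → ℝ} {t : ℝ}, t ∈ Icc (0 : ℝ) 1 → IntegrableOn f (Ioo 0 1) →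
      IntervalIntegrable f volume 0 t := fun ht hf => by
    rw [intervalIntegrable_iff_integrableOn_Ioo_of_le ht.1]
    exact hf.mono_set (Ioo_subset_Ioo_right ht.2)
  -- A majorant of the factors in the flux and its derivative, uniform in space and integrable in
  -- time as the flux has finite mass.
  set X : ℝ → ℝ≥0∞ := fun t => ENNReal.ofReal C * (ν t).totalVariation univ + ENNReal.ofReal |α|
    with hX
  have hf1 : ∀ t y, ‖(1 - δ) * convSigned (mollifier ε) (ν t) y - α‖ₑ ≤ X t := by
    intro t y
    refine (enorm_sub_le).trans (add_le_add ?_ ?_)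
    · refine le_trans ?_ (enorm_convSigned_le (ν t) hC y)
      rw [enorm_mul]
      refine mul_le_of_le_one_left bot_le ?_
      rw [← ofReal_norm, ENNReal.ofReal_le_one, Real.norm_eq_abs, abs_of_nonneg (by linarith)]
      linarith
    · rw [← ofReal_norm, Real.norm_eq_abs]
  have hf2 : ∀ t y, ‖(1 - δ) * convSigned (deriv (mollifier ε)) (ν t) y‖ₑ ≤ X t := by
    intro t y
    refine le_trans ?_ ((enorm_convSigned_le (ν t) hC' y).trans le_self_add)
    rw [enorm_mul]
    refine mul_le_of_le_one_left bot_le ?_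
    rw [← ofReal_norm, ENNReal.ofReal_le_one, Real.norm_eq_abs, abs_of_nonneg (by linarith)]
    linarith
  have hw : ∀ y, ‖cutoff R y‖ₑ ≤ 1 := fun y => by
    rw [← ofReal_norm, ENNReal.ofReal_le_one, Real.norm_eq_abs, abs_of_nonneg (cutoff_nonneg _ _)]
    exact cutoff_le_one _ _
  have hw' : ∀ y, ‖deriv (cutoff R) y‖ₑ ≤ ENNReal.ofReal (D / R) := fun y => by
    rw [← ofReal_norm]; exact ENNReal.ofReal_le_ofReal (ha.deriv_le y)
  refine isCE_of_density (D := fun t => regDensity ε R δ α (μ t) t)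
    (J := fun t => regFlux ε R δ α (ν t)) (J' := fun t => regFluxDeriv ε R δ α (ν t))
    (c := 2 * R) (C := max (C + 1) (3 / (8 * R) + 1))
    (B := fun t => ENNReal.ofReal (D / R) * X t + X t)
    (fun y t ht => ?_) ?_ (fun t ht y => ?_) (fun t ht y => (ha.zero_lt_regDensity (hμ t ht) ht y).le)
    (fun t y => hasDerivAt_regFlux hε R δ α (ν t) y) (fun t => ?_)
    (measurable_regFlux h.measurable hε R δ α) ?_ (fun t y => ?_) (fun t y => ?_) ?_
    (fun t y hy => regFlux_eq_zero hR (ν t) hy) (fun t y hy => ?_) hμ' hνG hν0 hGm hG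
  -- ∂_y (χ j_ε) = χ ∂_y j_ε + χ' j_ε: the first term is balanced by χ ρ_ε through e1, the second by
  -- χ' F_ε through e2. The drift term t α χ' is balanced by the flux -α χ.
  · have e1 := h.conv_sub_eq (hasDerivAt_mollifier ε) hkc' hcd hC y ht
    have e2 := h.conv_sub_eq (hasDerivAt_smoothStep ε) hkc hcs (abs_smoothStep_le ε) y ht
    have e3 : ∫ r in (0 : ℝ)..t, regFluxDeriv ε R δ α (ν r) y
        = deriv (cutoff R) y * ((1 - δ) * (∫ r in (0 : ℝ)..t, convSigned (mollifier ε) (ν r) y)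
            - t * α)
          + cutoff R y * ((1 - δ) * ∫ r in (0 : ℝ)..t, convSigned (deriv (mollifier ε)) (ν r) y) := by
      unfold regFluxDeriv
      rw [intervalIntegral.integral_add
          ((((hii ht (hflux y)).const_mul _).sub intervalIntegrable_const).const_mul _)
          (((hii ht (hflux' y)).const_mul _).const_mul _),
        intervalIntegral.integral_const_mul, intervalIntegral.integral_sub
          ((hii ht (hflux y)).const_mul _) intervalIntegrable_const,
        intervalIntegral.integral_const_mul, intervalIntegral.integral_const_mul,
        intervalIntegral.integral_const_mul, intervalIntegral.integral_const]
      simp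
    rw [e3]
    simp only [regDensity]
    linear_combination (1 - δ) * cutoff R y * e1 + (1 - δ) * deriv (cutoff R) y * e2
  · have h1 := h.measurable_convMeasure hkc hC
    have h2 := h.measurable_convMeasure (continuous_smoothStep ε) (abs_smoothStep_le ε)
    have h3 : Measurable fun z : ℝ × ℝ => smoothStep 1 z.2 :=
      (continuous_smoothStep 1).measurable.comp measurable_snd
    exact (((hwm.mul h1).add (hwm'.mul (h2.sub h3))).const_mul _).add
      (measurable_const.add ((measurable_fst.const_mul α).mul hwm'))
  · rw [abs_of_pos (ha.zero_lt_regDensity (hμ t ht) ht y)]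
    -- Only some finite bound is needed here, so the supremum C of the kernel bounds the mollified
    -- density.
    refine (regDensity_lt hε ha.ε_le (by linarith [ha.two_le]) hδ hδ1 ha.deriv_le ha.drift_le
      (μ t) (hμ t ht) ht (A := C) ?_ ?_ ?_).le
    · have := norm_integral_le_of_norm_le_const (μ := μ t) (f := fun x => mollifier ε (y - x))
        (ae_of_all _ fun x => hC (y - x))
      rw [probReal_univ, mul_one] at this
      exact (le_abs_self _).trans this
    · exact lt_of_lt_of_le (by linarith) (le_max_left _ _)
    · exact lt_of_lt_of_le (by linarith) (le_max_right _ _)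
  · have h1 := (contDiff_convSigned (ν t) (n := 0) (contDiff_mollifier ε) hcs).continuous
    have h2 := (contDiff_convSigned (ν t) (n := 0) (contDiff_zero.2 hkc') hcd).continuous
    have h3 := continuous_cutoff R
    have h4 := (contDiff_deriv_cutoff R).continuous
    unfold regFluxDeriv
    fun_prop
  · exact (hwm'.mul ((hfm.const_mul _).sub_const _)).add (hwm.mul (hfm'.const_mul _))
  · rw [regFlux, enorm_mul]
    exact ((mul_le_of_le_one_left bot_le (hw y)).trans (hf1 t y)).trans le_add_self
  · refine (enorm_add_le _ _).trans (add_le_add ?_ ?_)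
    · rw [enorm_mul]
      exact mul_le_mul' (hw' y) (hf1 t y)
    · rw [enorm_mul]
      exact (mul_le_of_le_one_left bot_le (hw y)).trans (hf2 t y)
  · have hXf : ∫⁻ t in Ioo (0 : ℝ) 1, X t < ⊤ := by
      rw [hX, lintegral_add_right _ measurable_const,
        lintegral_const_mul' _ _ ENNReal.ofReal_ne_top]
      refine ENNReal.add_lt_top.2 ⟨ENNReal.mul_lt_top ENNReal.ofReal_lt_top h.mass_lt_top, ?_⟩
      simp
    have e : ∀ t, ENNReal.ofReal (D / R) * X t + X t = (ENNReal.ofReal (D / R) + 1) * X t :=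
      fun t => by ring
    simp_rw [e]
    rw [lintegral_const_mul' _ _ (by simp)]
    exact ENNReal.mul_lt_top (by simp) hXf
  · have hy' : 2 * R ≤ |y| := by
      by_contra! h; exact hy ⟨(abs_lt.1 h).1.le, (abs_lt.1 h).2.le⟩
    simp [regFluxDeriv, cutoff_eq_zero hR hy', deriv_cutoff_eq_zero_of_ge hR hy']

end

section

variable {μ : ℝ → Measure ℝ} {ν : ℝ → SignedMeasure ℝ} {p M : ℝ} {m : ℝ → ℝ} {ε R δ α D : ℝ}

/-! ### The choice of the drift -/

/-- An interior point is a convex combination of x₀, with positive weight, and of 0 or M, where m ≥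
0. -/
lemma IsMobility.pos_of_pos (hm : IsMobility M m) {x₀ : ℝ} (hx₀ : x₀ ∈ Icc 0 M) (h : 0 < m x₀)
    {x : ℝ} (hx : x ∈ Ioo 0 M) : 0 < m x := by
  have hx0 : 0 < x₀ := hx₀.1.lt_of_ne fun h0 => by rw [← h0, hm.map_zero] at h; exact h.false
  have hM : 0 ≤ M := hx₀.1.trans hx₀.2
  rcases le_or_gt x x₀ with hle | hlt
  · have := hm.concaveOn.2 hx₀ (⟨le_rfl, hM⟩ : (0 : ℝ) ∈ Icc 0 M)
      (div_nonneg hx.1.le hx0.le : 0 ≤ x / x₀) (sub_nonneg.2 ((div_le_one hx0).2 hle)) (by ring)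
    simp only [smul_eq_mul, hm.map_zero, mul_zero, add_zero, div_mul_cancel₀ _ hx0.ne'] at this
    exact lt_of_lt_of_le (mul_pos (div_pos hx.1 hx0) h) this
  · have hd : 0 < M - x₀ := by linarith [hx.2]
    have e : (M - x) / (M - x₀) * x₀ + (1 - (M - x) / (M - x₀)) * M = x := by
      field_simp; ring
    have := hm.concaveOn.2 hx₀ (⟨hM, le_rfl⟩ : M ∈ Icc 0 M)
      (div_nonneg (by linarith [hx.2]) hd.le : 0 ≤ (M - x) / (M - x₀))
      (sub_nonneg.2 ((div_le_one hd).2 (by linarith)) : 0 ≤ 1 - (M - x) / (M - x₀)) (by ring)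
    simp only [smul_eq_mul, e] at this
    refine lt_of_lt_of_le ?_ this
    have h1 : 0 < (M - x) / (M - x₀) * m x₀ := mul_pos (div_pos (by linarith [hx.2]) hd) h
    have h2 : 0 ≤ (1 - (M - x) / (M - x₀)) * m M :=
      mul_nonneg (sub_nonneg.2 ((div_le_one hd).2 (by linarith))) (hm.nonneg M ⟨hM, le_rfl⟩)
    linarith

/-- On a compact interval of densities on which the mobility is positive, small fluxes have small
action density. -/
lemma exists_small_action (hp : 1 < p) (hm : IsMobility M m) {a b : ℝ} (ha : 0 < a) (hbM : b < M)
    (hab : a ≤ b) (hpos : ∀ s ∈ Icc a b, 0 < m s) {e : ℝ} (he : 0 < e) :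
    ∃ τ₀ : ℝ, 0 < τ₀ ∧ ∀ s ∈ Icc a b, ∀ τ, |τ| ≤ τ₀ → actionDensity p M m s τ ≤ ENNReal.ofReal e := by
  have hp0 : 0 < p := by linarith
  obtain ⟨s₀, hs₀, hmin⟩ := isCompact_Icc.exists_isMinOn (nonempty_Icc.2 hab)
    (hm.continuousOn.mono fun s (hs : s ∈ Icc a b) => ⟨ha.le.trans hs.1, hs.2.trans hbM.le⟩)
  have h0 := hpos s₀ hs₀
  -- The flux of action density e at the density s₀ where m is smallest on the interval.
  refine ⟨(e * m s₀ ^ (p - 1)) ^ (1 / p), by positivity, fun s hs τ hτ => ?_⟩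
  have h1 : ¬(s < 0 ∨ M < s) := by
    rw [not_or, not_lt, not_lt]
    exact ⟨ha.le.trans hs.1, hs.2.trans hbM.le⟩
  have hs0 := hpos s hs
  rw [actionDensity, if_neg h1, if_pos hs0]
  apply ENNReal.ofReal_le_ofReal
  rw [div_le_iff₀ (by positivity)]
  calc |τ| ^ p ≤ ((e * m s₀ ^ (p - 1)) ^ (1 / p)) ^ p := by gcongr
    _ = e * m s₀ ^ (p - 1) := by
        rw [← Real.rpow_mul (by positivity), one_div_mul_cancel hp0.ne', Real.rpow_one]
    _ ≤ e * m s ^ (p - 1) :=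
        mul_le_mul_of_nonneg_left (Real.rpow_le_rpow h0.le (hmin hs) (by linarith)) he.le

/-- A drift avoiding the atoms of countably many functions of time. -/
lemma exists_drift_forall_ae_ne {g : ℚ → ℝ → ℝ} (hg : ∀ q, Measurable (g q)) {α₀ : ℝ}
    (hα₀ : 0 < α₀) : ∃ α ∈ Ioo 0 α₀, ∀ᵐ t, ∀ q, g q t ≠ α := by
  -- The level sets of one function are disjoint, so only countably many have positive measure, and
  -- countably many functions are considered.
  have hc : (⋃ q, {α : ℝ | 0 < volume {t : ℝ | g q t = α}}).Countable :=
    countable_iUnion fun q => Measure.countable_meas_level_set_pos (hg q)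
  obtain ⟨α, hα1, hα2⟩ := (hc.dense_compl ℝ).exists_mem_open isOpen_Ioo (nonempty_Ioo.2 hα₀)
  refine ⟨α, hα2, ae_all_iff.2 fun q => ?_⟩
  have : volume {t : ℝ | g q t = α} = 0 := by
    by_contra h
    exact hα1 (mem_iUnion.2 ⟨q, pos_iff_ne_zero.2 h⟩)
  rw [ae_iff]
  simpa using this

/-- The times at which the regularized flux either vanishes or is not locally zero. -/
def goodTimes (ε R δ α : ℝ) (ν : ℝ → SignedMeasure ℝ) : Set ℝ :=
  {t | (∀ q : ℚ, regFlux ε R δ α (ν t) q = 0)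
    ∨ ∀ q : ℚ, |(q : ℝ)| < 2 * R → regFlux ε R δ α (ν t) q ≠ 0}

lemma measurableSet_goodTimes (hν : ∀ A, MeasurableSet A → Measurable fun t => ν t A) (hε : 0 < ε)
    (R δ α : ℝ) : MeasurableSet (goodTimes ε R δ α ν) := by
  have h : ∀ q : ℚ, MeasurableSet {t | regFlux ε R δ α (ν t) q = 0} := fun q =>
    ((measurable_regFlux hν hε R δ α).comp
      (measurable_id.prodMk measurable_const)) (measurableSet_singleton 0)
  have e : goodTimes ε R δ α ν = (⋂ q : ℚ, {t | regFlux ε R δ α (ν t) q = 0})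
      ∪ ⋂ q : ℚ, {t | |(q : ℝ)| < 2 * R → regFlux ε R δ α (ν t) q ≠ 0} := by
    ext t; simp [goodTimes]
  rw [e]
  exact (MeasurableSet.iInter h).union (MeasurableSet.iInter fun q =>
    (MeasurableSet.const _).imp (h q).compl)

/-- A suitable drift: its cost is small and almost all times are good. -/
lemma IsIntegratedCE.exists_drift (h : IsIntegratedCE μ ν) (hp : 1 < p)
    (hm : IsMobility M m) (hε : 0 < ε) (hR : 0 < R) (hδ : 0 < δ) (hδ1 : δ < 1) (hD : 0 < D)
    (hRM : 3 / (8 * R) < M)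
    (hA : ∫⁻ t in Ioo (0 : ℝ) 1, ∫⁻ y, actionDensity p M m (convMeasure (mollifier ε) (μ t) y)
      (convSigned (mollifier ε) (ν t) y) < ⊤) {η : ℝ} (hη : 0 < η) :
    ∃ (α : ℝ) (E : ℝ≥0∞), D * |α| ≤ δ / 16 ∧
      (∀ s ∈ Icc (δ / (8 * R)) (3 / (8 * R)), ∀ τ, |τ| ≤ |α| / δ → actionDensity p M m s τ ≤ E) ∧
      ENNReal.ofReal (4 * R) * E ≤ ENNReal.ofReal η ∧
      ∀ᵐ t, t ∈ Ioo (0 : ℝ) 1 → t ∈ goodTimes ε R δ α ν := by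
  have hM : 0 < M := lt_trans (by positivity) hRM
  have hfm := measurable_convSigned_uncurry (T := ℝ) h.measurable (continuous_mollifier ε)
    (hasCompactSupport_mollifier hε)
  by_cases hpos : ∃ x₀ ∈ Icc 0 M, 0 < m x₀
  · obtain ⟨x₀, hx₀, hmx₀⟩ := hpos
    obtain ⟨τ₀, hτ₀, hτ⟩ := exists_small_action hp hm (a := δ / (8 * R)) (b := 3 / (8 * R))
      (by positivity) hRM (by gcongr; linarith)
      (fun s hs => hm.pos_of_pos hx₀ hmx₀
        ⟨lt_of_lt_of_le (by positivity) hs.1, hs.2.trans_lt hRM⟩)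
      (show 0 < η / (4 * R) by positivity)
    obtain ⟨α, hα, hαt⟩ := exists_drift_forall_ae_ne
      (g := fun q t => (1 - δ) * convSigned (mollifier ε) (ν t) q)
      (fun q => (hfm.comp (measurable_id.prodMk measurable_const)).const_mul _)
      -- The first bound gives α/δ ≤ τ₀, the second D α ≤ δ/16.
      (show 0 < min (τ₀ * δ) (δ / 16 / D) by positivity)
    have hα1 := hα.2.le.trans (min_le_left _ _)
    have hα2 := hα.2.le.trans (min_le_right _ _)
    refine ⟨α, ENNReal.ofReal (η / (4 * R)), ?_, fun s hs τ hτ' => hτ s hs τ ?_, ?_, ?_⟩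
    · rw [abs_of_pos hα.1, mul_comm]
      exact (le_div_iff₀ hD).1 hα2
    · rw [abs_of_pos hα.1] at hτ'
      exact hτ'.trans ((div_le_iff₀ hδ).2 hα1)
    · rw [← ENNReal.ofReal_mul (by positivity), mul_div_cancel₀ _ (by positivity)]
    · filter_upwards [hαt] with t ht _
      exact Or.inr fun q hq => mul_ne_zero (cutoff_pos hR hq).ne' (sub_ne_zero.2 (ht q))
  -- The mobility vanishes on [0, M], so no nonzero flux has finite action. No drift is allowed, and
  -- none is needed: j_ε is zero at almost every time.
  · push Not at hpos
    refine ⟨0, 0, by rw [abs_zero, mul_zero]; positivity, fun s hs τ hτ => ?_, by simp, ?_⟩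
    · have hτ0 : τ = 0 := by simpa using hτ
      rw [hτ0, actionDensity_zero_flux hp ⟨le_trans (by positivity) hs.1, hs.2.trans hRM.le⟩]
    · have hAm := h.measurable_actionDensity_conv (p := p) hM.le hm hε
      have hae := ae_lt_top hAm.lintegral_prod_right' hA.ne
      rw [ae_restrict_iff' measurableSet_Ioo] at hae
      filter_upwards [hae] with t ht ht'
      have h1 := ae_lt_top (hAm.comp (measurable_const.prodMk measurable_id) :
        Measurable fun y => actionDensity p M m (convMeasure (mollifier ε) (μ t) y)
          (convSigned (mollifier ε) (ν t) y)) (ht ht').ne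
      have h2 : ∀ᵐ y, convSigned (mollifier ε) (ν t) y = 0 := by
        filter_upwards [h1] with y hy
        by_contra hne
        have hmem : convMeasure (mollifier ε) (μ t) y ∈ Icc 0 M :=
          mem_Icc_of_actionDensity_ne_top hy.ne
        have : actionDensity p M m (convMeasure (mollifier ε) (μ t) y)
            (convSigned (mollifier ε) (ν t) y) = ⊤ := by
          rw [actionDensity, if_neg (by rw [not_or, not_lt, not_lt]; exact hmem),
            if_neg (not_lt.2 (hpos _ hmem)), if_neg hne]
        exact hy.ne this
      have hcont := (contDiff_convSigned (ν t) (n := 0) (contDiff_mollifier ε)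
        (hasCompactSupport_mollifier hε)).continuous
      have h3 := Measure.eq_of_ae_eq h2 hcont continuous_const
      refine Or.inl fun q => ?_
      have := congrFun h3 q
      simp [regFlux, this]

end

/-! ### Tail estimates and regularity of the constructed curve -/

section

variable {p M : ℝ} {m : ℝ → ℝ} {ε R δ α D : ℝ}

lemma convMeasure_mollifier_le (hε : 0 < ε) {κ : Measure ℝ} [IsProbabilityMeasure κ]
    (hac : κ ≪ volume) {A : ℝ} (hA0 : 0 ≤ A) (hA : ∀ᵐ x, κ.rnDeriv volume x ≤ ENNReal.ofReal A)
    (y : ℝ) : convMeasure (mollifier ε) κ y ≤ A := by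
  have hk : Measurable fun x => ENNReal.ofReal (mollifier ε (y - x)) :=
    ((continuous_mollifier ε).measurable.comp (by fun_prop)).ennreal_ofReal
  rw [← ENNReal.ofReal_le_ofReal_iff hA0, ofReal_convMeasure_mollifier hε,
    ← lintegral_rnDeriv_mul hac hk.aemeasurable]
  calc ∫⁻ x, κ.rnDeriv volume x * ENNReal.ofReal (mollifier ε (y - x))
      ≤ ∫⁻ x, ENNReal.ofReal A * ENNReal.ofReal (mollifier ε (y - x)) := by
        refine lintegral_mono_ae ?_
        filter_upwards [hA] with x hx
        gcongr
    _ = ENNReal.ofReal A * 1 := by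
        rw [lintegral_const_mul' _ _ ENNReal.ofReal_ne_top]
        congr 1
        rw [← ofReal_integral_eq_lintegral_ofReal ((integrable_mollifier hε).comp_sub_left y)
          (ae_of_all _ fun x => mollifier_nonneg hε _),
          integral_sub_left_eq_self (mollifier ε) volume y, integral_mollifier hε]
        simp
    _ = _ := mul_one _

lemma lintegral_rpow_le_of_tail {κ : Measure ℝ} [IsProbabilityMeasure κ] (hp : 0 ≤ p) {r : ℝ}
    {θ : ℝ≥0∞} (h : ∫⁻ x in {x | r ≤ |x|}, ENNReal.ofReal (|x| ^ p) ∂κ ≤ θ) :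
    ∫⁻ x, ENNReal.ofReal (|x| ^ p) ∂κ ≤ θ + ENNReal.ofReal (r ^ p) := by
  have hS : MeasurableSet {x : ℝ | r ≤ |x|} := measurableSet_le measurable_const (by fun_prop)
  rw [← lintegral_add_compl _ hS]
  refine add_le_add h ?_
  calc _ ≤ ∫⁻ x in {x : ℝ | r ≤ |x|}ᶜ, ENNReal.ofReal (r ^ p) ∂κ := by
        refine setLIntegral_mono' hS.compl fun x hx => ?_
        have hx' : |x| < r := not_le.1 hx
        gcongr
    _ ≤ ENNReal.ofReal (r ^ p) := by
        rw [setLIntegral_const]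
        exact mul_le_of_le_one_right bot_le prob_le_one

/-- Markov's inequality for |x|^p; it makes the tail mass small compared with r^(-p), the order of
δ. -/
lemma rpow_mul_measureReal_tail_le {κ : Measure ℝ} [IsProbabilityMeasure κ] (hp : 0 ≤ p) {r τ : ℝ}
    (hr : 0 ≤ r) (hτ : 0 ≤ τ)
    (h : ∫⁻ x in {x | r ≤ |x|}, ENNReal.ofReal (|x| ^ p) ∂κ ≤ ENNReal.ofReal τ) :
    r ^ p * κ.real {x | r ≤ |x|} ≤ τ := by
  have hS : MeasurableSet {x : ℝ | r ≤ |x|} := measurableSet_le measurable_const (by fun_prop)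
  have h1 : ENNReal.ofReal (r ^ p) * κ {x | r ≤ |x|} ≤ ENNReal.ofReal τ := by
    rw [← setLIntegral_const]
    refine le_trans (setLIntegral_mono' hS fun x hx => ?_) h
    have hx' : r ≤ |x| := hx
    gcongr
  have h2 := ENNReal.toReal_mono ENNReal.ofReal_ne_top h1
  rwa [ENNReal.toReal_mul, ENNReal.toReal_ofReal (by positivity), ENNReal.toReal_ofReal hτ] at h2

lemma setLIntegral_compl_Icc_le {κ : Measure ℝ} (hp : 0 ≤ p) (hR : 1 ≤ R) {τ : ℝ≥0∞}
    (h : ∫⁻ x in {x | R - 1 ≤ |x|}, ENNReal.ofReal (|x| ^ p) ∂κ ≤ τ) :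
    ∫⁻ x in (Icc (-(2 * R)) (2 * R))ᶜ, ENNReal.ofReal (|x| ^ p + 1) ∂κ ≤ 2 * τ := by
  have hx2 : ∀ x ∈ (Icc (-(2 * R)) (2 * R))ᶜ, 2 * R ≤ |x| := fun x hx => by
    by_contra! h; exact hx ⟨(abs_lt.1 h).1.le, (abs_lt.1 h).2.le⟩
  calc _ ≤ ∫⁻ x in (Icc (-(2 * R)) (2 * R))ᶜ, 2 * ENNReal.ofReal (|x| ^ p) ∂κ := by
        refine setLIntegral_mono' measurableSet_Icc.compl fun x hx => ?_
        have h1 : 1 ≤ |x| ^ p := Real.one_le_rpow (by linarith [hx2 x hx]) hp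
        rw [← ENNReal.ofReal_ofNat 2, ← ENNReal.ofReal_mul (by norm_num)]
        exact ENNReal.ofReal_le_ofReal (by linarith)
    _ = 2 * ∫⁻ x in (Icc (-(2 * R)) (2 * R))ᶜ, ENNReal.ofReal (|x| ^ p) ∂κ :=
        lintegral_const_mul' _ _ (by norm_num)
    _ ≤ 2 * τ := by
        gcongr
        refine le_trans (lintegral_mono_set fun x hx => ?_) h
        have := hx2 x hx
        show R - 1 ≤ |x|
        linarith

lemma IsAdmissible.isRegularCurve {μ : ℝ → Measure ℝ} {ν : ℝ → SignedMeasure ℝ}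
    (ha : IsAdmissible ε R δ α D) [∀ t, IsProbabilityMeasure (μ t)]
    (hμ : ∀ t ∈ Icc (0 : ℝ) 1, D * (μ t).real {x | R - 1 ≤ |x|} ≤ δ / 16) {A B : ℝ}
    (hA : ∀ t ∈ Icc (0 : ℝ) 1, ∀ y, convMeasure (mollifier ε) (μ t) y ≤ A) (hAB : A < B)
    (hRB : 3 / (8 * R) < B) (hBM : B < M)
    {μ' : ℝ → ProbabilityMeasure ℝ} {ν' : ℝ → SignedMeasure ℝ}
    (hμ' : ∀ t ∈ Icc (0 : ℝ) 1, (μ' t : Measure ℝ) = regMeasure ε R δ α (μ t) t)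
    (hνG : ∀ t ∈ goodTimes ε R δ α ν, ν' t = volume.withDensityᵥ (regFlux ε R δ α (ν t)))
    (hν0 : ∀ t ∉ goodTimes ε R δ α ν, ν' t = 0) (hCE : IsCE μ' ν') :
    IsRegularCurve M (Icc (-(2 * R)) (2 * R)) (δ / (16 * R)) B μ' ν' := by
  have hR := ha.R_pos
  have hδ := ha.δ_pos
  have hsupp : ∀ t ∈ Icc (0 : ℝ) 1, (μ' t : Measure ℝ).support = Icc (-(2 * R)) (2 * R) :=
    fun t ht => by rw [hμ' t ht]; exact ha.support_regMeasure (hμ t ht) ht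
  -- At every time the flux is zero or has the whole window as support. In the first kind of good
  -- time it vanishes at all rationals, hence everywhere by continuity.
  have hflux : ∀ t, ν' t = 0 ∨ ((ν' t).totalVariation.support = Icc (-(2 * R)) (2 * R) ∧
      ν' t = volume.withDensityᵥ (regFlux ε R δ α (ν t))) := by
    intro t
    by_cases ht : t ∈ goodTimes ε R δ α ν
    · have hc := (contDiff_regFlux ha.ε_pos R δ α (ν t)).continuous
      rcases ht with h | h
      · left
        have h0 : regFlux ε R δ α (ν t) = 0 :=
          Rat.denseRange_cast.equalizer hc continuous_const (funext h)
        rw [hνG t (Or.inl h), h0, withDensityᵥ_zero]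
      · right
        have e := hνG t (Or.inr h)
        refine ⟨?_, e⟩
        rw [e]
        exact support_totalVariation_withDensity hc (integrable_regFlux ha.ε_pos hR _)
          (by linarith) (fun y hy => regFlux_eq_zero hR _ hy) h
    · exact Or.inl (hν0 t ht)
  have hz : (0 : SignedMeasure ℝ).totalVariation.support = ∅ := by
    rw [SignedMeasure.totalVariation_zero, Measure.support_zero]
  refine ⟨hCE, isCompact_Icc, by positivity, ?_, hBM, ?_, ?_, ?_, ?_, ?_, ?_, ?_, ?_⟩
  · refine le_trans ?_ hRB.le
    rw [div_le_div_iff₀ (by positivity) (by positivity)]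
    nlinarith [ha.δ_lt]
  · intro t ht; rw [hsupp t ht]; exact isCompact_Icc
  · intro t ht; rw [hsupp t ht]; exact isPreconnected_Icc
  · intro t ht; rw [hsupp t ht]
  · intro t _
    rcases hflux t with h | ⟨h, _⟩
    · rw [h, hz]; exact isCompact_empty
    · rw [h]; exact isCompact_Icc
  · intro t _
    rcases hflux t with h | ⟨h, _⟩
    · rw [h, hz]; exact isPreconnected_empty
    · rw [h]; exact isPreconnected_Icc
  · intro t _
    rcases hflux t with h | ⟨h, _⟩
    · rw [h, hz]; exact empty_subset _
    · rw [h]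
  · intro t ht
    refine ⟨regDensity ε R δ α (μ t) t, (contDiff_regDensity ha.ε_pos R δ α (μ t) t).contDiffOn,
      ?_, fun x _ => ⟨ha.lt_regDensity (hμ t ht) ht x, ?_⟩⟩
    · rw [hsupp t ht, hμ' t ht, regMeasure]
    · exact regDensity_lt ha.ε_pos ha.ε_le (by linarith [ha.two_le]) hδ ha.δ_lt ha.deriv_le
        ha.drift_le (μ t) (hμ t ht) ht (hA t ht x) hAB hRB
  · intro t _
    rcases hflux t with h | ⟨h, h'⟩
    · refine ⟨0, contDiffOn_const, ?_⟩
      rw [h, withDensityᵥ_zero]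
    · refine ⟨regFlux ε R δ α (ν t), (contDiff_regFlux ha.ε_pos R δ α (ν t)).contDiffOn, ?_⟩
      rw [h]
      conv_lhs => rw [h']
      exact withDensityᵥ_restrict_Icc (integrable_regFlux ha.ε_pos hR _)
        fun y hy => regFlux_eq_zero hR _ hy

end

section

variable {p M : ℝ} {m : ℝ → ℝ}

/-! ### The approximation theorem -/

/-- Parameters for which the regularization has small transport cost. -/
lemma exists_parameters (hp : 0 ≤ p) {D Mom B η : ℝ} (hD : 0 < D) (hMom : 0 ≤ Mom) (hB : 0 < B)
    (hη : 0 < η) : ∃ κ τ : ℝ, 0 < κ ∧ κ ≤ 1 / 2 ∧ 0 < τ ∧ 2 * τ ≤ η ∧ ∀ R₀ : ℝ, ∃ R ε : ℝ,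
      R₀ ≤ R - 1 ∧ 2 ≤ R ∧ 3 / (8 * R) < B ∧ 0 < ε ∧ ε ≤ 1 ∧
      0 < κ / (4 * R) ^ p ∧ κ / (4 * R) ^ p < 1 ∧
      (∀ x : ℝ, (R - 1) ^ p * x ≤ τ → D * x ≤ κ / (4 * R) ^ p / 16) ∧
      (4 * R) ^ p * ε + 2 ^ p * (κ / (4 * R) ^ p * (4 * R) ^ p * (2 + Mom)
        + 2 * 8 ^ p * τ) ≤ η := by
  -- κ, τ and ε each use at most a quarter of η in the final cost.
  set κ : ℝ := min (1 / 2) (η / (4 * 2 ^ p * (2 + Mom))) with hκ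
  have hκ0 : 0 < κ := by positivity
  have hκ1 : κ ≤ 1 / 2 := min_le_left _ _
  have hκ2 : κ * (4 * 2 ^ p * (2 + Mom)) ≤ η :=
    (le_div_iff₀ (by positivity)).1 (min_le_right _ _)
  -- The third bound makes the tail mass negligible against δ. None of them involves R: the radius
  -- R₀ is found only after τ is known.
  set τ : ℝ := min (η / 2) (min (η / (4 * 2 ^ p * (2 * 8 ^ p))) (κ / (16 * D * 8 ^ p))) with hτ
  have hτ0 : 0 < τ := by positivity
  have hτ1 : 2 * τ ≤ η := by
    have : τ ≤ η / 2 := min_le_left _ _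
    linarith
  have hτ2 : τ * (4 * 2 ^ p * (2 * 8 ^ p)) ≤ η :=
    (le_div_iff₀ (by positivity)).1 ((min_le_right _ _).trans (min_le_left _ _))
  have hτ3 : τ * (16 * D * 8 ^ p) ≤ κ :=
    (le_div_iff₀ (by positivity)).1 ((min_le_right _ _).trans (min_le_right _ _))
  refine ⟨κ, τ, hκ0, hκ1, hτ0, hτ1, fun R₀ => ?_⟩
  set R : ℝ := max (R₀ + 1) (max 2 (1 / B)) with hR
  have hR1 : R₀ + 1 ≤ R := le_max_left _ _
  have hR2 : 2 ≤ R := (le_max_left _ _).trans (le_max_right _ _)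
  have hR3 : 1 / B ≤ R := (le_max_right _ _).trans (le_max_right _ _)
  have hR0 : 0 < R := by linarith
  have hRB : 1 ≤ R * B := (div_le_iff₀ hB).1 hR3
  have hbig : 1 ≤ (4 * R) ^ p := Real.one_le_rpow (by linarith) hp
  set L := (4 * R) ^ p with hL
  have hL0 : 0 < L := by positivity
  refine ⟨R, min 1 (η / (4 * L)), by linarith, hR2, ?_, by positivity, min_le_left _ _,
    by positivity, ?_, fun x hx => ?_, ?_⟩
  · rw [div_lt_iff₀ (by positivity)]; nlinarith
  · rw [div_lt_one hL0]; linarith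
  -- 4R ≤ 8 (R - 1) since R ≥ 2, so the powers of 4R and of R - 1 cancel up to 8^p.
  · have h8 : L ≤ 8 ^ p * (R - 1) ^ p := by
      rw [hL, ← Real.mul_rpow (by norm_num) (by linarith)]
      exact Real.rpow_le_rpow (by linarith) (by linarith) hp
    rw [div_div, le_div_iff₀ (by positivity)]
    rcases le_or_gt x 0 with h | h
    · exact (mul_nonpos_of_nonpos_of_nonneg (mul_nonpos_of_nonneg_of_nonpos hD.le h)
        (by positivity)).trans hκ0.le
    calc D * x * (L * 16) ≤ D * x * (8 ^ p * (R - 1) ^ p * 16) := by gcongr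
      _ = (R - 1) ^ p * x * (16 * D * 8 ^ p) := by ring
      _ ≤ τ * (16 * D * 8 ^ p) := by gcongr
      _ ≤ κ := hτ3
  · have e1 : L * min 1 (η / (4 * L)) ≤ η / 4 := by
      calc L * min 1 (η / (4 * L)) ≤ L * (η / (4 * L)) := by gcongr; exact min_le_right _ _
        _ = η / 4 := by field_simp
    rw [div_mul_cancel₀ _ hL0.ne']
    linarith

/-- A curve of finite action is approximated by a regular curve. -/
theorem exists_regular_approximation (hM : 0 < M) {A B : ℝ} (hA0 : 0 ≤ A) (hAB : A < B)
    (hBM : B < M) (hp : 1 < p) (hm : IsMobility M m) (hθ : BoundedTheta M m)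
    {μ : ℝ → ProbabilityMeasure ℝ}
    (h0 : (∫⁻ x, ENNReal.ofReal (|x| ^ p) ∂(μ 0 : Measure ℝ)) < ⊤)
    (hac : ∀ t ∈ Icc (0 : ℝ) 1, (μ t : Measure ℝ) ≪ volume)
    (hA : ∀ t ∈ Icc (0 : ℝ) 1, ∀ᵐ x, (μ t : Measure ℝ).rnDeriv volume x ≤ ENNReal.ofReal A)
    {η : ℝ} (hη : 0 < η) {ν : ℝ → SignedMeasure ℝ} (hCE : IsCE μ ν)
    (hfin : totalAction p M m μ ν < ⊤) :
    ∃ (K : Set ℝ) (l : ℝ) (μ' : ℝ → ProbabilityMeasure ℝ) (ν' : ℝ → SignedMeasure ℝ),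
      totalAction p M m μ' ν' ≤ totalAction p M m μ ν + ENNReal.ofReal η ∧
      IsRegularCurve M K l B μ' ν' ∧
      ∀ (q : ℝ), 1 ≤ q → q ≤ p → ∀ t ∈ Icc (0 : ℝ) 1,
        max
          (ENNReal.ofReal
              (max (Metric.diam (μ' t : Measure ℝ).support ^ (p - q)) 1)
            * wasserstein q (μ t : Measure ℝ) (μ' t : Measure ℝ) ^ q)
          (∫⁻ x in (μ' t : Measure ℝ).supportᶜ,
            ENNReal.ofReal (|x| ^ p + 1) ∂(μ t : Measure ℝ))
          ≤ ENNReal.ofReal η := by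
  have hp0 : 0 ≤ p := by linarith
  have hB0 : 0 < B := hA0.trans_lt hAB
  have hAM : ∀ t ∈ Icc (0 : ℝ) 1, ∀ᵐ x, (μ t : Measure ℝ).rnDeriv volume x ≤ ENNReal.ofReal M :=
    fun t ht => by
      filter_upwards [hA t ht] with x hx
      exact hx.trans (ENNReal.ofReal_le_ofReal (hAB.trans hBM).le)
  obtain ⟨Θ, hΘ0, hΘ⟩ := hθ.exists_bound hm
  have hTV : ∫⁻ t in Ioo (0 : ℝ) 1, (ν t).totalVariation univ < ⊤ := by
    calc _ ≤ ∫⁻ t in Ioo (0 : ℝ) 1, (action p M m (μ t : Measure ℝ) (ν t) + ENNReal.ofReal Θ) :=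
          lintegral_mono fun t => totalVariation_univ_le_action hp hΘ0 hΘ _ _
      _ = totalAction p M m μ ν + ∫⁻ t in Ioo (0 : ℝ) 1, ENNReal.ofReal Θ :=
          lintegral_add_right _ measurable_const
      _ < ⊤ := ENNReal.add_lt_top.2 ⟨hfin, by simp⟩
  have hI := hCE.isIntegratedCE hTV
  set μe : ℝ → Measure ℝ := extendTime fun t => (μ t : Measure ℝ) with hμe
  set νe : ℝ → SignedMeasure ℝ := extendTime ν with hνe
  have hprob : ∀ t, IsProbabilityMeasure (μe t) := hI.prob
  have eμ : ∀ t ∈ Icc (0 : ℝ) 1, μe t = μ t := fun t ht => extendTime_of_mem _ ht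
  have eν : ∀ t ∈ Icc (0 : ℝ) 1, νe t = ν t := fun t ht => extendTime_of_mem _ ht
  have hJ : ∀ ε, 0 < ε → ∀ t ∈ Icc (0 : ℝ) 1,
      ∫⁻ y, actionDensity p M m (convMeasure (mollifier ε) (μe t) y)
        (convSigned (mollifier ε) (νe t) y) ≤ action p M m (μ t : Measure ℝ) (ν t) := by
    intro ε hε t ht
    rw [eμ t ht, eν t ht]
    exact lintegral_actionDensity_conv_le hp hM.le hm hε (hAM t ht) (ν t)
  have hJfin : ∀ ε, 0 < ε → ∫⁻ t in Ioo (0 : ℝ) 1,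
      ∫⁻ y, actionDensity p M m (convMeasure (mollifier ε) (μe t) y)
        (convSigned (mollifier ε) (νe t) y) < ⊤ := fun ε hε =>
    (setLIntegral_mono' measurableSet_Ioo fun t ht => hJ ε hε t (Ioo_subset_Icc_self ht)).trans_lt
      hfin
  have h0' : ∫⁻ x, ENNReal.ofReal (|x| ^ p) ∂μe 0 < ⊤ := by
    rwa [eμ 0 (by simp)]
  have htail : ∀ θ : ℝ≥0∞, 0 < θ → ∃ R₀ : ℝ, 1 ≤ R₀ ∧ ∀ t ∈ Icc (0 : ℝ) 1,
      ∫⁻ x in {x | R₀ ≤ |x|}, ENNReal.ofReal (|x| ^ p) ∂μe t ≤ θ := fun θ hθ =>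
    hI.exists_tail_bound hp hM.le hm hΘ (hJfin 1 one_pos) h0' hθ
  obtain ⟨D, hD, hDb⟩ := exists_deriv_cutoff_bound
  obtain ⟨R₁, hR₁, htail₁⟩ := htail 1 one_pos
  -- The tail at level 1 gives the uniform moment bound 1 + R₁^p. Then κ and τ are fixed, next R₀
  -- from τ, then R, ε and δ, and last the drift, whose choice depends on all of these.
  obtain ⟨κ, τ, hκ, hκ1, hτ, hτη, hpar⟩ := exists_parameters (p := p) (Mom := 1 + R₁ ^ p) hp0 hD
    (by positivity) hB0 hη
  obtain ⟨R₀, hR₀, htail₀⟩ := htail (ENNReal.ofReal τ) (by simpa using hτ)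
  obtain ⟨R, ε, hR₀R, hR2, hRB, hε, hε1, hδ, hδ1, hmass, hcost⟩ := hpar R₀
  set δ := κ / (4 * R) ^ p with hδdef
  have hR : 0 < R := by linarith
  obtain ⟨α, E, hα, hE, hEη, hgood⟩ := hI.exists_drift hp hm hε hR hδ hδ1 hD (hRB.trans hBM)
    (hJfin ε hε) hη
  have ha : IsAdmissible ε R δ α D := ⟨hε, hε1, hR2, hδ, hδ1, fun x => hDb R x hR, hα⟩
  have htailR : ∀ t ∈ Icc (0 : ℝ) 1,
      ∫⁻ x in {x | R - 1 ≤ |x|}, ENNReal.ofReal (|x| ^ p) ∂μe t ≤ ENNReal.ofReal τ := fun t ht =>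
    (lintegral_mono_set fun x (hx : R - 1 ≤ |x|) => hR₀R.trans hx).trans (htail₀ t ht)
  have hκμ : ∀ t ∈ Icc (0 : ℝ) 1, D * (μe t).real {x | R - 1 ≤ |x|} ≤ δ / 16 := fun t ht =>
    hmass _ (rpow_mul_measureReal_tail_le hp0 (by linarith) hτ.le (htailR t ht))
  have hρA : ∀ t ∈ Icc (0 : ℝ) 1, ∀ y, convMeasure (mollifier ε) (μe t) y ≤ A := fun t ht y => by
    rw [eμ t ht]
    exact convMeasure_mollifier_le hε (hac t ht) hA0 (hA t ht) y
  have hP : ∀ t : Icc (0 : ℝ) 1, ∃ P : ProbabilityMeasure ℝ,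
      (P : Measure ℝ) = regMeasure ε R δ α (μe t) t := fun t =>
    ⟨⟨_, ha.isProbabilityMeasure_regMeasure (hκμ t t.2) t.2⟩, rfl⟩
  choose P hP using hP
  classical
  set μ' : ℝ → ProbabilityMeasure ℝ := fun t => P (projIcc 0 1 zero_le_one t) with hμ'def
  set G := goodTimes ε R δ α νe with hG
  set ν' : ℝ → SignedMeasure ℝ := fun t =>
    if t ∈ G then volume.withDensityᵥ (regFlux ε R δ α (νe t)) else 0 with hν'def
  have hμ' : ∀ t ∈ Icc (0 : ℝ) 1, (μ' t : Measure ℝ) = regMeasure ε R δ α (μe t) t := fun t ht => by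
    simp only [hμ'def, projIcc_of_mem _ ht, hP]
  have hνG : ∀ t ∈ G, ν' t = volume.withDensityᵥ (regFlux ε R δ α (νe t)) := fun t ht => if_pos ht
  have hν0 : ∀ t ∉ G, ν' t = 0 := fun t ht => if_neg ht
  have hCE' : IsCE μ' ν' := hI.isCE_reg ha hκμ hμ' hνG hν0
    (measurableSet_goodTimes hI.measurable hε R δ α) hgood
  have hreg := ha.isRegularCurve hκμ hρA hAB hRB hBM hμ' hνG hν0 hCE'
  refine ⟨_, _, μ', ν', ?_, hreg, fun q hq hqp t ht => ?_⟩
  · calc totalAction p M m μ' ν'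
        ≤ ∫⁻ t in Ioo (0 : ℝ) 1, (action p M m (μ t : Measure ℝ) (ν t) + ENNReal.ofReal η) := by
          refine lintegral_mono_ae ((ae_restrict_iff' measurableSet_Ioo).2 ?_)
          filter_upwards [hgood] with t htG ht
          have ht' := Ioo_subset_Icc_self ht
          rw [hμ' t ht', hνG t (htG ht)]
          refine (ha.action_regMeasure_le hp hM.le hm (hκμ t ht') ht'
            (fun y => (hρA t ht' y).trans (hAB.trans hBM).le) (hRB.trans hBM).le hE (νe t)).trans ?_
          exact add_le_add (hJ ε hε t ht') hEη
      _ = totalAction p M m μ ν + ENNReal.ofReal η := by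
          rw [lintegral_add_right _ measurable_const, totalAction]
          simp
  · have hsupp : (μ' t : Measure ℝ).support = Icc (-(2 * R)) (2 * R) := by
      rw [hμ' t ht]; exact ha.support_regMeasure (hκμ t ht) ht
    rw [hsupp, Real.diam_Icc (by linarith), show 2 * R - -(2 * R) = 4 * R by ring, ← eμ t ht]
    refine max_le ?_ ?_
    · have hMom := lintegral_rpow_le_of_tail hp0 (htail₁ t ht)
      have := rpow_mul_wasserstein_le hq hqp (μ := μe t) (μ' := (μ' t : Measure ℝ)) hR2 hδ hδ1 hε hε1
        (((ha.continuous_regDensity (κ := μe t) (t := t)).sub ((continuous_const.mul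
          (continuous_cutoff R)).mul (contDiff_convMeasure (n := 0) (μe t) (contDiff_mollifier ε)
          (hasCompactSupport_mollifier hε)).continuous)).measurable.ennreal_ofReal)
        ((hμ' t ht).trans (ha.regMeasure_eq_add (hκμ t ht) ht)) hMom (htailR t ht)
      refine this.trans ((le_of_eq ?_).trans (ENNReal.ofReal_le_ofReal hcost))
      rw [ENNReal.ofReal_add (by positivity) (by positivity),
        ENNReal.ofReal_mul (p := 2 ^ p) (by positivity),
        ENNReal.ofReal_add (by positivity) (by positivity),
        ENNReal.ofReal_mul (p := δ * (4 * R) ^ p) (by positivity),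
        ENNReal.ofReal_mul (p := 2 * 8 ^ p) (by positivity),
        ENNReal.ofReal_add (by norm_num) (by positivity),
        ENNReal.ofReal_add (p := 1) (by norm_num) (by positivity)]
      simp
    · refine (setLIntegral_compl_Icc_le hp0 (by linarith) (htailR t ht)).trans ?_
      rw [← ENNReal.ofReal_ofNat 2, ← ENNReal.ofReal_mul (by norm_num)]
      exact ENNReal.ofReal_le_ofReal hτη

end

end NonlinearTransport

end

/-! ### One regular curve for all fluxes -/

open NonlinearTransport in
theorem proposition4p7
    (M : ℝ) (hM : 0 < M) (Mbar : ℝ) (hMbar : Mbar < M) :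
    ∃ Mtilde : ℝ, Mtilde < M ∧
      ∀ (p : ℝ), 1 < p →
      ∀ (m : ℝ → ℝ), IsMobility M m → BoundedTheta M m →
      ∀ (μ : ℝ → ProbabilityMeasure ℝ),
        (∫⁻ x, ENNReal.ofReal (|x| ^ p) ∂(μ 0 : Measure ℝ)) < ⊤ →
        (∀ t ∈ Icc (0 : ℝ) 1, (μ t : Measure ℝ) ≪ volume) →
        (⨆ t ∈ Icc (0 : ℝ) 1, essSup ((μ t : Measure ℝ).rnDeriv volume) volume)
          ≤ ENNReal.ofReal Mbar →
      ∀ (η : ℝ), 0 < η →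
        ∃ (K : Set ℝ) (l : ℝ), IsCompact K ∧ 0 < l ∧ l ≤ Mtilde ∧
          ∀ (ν : ℝ → SignedMeasure ℝ), IsCE μ ν → totalAction p M m μ ν < ⊤ →
            ∃ (μ' : ℝ → ProbabilityMeasure ℝ) (ν' : ℝ → SignedMeasure ℝ),
              IsCE μ' ν' ∧
              totalAction p M m μ' ν' ≤ totalAction p M m μ ν + ENNReal.ofReal η ∧
              IsRegularCurve M K l Mtilde μ' ν' ∧
              ∀ (q : ℝ), 1 ≤ q → q ≤ p → ∀ t ∈ Icc (0 : ℝ) 1,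
                max
                  (ENNReal.ofReal
                      (max (Metric.diam (μ' t : Measure ℝ).support ^ (p - q)) 1)
                    * wasserstein q (μ t : Measure ℝ) (μ' t : Measure ℝ) ^ q)
                  (∫⁻ x in (μ' t : Measure ℝ).supportᶜ,
                    ENNReal.ofReal (|x| ^ p + 1) ∂(μ t : Measure ℝ))
                  ≤ ENNReal.ofReal η := by
  have hA0 : 0 ≤ max Mbar 0 := le_max_right _ _
  have hAM : max Mbar 0 < M := max_lt hMbar hM
  have hAB : max Mbar 0 < (M + max Mbar 0) / 2 := by linarith
  have hBM : (M + max Mbar 0) / 2 < M := by linarith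
  -- The midpoint leaves room above the density bound. A negative Mbar acts as 0, as it does under
  -- `ENNReal.ofReal`.
  refine ⟨(M + max Mbar 0) / 2, hBM, fun p hp m hm hθ μ h0 hac hsup η hη => ?_⟩
  have hA : ∀ t ∈ Icc (0 : ℝ) 1, ∀ᵐ x, (μ t : Measure ℝ).rnDeriv volume x
      ≤ ENNReal.ofReal (max Mbar 0) := by
    intro t ht
    filter_upwards [ae_le_essSup (μ := volume) (f := (μ t : Measure ℝ).rnDeriv volume)] with x hx
    exact hx.trans ((le_iSup₂_of_le t ht le_rfl).trans
      (hsup.trans (ENNReal.ofReal_le_ofReal (le_max_left _ _))))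
  -- Without a flux of finite action the claim about ν is vacuous, and any K and l will do.
  by_cases hex : ∃ ν, IsCE μ ν ∧ totalAction p M m μ ν < ⊤
  swap
  · exact ⟨∅, (M + max Mbar 0) / 2, isCompact_empty, by linarith, le_rfl,
      fun ν h1 h2 => absurd ⟨ν, h1, h2⟩ hex⟩
  obtain ⟨ν₁, hν₁, hν₁fin⟩ := hex
  set S : ℝ≥0∞ := ⨅ (ν : ℝ → SignedMeasure ℝ) (_ : IsCE μ ν), totalAction p M m μ ν with hS
  have hSfin : S ≠ ⊤ := ((iInf₂_le ν₁ hν₁).trans_lt hν₁fin).ne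
  have hSlt : S < S + ENNReal.ofReal (η / 2) :=
    ENNReal.lt_add_right hSfin (by simpa using half_pos hη)
  -- ν₀ depends on μ and η only. Half of η is the gap to the infimum, the other half the
  -- approximation error, so the resulting curve is admissible for every ν.
  obtain ⟨ν₀, hν₀, hν₀lt⟩ : ∃ ν₀, IsCE μ ν₀ ∧
      totalAction p M m μ ν₀ < S + ENNReal.ofReal (η / 2) := by
    by_contra! hcon
    exact hSlt.not_ge (le_iInf₂ hcon)
  have hν₀fin : totalAction p M m μ ν₀ < ⊤ :=
    hν₀lt.trans (ENNReal.add_lt_top.2 ⟨hSfin.lt_top, ENNReal.ofReal_lt_top⟩)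
  obtain ⟨K, l, μ', ν', hact, hreg, hW⟩ := exists_regular_approximation hM hA0 hAB hBM hp hm hθ h0
    hac hA (half_pos hη) hν₀ hν₀fin
  refine ⟨K, l, hreg.isCompact, hreg.l_pos, hreg.l_le, fun ν hν _ =>
    ⟨μ', ν', hreg.isCE, ?_, hreg, fun q hq hqp t ht => ?_⟩⟩
  · calc totalAction p M m μ' ν' ≤ totalAction p M m μ ν₀ + ENNReal.ofReal (η / 2) := hact
      _ ≤ (S + ENNReal.ofReal (η / 2)) + ENNReal.ofReal (η / 2) := by gcongr
      _ = S + ENNReal.ofReal η := by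
          rw [add_assoc, ← ENNReal.ofReal_add (by positivity) (by positivity), add_halves]
      _ ≤ totalAction p M m μ ν + ENNReal.ofReal η := by gcongr; exact iInf₂_le ν hν
  · exact (hW q hq hqp t ht).trans (ENNReal.ofReal_le_ofReal (by linarith))
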